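/- **Setting.** Let $\Omega=[l,u]=\{x\in\mathbb R^n: l\le x\le u\}$ with $-l,u\in[0,\infty]^n$, $l<u$ componentwise; $\lambda_1>0$, $\lambda_2\ge 0$, $p\in\{1,2\}$, $w_1,\dots,w_L\ge 0$; $G_1,\dots,G_L$ index sets with union $\{1,\dots,n\}$, and $x_{(l)}$ the restriction of $x$ to $G_l$. Let $f=f_n+f_s$ with $f_n,f_s:\mathbb R^n\to\mathbb R$ convex, $f_s$ differentiable, and $\nabla f_s$ Lipschitz with constant $L_s>0$. Consider $$\min_{x\in\Omega}F_0(x)=f(x)+\lambda_1\|x\|_0+\lambda_2\sum_{l=1}^L w_l\,\mathcal I(\|x_{(l)}\|_p),\qquad \mathcal I(t)=1\text{ if }t\ne0,\ \mathcal I(0)=0 .\tag{1}$$ Assume that $f$ is Lipschitz continuous on $\Omega$ and level-bounded on $\Omega$ (all sets $\{x\in\Omega: f(x)\le r\}$ are bounded), that $L_f$ is a real number with $|\xi_j|\le L_f$ for all $j$ and all $\xi\in\partial f(x)$, $x\in\Omega$, and all $\xi\in\partial f_n(x)+\partial f_s(y)$, $x,y\in\Omega$, and that $0<\nu<\min\{\lambda_1/L_f,\vartheta\}$,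 where $\vartheta$ is the minimum of all nonzero $|l_i|$ and nonzero $u_j$ (and $\lambda_1/0:=\infty$). A $\nu$-strong local minimizer of (1) is a local minimizer $x\in\Omega$ of $F_0$ on $\Omega$ with $|x_j|\ge\nu$ whenever $x_j\ne0$. For $\mu>0$ put $\theta_1(t;\mu)=0$, $\theta_2(t;\mu)=t/\mu-1$, $\theta_3(t;\mu)=-t/\mu-1$, $R(x;\mu)=\frac{\lambda_1}{\mu}\|x\|_1+\frac{\lambda_2}{\mu}\sum_l w_l\|x_{(l)}\|_p$, $$\Theta_{I,J}(x;\mu)=\lambda_1\sum_j\theta_{I_j}(x_j;\mu)+\lambda_2\sum_l w_l\theta_{J_l}(\|x_{(l)}\|_p;\mu)\qquad (I\in\{1,2,3\}^n,\ J\in\{1,2\}^L),$$ $$F(x;\mu)=f(x)+R(x;\mu)-\lambda_1\sum_j\max_{i=1,2,3}\theta_i(x_j;\mu)-\lambda_2\sum_l w_l\max_{i=1,2}\theta_i(\|x_{(l)}\|_p;\mu),$$ $$w_{I,J,\xi}(x;\mu,y,z)=f_n(x)+R(x;\mu)+f_s(y)+\langle\nabla f_s(y),x-y\rangle-\Theta_{I,J}(z;\mu)-\langle\xi,x-z\rangle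 .$$ Let $(\mu_k)$ be given by $\mu_k=\bar\mu_k$ for $k<K$ and $\mu_k=\nu$ for $k\ge K$, where $K\in\mathbb N$ and $(\bar\mu_k)$ is nonincreasing with $\bar\mu_{K-1}\ge\nu\ge\bar\mu_K$ (only $\nu\ge\bar\mu_K$ if $K=0$). Given iterates $x^k$, let $I^k_j$ and $J^k_l$ be the largest indices maximizing $\theta_i(x^k_j;\tau_k)$ over $i\in\{1,2,3\}$ and $\theta_i(\|x^k_{(l)}\|_p;\tau_k)$ over $i\in\{1,2\}$, where each $\tau_k$ is $\nu$ or $\mu_k$ (the choice is arbitrary). *Algorithm 1 (line search, with $N=0$).* Take $x^0\in\Omega$, $\rho>1$, $c\in(0,L_s]$, $0<\underline\alpha\le\bar\alpha$. At iteration $k\ge 0$ choose $\alpha^B_k\in[\underline\alpha,\bar\alpha]$; for $m=0,1,\dots$ put $\alpha_k=\alpha^B_k\rho^m$, take $\xi^k\in\partial\Theta_{I^k,J^k}(\cdot\,;\mu_k)(x^k)$ and compute $x^k(\alpha_k)=\operatorname{argmin}_{x\in\Omega}\{w_{I^k,J^k,\xi^k}(x;\mu_k,x^k,x^k)+\frac{\alpha_k}2\|x-x^k\|^2\}$;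 at the first $m$ for which $F(x^k(\alpha_k);\mu_k)\le F(x^k;\mu_k)-\frac c2\|x^k(\alpha_k)-x^k\|^2$, set $x^{k+1}=x^k(\alpha_k)$. *Algorithm 2 (extrapolation).* Take $x^0\in\Omega$, $\beta\in[0,1)$, and any $x^{-1}\in\mathbb R^n$ (e.g. $x^{-1}=x^0$). At iteration $k\ge0$ choose $\beta_k\in[0,\beta]$, put $y^k=x^k+\beta_k(x^k-x^{k-1})$, take $\xi^k\in\partial\Theta_{I^k,J^k}(\cdot\,;\mu_k)(x^k)$ and set $x^{k+1}=\operatorname{argmin}_{x\in\Omega}\{w_{I^k,J^k,\xi^k}(x;\mu_k,y^k,x^k)+\frac{L_s}2\|x-y^k\|^2\}$. *KL property.* $\partial$ denotes the convex subdifferential. A proper closed convex function $h$ with values in $(-\infty,\infty]$ has the KL property at $\hat x\in\operatorname{dom}\partial h$ if there are $a\in(0,\infty]$, a continuous concave $\varphi:[0,a)\to[0,\infty)$ with $\varphi(0)=0$, continuously differentiable on $(0,a)$ with $\varphi'>0$ there, and a neighbourhood $V$ of $\hat x$ such that $\varphi'(h(x)-h(\hat x))\operatorname{dist}(0,\partial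 h(x))\ge1$ for all $x\in V$ with $h(\hat x)<h(x)<h(\hat x)+a$. The exponent is $\alpha\in[0,1)$ if $\varphi(t)=a_0t^{1-\alpha}$, $a_0>0$, can be taken. $h$ is a KL function if it has the KL property at every point of $\operatorname{dom}\partial h$. **Theorem.** Let $\{x^k\}$ be generated by Algorithm 1 with $N=0$ (resp. by Algorithm 2). Then $\{x^k\}$ has an accumulation point. Let $x^*$ be any accumulation point, put $\check\Omega=\{x\in\Omega: x_j=0\text{ whenever }x^*_j=0\}$, let $\delta_{\check\Omega}$ be $0$ on $\check\Omega$ and $\infty$ elsewhere, and $H(x,y)=f(x)+\frac{L_s}2\|x-y\|^2+\delta_{\check\Omega}(x)$ on $\mathbb R^n\times\mathbb R^n$. If $f+\delta_{\check\Omega}$ (resp. $H$) is a KL function, then $x^k\to x^*$, $x^*$ is a $\nu$-strong local minimizer of (1), and $\sum_{k=0}^\infty\|x^{k+1}-x^k\|<\infty$. If moreover $f+\delta_{\check\Omega}$ has the KL property at $x^*$ (resp. $H$ has the KL property at $(x^*,x^*)$) with exponent $\alpha\in[0,1)$, then: (i) if $\alpha=0$, then $x^k=x^*$ for all sufficiently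 large $k$; (ii) if $\alpha\in(0,\frac12]$, there are $c>0$ and $q\in[0,1)$ with $\|x^k-x^*\|\le cq^k$ for all $k\ge0$; (iii) if $\alpha\in(\frac12,1)$, there is $c>0$ with $\|x^k-x^*\|\le ck^{-\frac{1-\alpha}{2\alpha-1}}$ for all $k\ge1$. -/

import Mathlib

open Filter Topology Set

noncomputable section

/-! ### Convex subdifferential, indicator functions, Kurdyka-Lojasiewicz property -/

/-- The convex subdifferential of an extended-real-valued function. For proper `h` it is empty
outside the effective domain of `h`. -/
def subdifferential {V : Type*} [NormedAddCommGroup V] [InnerProductSpace ℝ V]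
    (h : V → EReal) (x : V) : Set V :=
  {ξ | ∀ y, h x + ((inner ℝ ξ (y - x) : ℝ) : EReal) ≤ h y}

open Classical in
/-- The indicator function of convex analysis: `0` on `S` and `+∞` off `S`. -/
def indicatorTop {V : Type*} (S : Set V) (x : V) : EReal := if x ∈ S then 0 else ⊤

/-- `φ : [0, a) → [0, ∞)` is a desingularizing function; only its values on `[0, a)` matter,
and `a = ∞` is allowed. -/
structure IsDesingularizing (a : EReal) (φ : ℝ → ℝ) : Prop where
  pos_a : 0 < a
  nonneg : ∀ t : ℝ, 0 ≤ t → (t : EReal) < a → 0 ≤ φ t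
  continuousOn : ContinuousOn φ {t : ℝ | 0 ≤ t ∧ (t : EReal) < a}
  concaveOn : ConcaveOn ℝ {t : ℝ | 0 ≤ t ∧ (t : EReal) < a} φ
  contDiffOn : ContDiffOn ℝ 1 φ {t : ℝ | 0 < t ∧ (t : EReal) < a}
  map_zero : φ 0 = 0
  deriv_pos : ∀ t : ℝ, 0 < t → (t : EReal) < a → 0 < deriv φ t

/-- The KL inequality for `h` at `xh` with the desingularizing function `φ` on `[0, a)`:
`xh ∈ dom ∂h`, and `φ'(h x - h xh) * dist (0, ∂h x) ≥ 1` for all `x` in some neighbourhood of `xh`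
with `h xh < h x < h xh + a`. The distance to the empty set is `+∞`. -/
def HasKLWith {V : Type*} [NormedAddCommGroup V] [InnerProductSpace ℝ V]
    (h : V → EReal) (xh : V) (a : EReal) (φ : ℝ → ℝ) : Prop :=
  (subdifferential h xh).Nonempty ∧ IsDesingularizing a φ ∧
    ∃ U ∈ 𝓝 xh, ∀ x ∈ U, h xh < h x → h x < h xh + a →
      1 ≤ ENNReal.ofReal (deriv φ ((h x).toReal - (h xh).toReal)) *
        Metric.infEDist 0 (subdifferential h x)

/-- `h` has the KL property at `xh`. -/
def HasKLAt {V : Type*} [NormedAddCommGroup V] [InnerProductSpace ℝ V]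
    (h : V → EReal) (xh : V) : Prop :=
  ∃ (a : EReal) (φ : ℝ → ℝ), HasKLWith h xh a φ

/-- `h` has the KL property at `xh` with exponent `α`: one can take `φ t = a₀ t ^ (1 - α)`. -/
def HasKLExponentAt {V : Type*} [NormedAddCommGroup V] [InnerProductSpace ℝ V]
    (h : V → EReal) (xh : V) (α : ℝ) : Prop :=
  ∃ (a : EReal) (a₀ : ℝ), 0 < a₀ ∧ HasKLWith h xh a (fun t => a₀ * t ^ (1 - α))

/-- `h` is a KL function: it has the KL property at every point of `dom ∂h`. -/
def IsKLFunction {V : Type*} [NormedAddCommGroup V] [InnerProductSpace ℝ V]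
    (h : V → EReal) : Prop :=
  ∀ xh, (subdifferential h xh).Nonempty → HasKLAt h xh

/-! ### The sparse group problem -/

/-- The data of the sparse group `ℓ₀` problem in `ℝⁿ` with `L` groups: the two parts of the loss
`f = fn + fs`, the box `[lo, hi]` (infinite bounds allowed), the regularization parameters, the
group norm exponent `p`, the weights, the groups, and the parameter `ν` of the relaxation. -/
structure SparseGroupProblem (n L : ℕ) where
  fn : EuclideanSpace ℝ (Fin n) → ℝ
  fs : EuclideanSpace ℝ (Fin n) → ℝ
  lo : Fin n → EReal
  hi : Fin n → EReal
  lam1 : ℝ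
  lam2 : ℝ
  p : ℕ
  w : Fin L → ℝ
  G : Fin L → Finset (Fin n)
  ν : ℝ

/-- The functions `θ₁ = 0`, `θ₂(t; μ) = t / μ - 1`, `θ₃(t; μ) = - t / μ - 1`
(indexed by `0, 1, 2`). -/
def theta (i : Fin 3) (t μ : ℝ) : ℝ := ![0, t / μ - 1, -t / μ - 1] i

open Classical in
/-- The largest index at which a finite family of reals attains its maximum. -/
def maxArgmax {m : ℕ} [NeZero m] (g : Fin m → ℝ) : Fin m :=
  (Finset.univ.filter fun i => ∀ i', g i' ≤ g i).max' (by
    obtain ⟨i, -, hi⟩ := Finset.exists_max_image Finset.univ g Finset.univ_nonempty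
    exact ⟨i, by simpa using hi⟩)

namespace SparseGroupProblem

variable {n L : ℕ} (P : SparseGroupProblem n L)

/-- The loss function `f = fn + fs`. -/
def f (x : EuclideanSpace ℝ (Fin n)) : ℝ := P.fn x + P.fs x

/-- The box `Ω = [lo, hi]`. -/
def Omega : Set (EuclideanSpace ℝ (Fin n)) :=
  {x | ∀ j, P.lo j ≤ ((x j : ℝ) : EReal) ∧ ((x j : ℝ) : EReal) ≤ P.hi j}

/-- The group norm `‖x_(l)‖_p`. -/
def groupNorm (x : EuclideanSpace ℝ (Fin n)) (l : Fin L) : ℝ :=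
  (∑ j ∈ P.G l, |x j| ^ P.p) ^ (1 / (P.p : ℝ))

open Classical in
/-- The objective `F₀ = f + λ₁ ‖·‖₀ + λ₂ ∑ w_l 𝟙(‖x_(l)‖_p ≠ 0)`. -/
def F0 (x : EuclideanSpace ℝ (Fin n)) : ℝ :=
  P.f x + P.lam1 * ∑ j, (if x j ≠ 0 then (1 : ℝ) else 0)
    + P.lam2 * ∑ l, P.w l * (if P.groupNorm x l ≠ 0 then (1 : ℝ) else 0)

/-- A `ν`-strong local minimizer: a local minimizer of `F₀` on `Ω` all of whose nonzero entries
have absolute value at least `ν`. -/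
def IsStrongLocalMinimizer (x : EuclideanSpace ℝ (Fin n)) : Prop :=
  x ∈ P.Omega ∧ IsLocalMinOn P.F0 P.Omega x ∧ ∀ j, x j ≠ 0 → P.ν ≤ |x j|

/-- The penalty `(λ₁ / μ) ‖x‖₁ + (λ₂ / μ) ∑ w_l ‖x_(l)‖_p`. -/
def convexPenalty (x : EuclideanSpace ℝ (Fin n)) (μ : ℝ) : ℝ :=
  P.lam1 / μ * ∑ j, |x j| + P.lam2 / μ * ∑ l, P.w l * P.groupNorm x l

/-- The relaxed objective
`F(x; μ) = f(x) + (λ₁/μ)‖x‖₁ + (λ₂/μ) ∑ w_l ‖x_(l)‖_p`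
`- λ₁ ∑ max_{i=1,2,3} θ_i(x_j; μ) - λ₂ ∑ w_l max_{i=1,2} θ_i(‖x_(l)‖_p; μ)`. -/
def F (x : EuclideanSpace ℝ (Fin n)) (μ : ℝ) : ℝ :=
  P.f x + P.convexPenalty x μ
    - P.lam1 * ∑ j, Finset.univ.sup' Finset.univ_nonempty (fun i : Fin 3 => theta i (x j) μ)
    - P.lam2 * ∑ l, P.w l * Finset.univ.sup' Finset.univ_nonempty
        (fun i : Fin 2 => theta i.castSucc (P.groupNorm x l) μ)

/-- `Θ_{I,J}(x; μ) = λ₁ ∑ θ_{I_j}(x_j; μ) + λ₂ ∑ w_l θ_{J_l}(‖x_(l)‖_p; μ)`. -/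
def Theta (I : Fin n → Fin 3) (J : Fin L → Fin 2) (x : EuclideanSpace ℝ (Fin n)) (μ : ℝ) : ℝ :=
  P.lam1 * ∑ j, theta (I j) (x j) μ
    + P.lam2 * ∑ l, P.w l * theta (J l).castSucc (P.groupNorm x l) μ

/-- The index vector `I^x` at level `τ`: the largest index maximizing `θ_i(x_j; τ)`. -/
def activeI (x : EuclideanSpace ℝ (Fin n)) (τ : ℝ) (j : Fin n) : Fin 3 :=
  maxArgmax fun i : Fin 3 => theta i (x j) τ

/-- The index vector `J^x` at level `τ`: the largest index in `{1, 2}` maximizing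
`θ_i(‖x_(l)‖_p; τ)`. -/
def activeJ (x : EuclideanSpace ℝ (Fin n)) (τ : ℝ) (l : Fin L) : Fin 2 :=
  maxArgmax fun i : Fin 2 => theta i.castSucc (P.groupNorm x l) τ

/-- The model function `w_{I,J,ξ}(x; μ, y, z)` of the subproblems. -/
def model (I : Fin n → Fin 3) (J : Fin L → Fin 2) (ξ : EuclideanSpace ℝ (Fin n)) (μ : ℝ)
    (y z x : EuclideanSpace ℝ (Fin n)) : ℝ :=
  P.fn x + P.convexPenalty x μ + P.fs y + inner ℝ (gradient P.fs y) (x - y)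
    - P.Theta I J z μ - inner ℝ ξ (x - z)

/-- `x⁺` solves the subproblem at level `μ` with indices `I^z, J^z` taken at level `τ`:
`ξ ∈ ∂Θ_{I,J}(z; μ)` and
`x⁺ ∈ argmin_{x ∈ Ω} w_{I,J,ξ}(x; μ, y, z) + (α / 2) ‖x - y‖²`. -/
def SolvesSubproblem (μ τ α : ℝ) (y z ξ xplus : EuclideanSpace ℝ (Fin n)) : Prop :=
  ξ ∈ subdifferential
      (fun v => ((P.Theta (activeI z τ) (P.activeJ z τ) v μ : ℝ) : EReal)) z ∧
    xplus ∈ P.Omega ∧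
    IsMinOn (fun x => P.model (activeI z τ) (P.activeJ z τ) ξ μ y z x + α / 2 * ‖x - y‖ ^ 2)
      P.Omega xplus

/-- The standing assumptions on the problem, with the constants `Lf` and `Ls`. The condition
`ν * Lf < lam1` is `ν < λ₁ / Lf` (read as `ν < ∞` if `Lf = 0`), and `nu_lt_lo`, `nu_lt_hi` say that
`ν` is less than the absolute value of each nonzero bound of the box. -/
structure StandingAssumptions (Lf Ls : ℝ) : Prop where
  lo_nonpos : ∀ j, P.lo j ≤ 0
  hi_nonneg : ∀ j, 0 ≤ P.hi j
  lo_lt_hi : ∀ j, P.lo j < P.hi j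
  lam1_pos : 0 < P.lam1
  lam2_nonneg : 0 ≤ P.lam2
  p_eq : P.p = 1 ∨ P.p = 2
  w_nonneg : ∀ l, 0 ≤ P.w l
  groups_cover : ∀ j, ∃ l, j ∈ P.G l
  fn_convex : ConvexOn ℝ univ P.fn
  fs_convex : ConvexOn ℝ univ P.fs
  fs_differentiable : Differentiable ℝ P.fs
  Ls_pos : 0 < Ls
  fs_gradient_lipschitz : ∀ x y, ‖gradient P.fs x - gradient P.fs y‖ ≤ Ls * ‖x - y‖
  f_lipschitz : ∃ C : NNReal, LipschitzOnWith C P.f P.Omega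
  f_levelBounded : ∀ r : ℝ, Bornology.IsBounded {x ∈ P.Omega | P.f x ≤ r}
  Lf_bound : ∀ x ∈ P.Omega, ∀ ξ ∈ subdifferential (fun v => ((P.f v : ℝ) : EReal)) x,
    ∀ j, |ξ j| ≤ Lf
  Lf_bound_split : ∀ x ∈ P.Omega, ∀ y ∈ P.Omega,
    ∀ ξ ∈ subdifferential (fun v => ((P.fn v : ℝ) : EReal)) x,
    ∀ η ∈ subdifferential (fun v => ((P.fs v : ℝ) : EReal)) y,
    ∀ j, |(ξ + η) j| ≤ Lf
  nu_pos : 0 < P.ν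
  nu_mul_Lf_lt : P.ν * Lf < P.lam1
  nu_lt_lo : ∀ j, P.lo j ≠ 0 → P.lo j < ((-P.ν : ℝ) : EReal)
  nu_lt_hi : ∀ j, P.hi j ≠ 0 → ((P.ν : ℝ) : EReal) < P.hi j

/-- A smoothing schedule: there are `K` and a nonincreasing sequence `μbar` with
`μbar (K - 1) ≥ ν ≥ μbar K` (the first inequality is void if `K = 0`) such that
`μ k = μbar k` for `k < K` and `μ k = ν` for `k ≥ K`. -/
def IsSchedule (μ : ℕ → ℝ) : Prop :=
  ∃ (K : ℕ) (μbar : ℕ → ℝ), Antitone μbar ∧ (0 < K → P.ν ≤ μbar (K - 1)) ∧ μbar K ≤ P.ν ∧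
    (∀ k < K, μ k = μbar k) ∧ ∀ k, K ≤ k → μ k = P.ν

/-- The acceptance test of the line search with memory `N` at iteration `k`. -/
def LineSearchTest (c : ℝ) (N : ℕ) (μ : ℕ → ℝ) (x : ℕ → EuclideanSpace ℝ (Fin n)) (k : ℕ)
    (v : EuclideanSpace ℝ (Fin n)) : Prop :=
  P.F v (μ k) ≤
    (Finset.Icc (k - N) k).sup' (Finset.nonempty_Icc.mpr (Nat.sub_le k N))
      (fun j => P.F (x j) (μ k)) - c / 2 * ‖v - x k‖ ^ 2

/-- `x` is a sequence of iterates of the DC algorithm with line search (memory `N`).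
At iteration `k` the trial points `v k 0, v k 1, …, v k (m k)`, with proximal parameters
`αB k * ρ ^ i`, are computed; all but the last one are rejected and the last one is accepted. The
subgradient may be chosen anew for each trial point. The index vectors of iteration `k` are taken
at the level `τ k`, which is `ν` or `μ k`. -/
def IsLineSearchRun (Ls : ℝ) (N : ℕ) (μ : ℕ → ℝ) (x : ℕ → EuclideanSpace ℝ (Fin n)) : Prop :=
  x 0 ∈ P.Omega ∧
  ∃ ρ c αlo αhi : ℝ, 1 < ρ ∧ 0 < c ∧ c ≤ Ls ∧ 0 < αlo ∧ αlo ≤ αhi ∧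
  ∃ (τ αB : ℕ → ℝ) (m : ℕ → ℕ) (ξ v : ℕ → ℕ → EuclideanSpace ℝ (Fin n)), ∀ k,
    (τ k = P.ν ∨ τ k = μ k) ∧
    αlo ≤ αB k ∧ αB k ≤ αhi ∧
    (∀ i ≤ m k, P.SolvesSubproblem (μ k) (τ k) (αB k * ρ ^ i) (x k) (x k) (ξ k i) (v k i)) ∧
    (∀ i < m k, ¬ P.LineSearchTest c N μ x k (v k i)) ∧
    P.LineSearchTest c N μ x k (v k (m k)) ∧
    x (k + 1) = v k (m k)

/-- `x` is a sequence of iterates of the DC algorithm with extrapolation. The point `xm1` is the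
(arbitrary) value of `x^{-1}`, used only in `y⁰`. The index vectors of iteration `k` are taken
at the level `τ k`, which is `ν` or `μ k`. -/
def IsExtrapolationRun (Ls : ℝ) (μ : ℕ → ℝ) (x : ℕ → EuclideanSpace ℝ (Fin n)) : Prop :=
  x 0 ∈ P.Omega ∧
  ∃ β : ℝ, 0 ≤ β ∧ β < 1 ∧
  ∃ (xm1 : EuclideanSpace ℝ (Fin n)) (τ b : ℕ → ℝ) (y ξ : ℕ → EuclideanSpace ℝ (Fin n)),
    y 0 = x 0 + b 0 • (x 0 - xm1) ∧
    (∀ k, y (k + 1) = x (k + 1) + b (k + 1) • (x (k + 1) - x k)) ∧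
    ∀ k, (τ k = P.ν ∨ τ k = μ k) ∧ 0 ≤ b k ∧ b k ≤ β ∧
      P.SolvesSubproblem (μ k) (τ k) Ls (y k) (x k) (ξ k) (x (k + 1))

/-- The face `{x ∈ Ω : x_j = 0 whenever xs_j = 0}`. -/
def face (xs : EuclideanSpace ℝ (Fin n)) : Set (EuclideanSpace ℝ (Fin n)) :=
  {x ∈ P.Omega | ∀ j, xs j = 0 → x j = 0}

/-- `f + δ` with `δ` the indicator function of the face determined by `xs`. -/
def fFace (xs x : EuclideanSpace ℝ (Fin n)) : EReal :=
  ((P.f x : ℝ) : EReal) + indicatorTop (P.face xs) x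

/-- `H(x, y) = f(x) + (Ls / 2) ‖x - y‖² + δ(x)` on `ℝⁿ × ℝⁿ` with its Euclidean structure, with
`δ` the indicator function of the face determined by `xs`. -/
def HFace (Ls : ℝ) (xs : EuclideanSpace ℝ (Fin n))
    (z : WithLp 2 (EuclideanSpace ℝ (Fin n) × EuclideanSpace ℝ (Fin n))) : EReal :=
  ((P.f z.fst + Ls / 2 * ‖z.fst - z.snd‖ ^ 2 : ℝ) : EReal) + indicatorTop (P.face xs) z.fst

end SparseGroupProblem

/-- The convergence rate attached to the exponent `α ∈ [0, 1)`: finite convergence if `α = 0`,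
R-linear convergence if `0 < α ≤ 1/2`, and R-sublinear convergence with rate
`k ^ (-(1 - α) / (2 α - 1))` if `1/2 < α < 1`. -/
def ConvergesAtKLRate {V : Type*} [NormedAddCommGroup V] (x : ℕ → V) (xs : V) (α : ℝ) : Prop :=
  (α = 0 → ∃ k₀ : ℕ, ∀ k, k₀ ≤ k → x k = xs) ∧
  (0 < α → α ≤ 1 / 2 → ∃ c q : ℝ, 0 < c ∧ 0 ≤ q ∧ q < 1 ∧ ∀ k, ‖x k - xs‖ ≤ c * q ^ k) ∧
  (1 / 2 < α → α < 1 → ∃ c : ℝ, 0 < c ∧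
    ∀ k : ℕ, 1 ≤ k → ‖x k - xs‖ ≤ c * (k : ℝ) ^ (-((1 - α) / (2 * α - 1))))

end

/-! ### Kurdyka-Lojasiewicz descent sequences -/

/-! The schedule reaches `ν` after finitely many iterations, so only a tail with smoothing and index
levels both equal to `ν` matters. On it the model majorizes `F(·; ν)` up to a quadratic, and each
iteration gives descent: of `F` itself for the line search, of `F` plus `Ls / 2` times the squared
last step for extrapolation. Since `f ≤ F` and `f` is level-bounded on the box, the iterates have
cluster points and the steps tend to zero.

The nonconvexity then disappears by finite identification (`StandingAssumptions.identification`). If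
`|z j| < ν`, the subtracted piece for coordinate `j` is constant, so the next iterate feels the full
slope `λ₁ / ν > Lf` of the penalty. Keeping that entry nonzero would require a step bounded away
from zero. Hence every coordinate is eventually either identically zero or always at least `ν` in
absolute value, and vanishing steps freeze its sign. From then on all iterates lie on the face of
the cluster point, and `F` and `f` differ there by a constant.

With the pattern frozen, the slopes of the `ℓ₁` penalty cancel exactly along the face and those of
the group norms cancel up to a multiple of the step, because group norms that are at least `ν` have
Lipschitz gradients. The optimality condition therefore supplies a subgradient of `f` plus the
indicator of the face whose size is controlled by the steps (`exists_small_subgradient`). Passing to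
the limit shows that the limit minimizes `f` on its face. Nearby points off the face pay at least
`λ₁` more in `‖·‖₀`, which gives local minimality.

Both algorithms thus become instances of one abstract scheme, `IsKLDescent`: `f + δ` along the
iterates with last step `d k`, and `H` along pairs of consecutive iterates. The Kurdyka-Lojasiewicz
inequality combined with concavity of `φ` bounds the length of the trajectory by a telescoping sum
of `φ`-values, which gives summability and convergence. For `φ t = a₀ t ^ (1 - α)` it gives a scalar
recursion for the value gap, from which the rates follow. -/

theorem IsDesingularizing.deriv_mul_sub_le {a : EReal} {φ : ℝ → ℝ} (h : IsDesingularizing a φ)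
    {s t : ℝ} (hs : 0 < s) (hsa : (s : EReal) < a) (ht : 0 ≤ t) (hts : t ≤ s) :
    deriv φ s * (s - t) ≤ φ s - φ t := by
  rcases hts.eq_or_lt with rfl | hts
  · simp
  have hopen : IsOpen {t : ℝ | 0 < t ∧ (t : EReal) < a} :=
    (isOpen_lt continuous_const continuous_id).inter
      (isOpen_lt continuous_coe_real_ereal continuous_const)
  have hd : DifferentiableAt ℝ φ s :=
    (h.contDiffOn.differentiableOn (by norm_num)).differentiableAt (hopen.mem_nhds ⟨hs, hsa⟩)
  have := h.concaveOn.deriv_le_slope (x := t) (y := s)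
    ⟨ht, lt_trans (by exact_mod_cast hts) hsa⟩ ⟨hs.le, hsa⟩ hts hd
  rw [slope_def_field, le_div_iff₀ (by linarith)] at this
  exact this

/-- A sequence `z` along which `h` decreases sufficiently with step lengths `d`, with small
subgradients, and whose values converge to the value at the point `zs`. -/
structure IsKLDescent {V : Type*} [NormedAddCommGroup V] [InnerProductSpace ℝ V]
    (h : V → EReal) (z : ℕ → V) (zs : V) (r d : ℕ → ℝ) (rs a b : ℝ) : Prop where
  a_pos : 0 < a
  b_pos : 0 < b
  d_nonneg : ∀ k, 0 ≤ d k
  value : ∀ k, h (z k) = (r k : EReal)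
  value_lim : h zs = (rs : EReal)
  descent : ∀ k, r (k + 1) + a * d k ^ 2 ≤ r k
  subgrad : ∀ k, ∃ g ∈ subdifferential h (z (k + 1)), ‖g‖ ≤ b * (d k + d (k + 1))
  step : ∀ k, ‖z (k + 1) - z k‖ ≤ d k + d (k + 1)
  tendsto_value : Tendsto r atTop (𝓝 rs)

namespace IsKLDescent

variable {V : Type*} [NormedAddCommGroup V] [InnerProductSpace ℝ V]
  {h : V → EReal} {z : ℕ → V} {zs : V} {r d : ℕ → ℝ} {rs a b : ℝ}

theorem shift (H : IsKLDescent h z zs r d rs a b) (m : ℕ) :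
    IsKLDescent h (fun k => z (k + m)) zs (fun k => r (k + m)) (fun k => d (k + m)) rs a b where
  a_pos := H.a_pos
  b_pos := H.b_pos
  d_nonneg k := H.d_nonneg _
  value k := H.value _
  value_lim := H.value_lim
  descent k := by have := H.descent (k + m); rwa [show k + m + 1 = k + 1 + m by ring] at this
  subgrad k := by have := H.subgrad (k + m); rwa [show k + m + 1 = k + 1 + m by ring] at this
  step k := by have := H.step (k + m); rwa [show k + m + 1 = k + 1 + m by ring] at this
  tendsto_value := (tendsto_add_atTop_iff_nat m).2 H.tendsto_value

theorem antitone (H : IsKLDescent h z zs r d rs a b) : Antitone r :=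
  antitone_nat_of_succ_le fun k => by
    have := H.descent k
    have := mul_nonneg H.a_pos.le (sq_nonneg (d k))
    linarith

theorem lim_le (H : IsKLDescent h z zs r d rs a b) (k : ℕ) : rs ≤ r k :=
  H.antitone.le_of_tendsto H.tendsto_value k

theorem tendsto_d (H : IsKLDescent h z zs r d rs a b) : Tendsto d atTop (𝓝 0) := by
  have h1 : Tendsto (fun k => (r k - r (k + 1)) / a) atTop (𝓝 0) := by
    have := (H.tendsto_value.sub ((tendsto_add_atTop_iff_nat 1).2 H.tendsto_value)).div_const a
    simpa using this
  have h2 : Tendsto (fun k => d k ^ 2) atTop (𝓝 0) := by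
    refine squeeze_zero (fun k => sq_nonneg _) (fun k => ?_) h1
    rw [le_div_iff₀ H.a_pos]
    linarith [H.descent k]
  have h3 := h2.sqrt
  simpa [Real.sqrt_sq (H.d_nonneg _)] using h3

theorem d_eq_zero (H : IsKLDescent h z zs r d rs a b) {k : ℕ} (hk : r k ≤ rs) : d k = 0 := by
  have h1 := H.descent k
  have h2 := H.lim_le (k + 1)
  have h3 : d k ^ 2 ≤ 0 := by
    by_contra hcon
    push Not at hcon
    have := mul_pos H.a_pos hcon
    linarith
  exact pow_eq_zero_iff (two_ne_zero) |>.1 (le_antisymm h3 (sq_nonneg _))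

/-- The Kurdyka-Lojasiewicz inequality along the sequence. -/
theorem one_le_deriv_mul (H : IsKLDescent h z zs r d rs a b) {A : EReal} {φ : ℝ → ℝ}
    (hφ : IsDesingularizing A φ) {U : Set V}
    (hU : ∀ x ∈ U, h zs < h x → h x < h zs + A →
      1 ≤ ENNReal.ofReal (deriv φ ((h x).toReal - (h zs).toReal)) *
        Metric.infEDist 0 (subdifferential h x)) {k : ℕ} (hz : z (k + 1) ∈ U)
    (hpos : rs < r (k + 1)) (hA : ((r (k + 1) - rs : ℝ) : EReal) < A) :
    1 ≤ deriv φ (r (k + 1) - rs) * (b * (d k + d (k + 1))) := by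
  have hd := hφ.deriv_pos (r (k + 1) - rs) (by linarith) hA
  have h1 := hU _ hz (by rw [H.value, H.value_lim]; exact_mod_cast hpos) (by
    rw [H.value, H.value_lim]
    have h2 : (r (k + 1) : EReal) = (rs : EReal) + ((r (k + 1) - rs : ℝ) : EReal) := by
      rw [← EReal.coe_add]; congr 1; ring
    rw [h2]
    exact EReal.add_lt_add_left_coe hA rs)
  rw [H.value, H.value_lim, EReal.toReal_coe, EReal.toReal_coe] at h1
  obtain ⟨g, hg, hgn⟩ := H.subgrad k
  have h3 : Metric.infEDist 0 (subdifferential h (z (k + 1))) ≤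
      ENNReal.ofReal (b * (d k + d (k + 1))) := by
    refine (Metric.infEDist_le_edist_of_mem hg).trans ?_
    rw [edist_dist, dist_zero_left]
    exact ENNReal.ofReal_le_ofReal hgn
  have h4 := h1.trans (mul_le_mul_right h3 _)
  rw [← ENNReal.ofReal_mul hd.le, ENNReal.one_le_ofReal] at h4
  exact h4

/-- Let `Δ` be the drop of `φ` and `D = d k + d (k + 1)`. Descent, the KL inequality and concavity
give `a * d (k + 1) ^ 2 ≤ r (k + 1) - r (k + 2) ≤ Δ * b * D`, and the arithmetic-geometric mean
inequality linearizes the square. Weighting `D` by `1 / 4` leaves the coefficient 3 against 1, so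
that 2 survives after telescoping. -/
theorem three_mul_le (H : IsKLDescent h z zs r d rs a b) {A : EReal} {φ : ℝ → ℝ}
    (hφ : IsDesingularizing A φ) {U : Set V}
    (hU : ∀ x ∈ U, h zs < h x → h x < h zs + A →
      1 ≤ ENNReal.ofReal (deriv φ ((h x).toReal - (h zs).toReal)) *
        Metric.infEDist 0 (subdifferential h x)) {k : ℕ} (hz : z (k + 1) ∈ U)
    (hA : ((r (k + 1) - rs : ℝ) : EReal) < A) :
    3 * d (k + 1) ≤ d k + 4 * (b / a) * (φ (r (k + 1) - rs) - φ (r (k + 2) - rs)) := by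
  have ha := H.a_pos
  have hb := H.b_pos
  have hdk := H.d_nonneg k
  have hdk1 := H.d_nonneg (k + 1)
  have hanti : r (k + 2) ≤ r (k + 1) := H.antitone (Nat.le_succ _)
  rcases (H.lim_le (k + 1)).eq_or_lt with heq | hpos
  -- The limit value is already attained, where the KL inequality says nothing; descent alone forces
  -- `d (k + 1) = 0`.
  · have h2 : r (k + 2) = r (k + 1) := le_antisymm hanti (heq ▸ H.lim_le (k + 2))
    rw [H.d_eq_zero heq.ge, h2]
    simpa using hdk
  · have h1 := H.one_le_deriv_mul hφ hU hz hpos hA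
    have h2 := hφ.deriv_mul_sub_le (s := r (k + 1) - rs) (t := r (k + 2) - rs) (by linarith) hA
      (by linarith [H.lim_le (k + 2)]) (by linarith)
    have h3 := H.descent (k + 1)
    set Δ := φ (r (k + 1) - rs) - φ (r (k + 2) - rs)
    set D := d k + d (k + 1) with hD
    have hD0 : 0 ≤ D := by positivity
    have h4 : a * d (k + 1) ^ 2 ≤ Δ * (b * D) := by
      calc a * d (k + 1) ^ 2 ≤ (r (k + 1) - r (k + 2)) * 1 := by
            rw [show k + 1 + 1 = k + 2 from rfl] at h3; linarith
        _ ≤ (r (k + 1) - r (k + 2)) * (deriv φ (r (k + 1) - rs) * (b * D)) :=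
            mul_le_mul_of_nonneg_left h1 (by linarith)
        _ = (deriv φ (r (k + 1) - rs) * (r (k + 1) - rs - (r (k + 2) - rs))) * (b * D) := by ring
        _ ≤ Δ * (b * D) := mul_le_mul_of_nonneg_right h2 (by positivity)
    have h5 : d (k + 1) ^ 2 ≤ (b / a * Δ) * D := by
      have : (b / a * Δ) * D = Δ * (b * D) / a := by ring
      rw [this, le_div_iff₀ ha]; linarith
    have hd0 : 0 ≤ deriv φ (r (k + 1) - rs) := (hφ.deriv_pos _ (by linarith) hA).le
    have hΔ : 0 ≤ Δ := le_trans (mul_nonneg hd0 (by linarith)) h2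
    have h6 : d (k + 1) ≤ D / 4 + b / a * Δ := by
      -- With `B = b / a * Δ`, the identity `(D / 4 + B) ^ 2 - D * B = (D / 4 - B) ^ 2` is used.
      apply le_of_sq_le_sq _ (by positivity)
      nlinarith [sq_nonneg (D / 4 - b / a * Δ)]
    linarith

/-- As long as the sequence stays in `U`, its length is controlled by its first step and by the
gap in the values. -/
theorem length_le (H : IsKLDescent h z zs r d rs a b) {A : EReal} {φ : ℝ → ℝ}
    (hφ : IsDesingularizing A φ) {U : Set V}
    (hU : ∀ x ∈ U, h zs < h x → h x < h zs + A →
      1 ≤ ENNReal.ofReal (deriv φ ((h x).toReal - (h zs).toReal)) *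
        Metric.infEDist 0 (subdifferential h x)) {m : ℕ}
    (hA : ((r (m + 1) - rs : ℝ) : EReal) < A) (M : ℕ) (hz : ∀ i < M, z (m + 1 + i) ∈ U) :
    2 * ∑ i ∈ Finset.range M, d (m + 1 + i) + d (m + M) + 4 * (b / a) * φ (r (m + 1 + M) - rs)
      ≤ d m + 4 * (b / a) * φ (r (m + 1) - rs) := by
  induction M with
  | zero => simp
  | succ M ih =>
    have h1 := ih fun i hi => hz i (by omega)
    have h2 := H.three_mul_le hφ hU (k := m + M)
      (by have := hz M (by omega); rwa [show m + 1 + M = m + M + 1 by ring] at this)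
      (lt_of_le_of_lt (by
        have := H.antitone (show m + 1 ≤ m + M + 1 by omega)
        exact_mod_cast (by linarith)) hA)
    rw [Finset.sum_range_succ]
    rw [show m + 1 + M = m + M + 1 by ring] at *
    rw [show m + (M + 1) = m + M + 1 by ring, show m + 1 + (M + 1) = m + M + 2 by ring]
    linarith

/-- Each `d i` enters the bounds of at most two consecutive steps. The resulting factor 2 is the one
on the left of `length_le`, so the two estimates combine directly. -/
theorem norm_sub_le (H : IsKLDescent h z zs r d rs a b) (m M : ℕ) :
    ‖z (m + M) - z m‖ ≤ 2 * ∑ i ∈ Finset.range M, d (m + i) + d (m + M) := by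
  induction M with
  | zero => simpa using H.d_nonneg m
  | succ M ih =>
    have h1 := H.step (m + M)
    have h2 := norm_add_le (z (m + M + 1) - z (m + M)) (z (m + M) - z m)
    rw [sub_add_sub_cancel] at h2
    rw [Finset.sum_range_succ, show m + (M + 1) = m + M + 1 by ring]
    linarith

theorem eventually_lt (H : IsKLDescent h z zs r d rs a b) {A : EReal} {φ : ℝ → ℝ}
    (hφ : IsDesingularizing A φ) : ∀ᶠ k in atTop, ((r k - rs : ℝ) : EReal) < A := by
  have h1 : Tendsto (fun k => ((r k - rs : ℝ) : EReal)) atTop (𝓝 ((0 : ℝ) : EReal)) :=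
    (continuous_coe_real_ereal.tendsto 0).comp (by simpa using H.tendsto_value.sub_const rs)
  exact h1.eventually (gt_mem_nhds hφ.pos_a)

theorem tendsto_desingularizing (H : IsKLDescent h z zs r d rs a b) {A : EReal} {φ : ℝ → ℝ}
    (hφ : IsDesingularizing A φ) : Tendsto (fun k => φ (r k - rs)) atTop (𝓝 0) := by
  have h0 : (0 : ℝ) ∈ {t : ℝ | 0 ≤ t ∧ (t : EReal) < A} := ⟨le_rfl, hφ.pos_a⟩
  have h1 := hφ.continuousOn 0 h0
  unfold ContinuousWithinAt at h1
  rw [hφ.map_zero] at h1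
  refine h1.comp (tendsto_nhdsWithin_iff.2 ⟨?_, ?_⟩)
  · simpa using H.tendsto_value.sub_const rs
  · filter_upwards [H.eventually_lt hφ] with k hk
    exact ⟨by linarith [H.lim_le k], hk⟩

theorem nonneg_desingularizing (H : IsKLDescent h z zs r d rs a b) {A : EReal} {φ : ℝ → ℝ}
    (hφ : IsDesingularizing A φ) {m k : ℕ} (hmk : m ≤ k) (hA : ((r m - rs : ℝ) : EReal) < A) :
    0 ≤ φ (r k - rs) :=
  hφ.nonneg _ (by linarith [H.lim_le k])
    (lt_of_le_of_lt (by have := H.antitone hmk; exact_mod_cast (by linarith)) hA)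

theorem summable_and_tendsto (H : IsKLDescent h z zs r d rs a b) (hc : MapClusterPt zs atTop z)
    (hKL : HasKLAt h zs) : Summable d ∧ Tendsto z atTop (𝓝 zs) := by
  obtain ⟨A, φ, -, hφ, U, hUn, hU⟩ := hKL
  obtain ⟨ε, hε, hball⟩ := Metric.mem_nhds_iff.1 hUn
  have hC : 0 < 4 * (b / a) := by have := H.a_pos; have := H.b_pos; positivity
  have hφ0 : Tendsto (fun k => 4 * (b / a) * φ (r k - rs)) atTop (𝓝 0) := by
    simpa using (H.tendsto_desingularizing hφ).const_mul (4 * (b / a))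
  have hev : ∀ᶠ k in atTop, ((r k - rs : ℝ) : EReal) < A ∧ d k < ε / 8 ∧
      4 * (b / a) * φ (r k - rs) < ε / 4 :=
    (H.eventually_lt hφ).and ((H.tendsto_d.eventually (gt_mem_nhds (by positivity))).and
      (hφ0.eventually (gt_mem_nhds (by positivity))))
  obtain ⟨m₀, hm₀⟩ := eventually_atTop.1 hev
  -- The starting point of the capture argument is `z (m + 1)`, while `length_le` also charges `d
  -- m`; hence the entry index is sought from `m₀ + 1` on.
  obtain ⟨m', hm', hzm⟩ := (hc.frequently (Metric.ball_mem_nhds zs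
    (show 0 < ε / 4 by positivity))).forall_exists_of_atTop (m₀ + 1)
  obtain ⟨m, rfl⟩ : ∃ m, m' = m + 1 := ⟨m' - 1, by omega⟩
  have hm : ∀ k, m ≤ k → ((r k - rs : ℝ) : EReal) < A ∧ d k < ε / 8 ∧
      4 * (b / a) * φ (r k - rs) < ε / 4 := fun k hk => hm₀ k (by omega)
  have hA := (hm (m + 1) (by omega)).1
  have hφnn : ∀ M, 0 ≤ φ (r (m + 1 + M) - rs) := fun M =>
    H.nonneg_desingularizing hφ (by omega) hA
  -- Capture: as long as the trajectory has stayed in `U`, its length bound keeps it in the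
  -- `ε`-ball. The initial distance, `d m`, the `φ`-term and the last `d` contribute less than `ε/4
  -- + ε/8 + ε/4 + ε/8 < ε`.
  have hmem : ∀ M, z (m + 1 + M) ∈ U := by
    intro M
    induction M using Nat.strong_induction_on with
    | _ M ih =>
      have h1 := H.length_le hφ hU hA M ih
      have h2 := H.norm_sub_le (m + 1) M
      have h3 := mul_nonneg hC.le (hφnn M)
      have h4 := (hm m le_rfl).2.1
      have h5 := (hm (m + 1) (by omega)).2.2
      have h6 := (hm (m + 1 + M) (by omega)).2.1
      have h7 := H.d_nonneg (m + M)
      apply hball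
      rw [Metric.mem_ball, dist_eq_norm]
      replace hzm : ‖z (m + 1) - zs‖ < ε / 4 := by rwa [← dist_eq_norm]
      have h8 := norm_add_le (z (m + 1 + M) - z (m + 1)) (z (m + 1) - zs)
      rw [sub_add_sub_cancel] at h8
      linarith
  have hsum : Summable d := by
    have : Summable fun i => d (i + (m + 1)) := by
      refine summable_of_sum_range_le (c := d m + 4 * (b / a) * φ (r (m + 1) - rs))
        (fun i => H.d_nonneg _) fun M => ?_
      have h1 := H.length_le hφ hU hA M fun i _ => hmem i
      have h3 := mul_nonneg hC.le (hφnn M)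
      have h7 := H.d_nonneg (m + M)
      have h8 : 0 ≤ ∑ i ∈ Finset.range M, d (m + 1 + i) :=
        Finset.sum_nonneg fun i _ => H.d_nonneg _
      simp only [add_comm _ (m + 1)]
      linarith
    exact (summable_nat_add_iff (m + 1)).1 this
  refine ⟨hsum, ?_⟩
  have hcau : CauchySeq z := by
    refine cauchySeq_of_summable_dist ?_
    refine Summable.of_nonneg_of_le (fun k => dist_nonneg) (fun k => ?_)
      (hsum.add ((summable_nat_add_iff 1).2 hsum))
    rw [dist_comm, dist_eq_norm]
    exact H.step k
  exact le_nhds_of_cauchy_adhp hcau hc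

/-- The distance to the limit is at most the remaining length, bounded by `length_le` uniformly in
`M`; then `M → ∞`. -/
theorem norm_sub_lim_le (H : IsKLDescent h z zs r d rs a b) {A : EReal} {φ : ℝ → ℝ}
    (hφ : IsDesingularizing A φ) {U : Set V}
    (hU : ∀ x ∈ U, h zs < h x → h x < h zs + A →
      1 ≤ ENNReal.ofReal (deriv φ ((h x).toReal - (h zs).toReal)) *
        Metric.infEDist 0 (subdifferential h x)) (hz : Tendsto z atTop (𝓝 zs))
    (hzU : ∀ k, z k ∈ U) {m : ℕ} (hA : ((r (m + 1) - rs : ℝ) : EReal) < A) :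
    ‖z (m + 1) - zs‖ ≤ d m + 4 * (b / a) * φ (r (m + 1) - rs) := by
  have hC : 0 < 4 * (b / a) := by have := H.a_pos; have := H.b_pos; positivity
  have h1 : Tendsto (fun M => ‖z (m + 1 + M) - z (m + 1)‖) atTop (𝓝 ‖zs - z (m + 1)‖) := by
    have : Tendsto (fun M => z (m + 1 + M)) atTop (𝓝 zs) := by
      simpa [add_comm] using (tendsto_add_atTop_iff_nat (m + 1)).2 hz
    exact (this.sub_const _).norm
  have h2 : Tendsto (fun M => d m + 4 * (b / a) * φ (r (m + 1) - rs) + d (m + 1 + M)) atTop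
      (𝓝 (d m + 4 * (b / a) * φ (r (m + 1) - rs) + 0)) := by
    have : Tendsto (fun M => d (m + 1 + M)) atTop (𝓝 0) := by
      simpa [add_comm] using (tendsto_add_atTop_iff_nat (m + 1)).2 H.tendsto_d
    exact this.const_add _
  rw [add_zero] at h2
  rw [norm_sub_rev]
  refine le_of_tendsto_of_tendsto' h1 h2 fun M => ?_
  have h3 := H.length_le hφ hU hA M fun i _ => hzU _
  have h4 := H.norm_sub_le (m + 1) M
  have h5 := mul_nonneg hC.le (H.nonneg_desingularizing hφ (k := m + 1 + M) (by omega) hA)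
  have h7 := H.d_nonneg (m + M)
  linarith

end IsKLDescent

/-! ### Convergence rates -/

theorem ConvergesAtKLRate.of_tail {V : Type*} [NormedAddCommGroup V] {x : ℕ → V} {xs : V} {α : ℝ}
    (m : ℕ) (h : ConvergesAtKLRate (fun k => x (k + m)) xs α) : ConvergesAtKLRate x xs α := by
  obtain ⟨h0, h1, h2⟩ := h
  set S := ∑ i ∈ Finset.range (m + 1), ‖x i - xs‖ with hS
  have hS0 : 0 ≤ S := Finset.sum_nonneg fun i _ => norm_nonneg _
  have hxS : ∀ k ≤ m, ‖x k - xs‖ ≤ S := fun k hk =>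
    Finset.single_le_sum (f := fun i => ‖x i - xs‖) (fun i _ => norm_nonneg _)
      (Finset.mem_range.2 (by omega))
  refine ⟨fun hα => ?_, fun hα hα' => ?_, fun hα hα' => ?_⟩
  · obtain ⟨k₀, hk₀⟩ := h0 hα
    refine ⟨k₀ + m, fun k hk => ?_⟩
    have := hk₀ (k - m) (by omega)
    simpa only [show k - m + m = k by omega] using this
  · obtain ⟨c, q, hc, hq, hq1, H⟩ := h1 hα hα'
    -- The ratio `q` may be `0`, and shifting the index back by `m` requires dividing by its `m`-th
    -- power.
    have hq' : 0 < max q (1 / 2) := lt_max_of_lt_right (by norm_num)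
    have hq'1 : max q (1 / 2) < 1 := max_lt hq1 (by norm_num)
    set p := max q (1 / 2)
    refine ⟨(c + S) / p ^ m, p, by positivity, hq'.le, hq'1, fun k => ?_⟩
    rw [div_mul_eq_mul_div, le_div_iff₀ (by positivity)]
    rcases le_total k m with hk | hk
    · have h1 := hxS k hk
      have h2 : p ^ m ≤ p ^ k := pow_le_pow_of_le_one hq'.le hq'1.le hk
      calc ‖x k - xs‖ * p ^ m ≤ S * p ^ k := by gcongr
        _ ≤ (c + S) * p ^ k := by gcongr; linarith
    · have h1 := H (k - m)
      simp only [show k - m + m = k by omega] at h1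
      calc ‖x k - xs‖ * p ^ m ≤ c * q ^ (k - m) * p ^ m := by gcongr
        _ ≤ (c + S) * p ^ (k - m) * p ^ m := by
            gcongr
            · linarith
            · exact le_max_left _ _
        _ = (c + S) * p ^ k := by
            rw [mul_assoc, ← pow_add, show k - m + m = k by omega]
  · obtain ⟨c, hc, H⟩ := h2 hα hα'
    set e := (1 - α) / (2 * α - 1) with he
    have he0 : 0 ≤ e := div_nonneg (by linarith) (by linarith)
    refine ⟨(c + S) * ((m : ℝ) + 1) ^ e, by positivity, fun k hk => ?_⟩
    have hk0 : (0 : ℝ) < k := by exact_mod_cast hk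
    -- Used with `t = 1` for the initial segment `k ≤ m`, and with `t = k - m ≥ 1` afterwards, where
    -- `k ≤ (m + 1) * (k - m)`.
    have hratio : ∀ t : ℝ, 0 < t → (k : ℝ) ≤ ((m : ℝ) + 1) * t →
        t ^ (-e) ≤ ((m : ℝ) + 1) ^ e * (k : ℝ) ^ (-e) := by
      intro t ht hkt
      rw [Real.rpow_neg ht.le, Real.rpow_neg hk0.le, ← div_eq_mul_inv, inv_le_comm₀ (by positivity)
        (by positivity), inv_div, div_le_iff₀ (by positivity), mul_comm,
        ← Real.mul_rpow (by positivity) ht.le]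
      exact Real.rpow_le_rpow hk0.le hkt he0
    rcases le_or_gt k m with hkm | hkm
    · have h1 := hratio 1 one_pos (by rw [mul_one]; exact_mod_cast (by omega))
      rw [Real.one_rpow] at h1
      calc ‖x k - xs‖ ≤ S := hxS k hkm
        _ ≤ (c + S) * 1 := by linarith
        _ ≤ (c + S) * (((m : ℝ) + 1) ^ e * (k : ℝ) ^ (-e)) := by gcongr
        _ = _ := by ring
    · have h1 := H (k - m) (by omega)
      simp only [show k - m + m = k by omega] at h1
      have h2 := hratio ((k - m : ℕ) : ℝ) (by exact_mod_cast (by omega)) (by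
        obtain ⟨j, rfl⟩ : ∃ j, k = m + 1 + j := ⟨k - m - 1, by omega⟩
        rw [show m + 1 + j - m = j + 1 by omega]
        push_cast
        nlinarith [mul_nonneg (Nat.cast_nonneg (α := ℝ) m) (Nat.cast_nonneg (α := ℝ) j)])
      calc ‖x k - xs‖ ≤ c * ((k - m : ℕ) : ℝ) ^ (-e) := h1
        _ ≤ (c + S) * (((m : ℝ) + 1) ^ e * (k : ℝ) ^ (-e)) := by
            gcongr
            linarith
        _ = _ := by ring

theorem ConvergesAtKLRate.of_norm_le {V W : Type*} [NormedAddCommGroup V] [NormedAddCommGroup W]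
    {z : ℕ → W} {zs : W} {x : ℕ → V} {xs : V} {α : ℝ} (h : ConvergesAtKLRate z zs α)
    (hle : ∀ k, ‖x k - xs‖ ≤ ‖z k - zs‖) : ConvergesAtKLRate x xs α := by
  obtain ⟨h0, h1, h2⟩ := h
  refine ⟨fun hα => ?_, fun hα hα' => ?_, fun hα hα' => ?_⟩
  · obtain ⟨k₀, hk₀⟩ := h0 hα
    refine ⟨k₀, fun k hk => ?_⟩
    have := hle k
    rw [hk₀ k hk, sub_self, norm_zero] at this
    exact sub_eq_zero.1 (norm_le_zero_iff.1 this)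
  · obtain ⟨c, q, hc, hq, hq1, H⟩ := h1 hα hα'
    exact ⟨c, q, hc, hq, hq1, fun k => (hle k).trans (H k)⟩
  · obtain ⟨c, hc, H⟩ := h2 hα hα'
    exact ⟨c, hc, fun k hk => (hle k).trans (H k hk)⟩

/-- Since `0 ≤ s ≤ 1` and `p ≤ 1`, one has `s ≤ s ^ p`, so every two steps contract by `C / (1 +
C)`. The ratio `q` is the square root of this factor, and the constant `q⁻¹` accommodates `k = 1`.
-/
theorem exists_le_geometric_of_rpow_le {s : ℕ → ℝ} {p C : ℝ} (hs : ∀ k, 0 ≤ s k)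
    (hanti : Antitone s) (hs1 : s 0 ≤ 1) (hp1 : p ≤ 1) (hC : 0 < C)
    (hrec : ∀ k, s (k + 2) ^ p ≤ C * (s k - s (k + 2))) :
    ∃ c q : ℝ, 0 < c ∧ 0 < q ∧ q < 1 ∧ ∀ k, s k ≤ c * q ^ k := by
  have hQ : 0 < C / (1 + C) := by positivity
  have hQ1 : C / (1 + C) < 1 := by rw [div_lt_one (by positivity)]; linarith
  set q := Real.sqrt (C / (1 + C)) with hq
  have hq0 : 0 < q := Real.sqrt_pos.2 hQ
  have hq1 : q < 1 := by rw [hq, Real.sqrt_lt' one_pos]; simpa using hQ1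
  have hqq : q ^ 2 = C / (1 + C) := Real.sq_sqrt hQ.le
  refine ⟨q⁻¹, q, by positivity, hq0, hq1, fun k => ?_⟩
  have hs1' : ∀ k, s k ≤ 1 := fun k => (hanti (Nat.zero_le k)).trans hs1
  induction k using Nat.twoStepInduction with
  | zero => rw [pow_zero, mul_one]; exact (hs1' 0).trans (one_le_inv_iff₀.2 ⟨hq0, hq1.le⟩)
  | one => rw [pow_one, inv_mul_cancel₀ hq0.ne']; exact hs1' 1
  | more k ih _ =>
    have h1 : s (k + 2) ≤ s (k + 2) ^ p := by
      rcases (hs (k + 2)).eq_or_lt with h | h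
      · rw [← h]; exact Real.rpow_nonneg le_rfl _
      · simpa using Real.rpow_le_rpow_of_exponent_ge h (hs1' _) hp1
    have h2 := h1.trans (hrec k)
    have h3 : s (k + 2) ≤ q ^ 2 * s k := by
      rw [hqq, div_mul_eq_mul_div, le_div_iff₀ (by positivity)]
      linarith
    calc s (k + 2) ≤ q ^ 2 * s k := h3
      _ ≤ q ^ 2 * (q⁻¹ * q ^ k) := by gcongr
      _ = q⁻¹ * q ^ (k + 2) := by ring

/-- A convex function lies below its chord: on `[0, 2]` the chord of `(1 + x) ^ N` is `1 + x * ((3 ^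
N - 1) / 2)`. The interval is dictated by the use at `x = 2 / (k + 1)`. -/
theorem one_add_pow_le_one_add_mul {x : ℝ} (hx : 0 ≤ x) (hx2 : x ≤ 2) (N : ℕ) :
    (1 + x) ^ N ≤ 1 + x * 3 ^ N := by
  have key : (1 + x) ^ N ≤ 1 + x * ((3 ^ N - 1) / 2) := by
    induction N with
    | zero => simp
    | succ N ih =>
      have h1 : (0 : ℝ) ≤ (3 ^ N - 1) / 2 := by
        have : (1 : ℝ) ≤ 3 ^ N := one_le_pow₀ (by norm_num)
        linarith
      calc (1 + x) ^ (N + 1) = (1 + x) ^ N * (1 + x) := pow_succ _ _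
        _ ≤ (1 + x * ((3 ^ N - 1) / 2)) * (1 + x) := by gcongr
        _ ≤ 1 + x * ((3 ^ (N + 1) - 1) / 2) := by
          rw [pow_succ]
          nlinarith [mul_nonneg (mul_nonneg hx h1) (by linarith : 0 ≤ 2 - x)]
  refine key.trans ?_
  have : (0 : ℝ) < 3 ^ N := by positivity
  gcongr
  linarith

/-- Comparison with `B = A * (k + 3) ^ (-1 / q)`. If `s (k + 2)` exceeded `B`, the recursion would
push `s k` strictly above `B * (1 + B ^ q / C)`. The induction hypothesis bounds `s k` by `B * (1 +
2 / (k + 1)) ^ (1 / q)`, which is not larger once `A` is large. -/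
theorem exists_le_rpow_of_rpow_le {s : ℕ → ℝ} {q C : ℝ}
    (hanti : Antitone s) (hq : 0 < q) (hC : 0 < C)
    (hrec : ∀ k, s (k + 2) ^ (1 + q) ≤ C * (s k - s (k + 2))) :
    ∃ A : ℝ, 0 < A ∧ ∀ k : ℕ, s k ≤ A * ((k : ℝ) + 1) ^ (-(1 / q)) := by
  set e := 1 / q with he
  have he0 : 0 < e := by positivity
  obtain ⟨N, hN⟩ := exists_nat_ge e
  have hM : (0 : ℝ) < 6 * 3 ^ N * C := by positivity
  -- The first entry settles `k = 0` and `k = 1`. The second gives `A ^ q ≥ 6 * 3 ^ N * C`, which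
  -- with `k + 3 ≤ 3 * (k + 1)` yields `2 * 3 ^ N / (k + 1) ≤ B ^ q / C`.
  set A := max (s 0 * 2 ^ e) ((6 * 3 ^ N * C) ^ e) with hA
  have hA0 : 0 < A := lt_max_of_lt_right (by positivity)
  have hAq : 6 * 3 ^ N * C ≤ A ^ q := by
    have h1 : ((6 * 3 ^ N * C) ^ e) ^ q ≤ A ^ q :=
      Real.rpow_le_rpow (by positivity) (le_max_right _ _) hq.le
    rwa [← Real.rpow_mul hM.le, he, one_div_mul_cancel hq.ne', Real.rpow_one] at h1
  have hs02 : s 0 * 2 ^ e ≤ A := le_max_left _ _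
  have h2e : (1 : ℝ) ≤ 2 ^ e := Real.one_le_rpow (by norm_num) he0.le
  refine ⟨A, hA0, fun k => ?_⟩
  induction k using Nat.twoStepInduction with
  | zero =>
    simp only [Nat.cast_zero, zero_add, Real.one_rpow, mul_one]
    nlinarith
  | one =>
    rw [Nat.cast_one, one_add_one_eq_two, Real.rpow_neg (by norm_num), ← div_eq_mul_inv,
      le_div_iff₀ (by positivity)]
    exact (mul_le_mul_of_nonneg_right (hanti zero_le_one) (by positivity)).trans hs02
  | more k ih _ =>
    by_contra! hcon
    push_cast at hcon
    rw [show (k : ℝ) + 2 + 1 = k + 3 by ring] at hcon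
    have hk0 : (0 : ℝ) ≤ k := Nat.cast_nonneg k
    set B := A * ((k : ℝ) + 3) ^ (-e) with hB
    have hB0 : 0 < B := by positivity
    have h1 : B ^ q = A ^ q / (k + 3) := by
      rw [hB, Real.mul_rpow hA0.le (by positivity), ← Real.rpow_mul (by positivity), he, neg_mul,
        one_div_mul_cancel hq.ne', Real.rpow_neg_one, div_eq_mul_inv]
    have h2 : B * B ^ q ≤ C * (s k - B) := by
      calc B * B ^ q = B ^ (1 + q) := by rw [Real.rpow_add hB0, Real.rpow_one]
        _ ≤ s (k + 2) ^ (1 + q) := Real.rpow_le_rpow hB0.le hcon.le (by positivity)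
        _ ≤ C * (s k - s (k + 2)) := hrec k
        _ ≤ C * (s k - B) := by gcongr
    have h3 : A * ((k : ℝ) + 1) ^ (-e) = B * (1 + 2 / (k + 1)) ^ e := by
      rw [hB, show (1 : ℝ) + 2 / (k + 1) = (k + 3) / (k + 1) by field_simp; ring,
        Real.div_rpow (by positivity) (by positivity), Real.rpow_neg (by positivity),
        Real.rpow_neg (by positivity)]
      have : ((k : ℝ) + 3) ^ e ≠ 0 := by positivity
      field_simp
    have h4 : (1 + 2 / ((k : ℝ) + 1)) ^ e ≤ 1 + 2 / (k + 1) * 3 ^ N := by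
      have hx : (0 : ℝ) ≤ 2 / (k + 1) := by positivity
      have hx2 : 2 / ((k : ℝ) + 1) ≤ 2 := by
        rw [div_le_iff₀ (by positivity)]; linarith
      refine le_trans ?_ (one_add_pow_le_one_add_mul hx hx2 N)
      rw [← Real.rpow_natCast]
      exact Real.rpow_le_rpow_of_exponent_le (by linarith) hN
    have h5 : s k < B * (1 + B ^ q / C) → False := by
      intro h
      have : B * (1 + B ^ q / C) * C = B * C + B * B ^ q := by field_simp
      nlinarith
    apply h5
    have hlt : s (k + 2) ≤ s k := hanti (by omega)
    have h6 : 2 / ((k : ℝ) + 1) * 3 ^ N ≤ B ^ q / C := by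
      rw [h1, le_div_iff₀ hC, div_mul_eq_mul_div, div_mul_eq_mul_div,
        div_le_div_iff₀ (by positivity) (by positivity)]
      have : 2 * 3 ^ N * C * ((k : ℝ) + 3) ≤ 6 * 3 ^ N * C * (k + 1) := by
        have : 0 ≤ 3 ^ N * C * (k : ℝ) := by positivity
        nlinarith
      exact this.trans (mul_le_mul_of_nonneg_right hAq (by positivity))
    have h7 : s k ≤ B * (1 + B ^ q / C) := by
      calc s k ≤ A * ((k : ℝ) + 1) ^ (-e) := ih
        _ = B * (1 + 2 / (k + 1)) ^ e := h3
        _ ≤ B * (1 + B ^ q / C) := by gcongr; linarith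
    -- Equality is excluded because `s (k + 2) > B` is strict, hence so is the inequality between
    -- the powers with exponent `1 + q`.
    refine lt_of_le_of_ne h7 fun heq => ?_
    have h8 : s (k + 2) ^ (1 + q) ≤ C * (s k - s (k + 2)) := hrec k
    have h9 : B ^ (1 + q) < s (k + 2) ^ (1 + q) := Real.rpow_lt_rpow hB0.le hcon (by positivity)
    rw [Real.rpow_add hB0, Real.rpow_one] at h9
    have : C * (s k - B) = B * B ^ q := by rw [heq]; field_simp; ring
    nlinarith

/-! ### Rates for KL descent sequences -/

namespace IsKLDescent

variable {V : Type*} [NormedAddCommGroup V] [InnerProductSpace ℝ V]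
  {h : V → EReal} {z : ℕ → V} {zs : V} {r d : ℕ → ℝ} {rs a b : ℝ}

theorem step_sq_le (H : IsKLDescent h z zs r d rs a b) (k : ℕ) :
    (d k + d (k + 1)) ^ 2 ≤ 2 / a * (r k - r (k + 2)) := by
  have h1 := H.descent k
  have h2 := H.descent (k + 1)
  have ha := H.a_pos
  rw [div_mul_eq_mul_div, le_div_iff₀ ha]
  have h3 : (d k + d (k + 1)) ^ 2 ≤ 2 * (d k ^ 2 + d (k + 1) ^ 2) := by
    nlinarith [sq_nonneg (d k - d (k + 1))]
  have h4 : (d k + d (k + 1)) ^ 2 * a ≤ 2 * (d k ^ 2 + d (k + 1) ^ 2) * a := by gcongr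
  rw [show k + 2 = k + 1 + 1 from rfl]
  linarith

theorem d_le_rpow (H : IsKLDescent h z zs r d rs a b) (k : ℕ) :
    d k ≤ (1 / a) ^ (1 / 2 : ℝ) * (r k - rs) ^ (1 / 2 : ℝ) := by
  have ha := H.a_pos
  rw [← Real.mul_rpow (by positivity) (by linarith [H.lim_le k]), ← Real.sqrt_eq_rpow]
  refine Real.le_sqrt_of_sq_le ?_
  rw [one_div, ← div_eq_inv_mul, le_div_iff₀ ha]
  linarith [H.descent k, H.lim_le (k + 1)]

/-- The KL inequality with `φ' s = a₀ * (1 - α) * s ^ (-α)`, multiplied by `s ^ α`. Together with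
`step_sq_le` it bounds a power of the value gap by the drop of the gap over two steps. -/
theorem rpow_le_of_exponent (H : IsKLDescent h z zs r d rs a b) {A : EReal} {a₀ α : ℝ}
    (hφ : IsDesingularizing A fun t => a₀ * t ^ (1 - α)) {U : Set V}
    (hU : ∀ x ∈ U, h zs < h x → h x < h zs + A →
      1 ≤ ENNReal.ofReal (deriv (fun t => a₀ * t ^ (1 - α)) ((h x).toReal - (h zs).toReal)) *
        Metric.infEDist 0 (subdifferential h x)) {k : ℕ} (hz : z (k + 1) ∈ U)
    (hpos : rs < r (k + 1)) (hA : ((r (k + 1) - rs : ℝ) : EReal) < A) :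
    (r (k + 1) - rs) ^ α ≤ a₀ * (1 - α) * b * (d k + d (k + 1)) := by
  have h1 := H.one_le_deriv_mul hφ hU hz hpos hA
  have hs : 0 < r (k + 1) - rs := by linarith
  have h2 : deriv (fun t : ℝ => a₀ * t ^ (1 - α)) (r (k + 1) - rs)
      = a₀ * ((1 - α) * (r (k + 1) - rs) ^ (-α)) := by
    have := (Real.hasDerivAt_rpow_const (x := r (k + 1) - rs) (p := 1 - α)
      (Or.inl hs.ne')).const_mul a₀
    rw [this.deriv]
    ring_nf
  rw [h2, Real.rpow_neg hs.le] at h1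
  have h3 : 0 < (r (k + 1) - rs) ^ α := Real.rpow_pos_of_pos hs _
  calc (r (k + 1) - rs) ^ α = (r (k + 1) - rs) ^ α * 1 := (mul_one _).symm
    _ ≤ (r (k + 1) - rs) ^ α * (a₀ * ((1 - α) * ((r (k + 1) - rs) ^ α)⁻¹) *
        (b * (d k + d (k + 1)))) := by gcongr
    _ = _ := by field_simp

/-- Here `φ` is linear, so near `zs` and just above its level subgradients have norm at least `1 /
a₀`. Those along the sequence tend to zero, so the level is reached exactly and the sequence stops
moving. -/
theorem eventually_eq_of_exponent_zero (H : IsKLDescent h z zs r d rs a b)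
    (hz : Tendsto z atTop (𝓝 zs)) (hKL : HasKLExponentAt h zs 0) :
    ∃ k₀ : ℕ, ∀ k, k₀ ≤ k → z k = zs := by
  obtain ⟨A, a₀, ha₀, -, hφ, U, hUn, hU⟩ := hKL
  have hb := H.b_pos
  have hd : Tendsto (fun k => a₀ * (1 - 0) * b * (d k + d (k + 1))) atTop (𝓝 0) := by
    simpa using (H.tendsto_d.add ((tendsto_add_atTop_iff_nat 1).2 H.tendsto_d)).const_mul
      (a₀ * (1 - 0) * b)
  have hev := (((tendsto_add_atTop_iff_nat 1).2 hz).eventually hUn).and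
    (((tendsto_add_atTop_nat 1).eventually (H.eventually_lt hφ)).and
      (hd.eventually (gt_mem_nhds one_pos)))
  obtain ⟨k₀, hk₀⟩ := eventually_atTop.1 hev
  have hr : ∀ k, k₀ ≤ k → r (k + 1) ≤ rs := by
    intro k hk
    by_contra! hcon
    obtain ⟨h1, h2, h3⟩ := hk₀ k hk
    have h4 := H.rpow_le_of_exponent hφ hU h1 hcon h2
    rw [Real.rpow_zero] at h4
    linarith
  have hd0 : ∀ k, k₀ + 1 ≤ k → d k = 0 := fun k hk => H.d_eq_zero (by
    have := hr (k - 1) (by omega)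
    rwa [show k - 1 + 1 = k by omega] at this)
  refine ⟨k₀ + 1, fun k hk => ?_⟩
  have hconst : ∀ M, z (k + M) = z k := by
    intro M
    have h1 := H.norm_sub_le k M
    rw [Finset.sum_eq_zero fun i _ => hd0 _ (by omega), hd0 _ (by omega)] at h1
    exact sub_eq_zero.1 (norm_le_zero_iff.1 (by simpa using h1))
  have h2 : Tendsto (fun M => z (k + M)) atTop (𝓝 zs) := by
    simpa [add_comm] using (tendsto_add_atTop_iff_nat k).2 hz
  simp only [hconst] at h2
  exact tendsto_nhds_unique tendsto_const_nhds h2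

/-- Convergence rates of Kurdyka-Lojasiewicz descent sequences. -/
theorem convergesAtKLRate (H : IsKLDescent h z zs r d rs a b) (hz : Tendsto z atTop (𝓝 zs))
    {α : ℝ} (hα1 : α < 1) (hKL : HasKLExponentAt h zs α) :
    ConvergesAtKLRate z zs α := by
  rcases eq_or_ne α 0 with rfl | hα0
  · exact ⟨fun _ => H.eventually_eq_of_exponent_zero hz hKL, fun h => absurd h (lt_irrefl _),
      fun h => absurd h (by norm_num)⟩
  by_cases hαpos : 0 < α
  swap
  · exact ⟨fun h => absurd h hα0, fun h => absurd h hαpos, fun h => absurd h (by linarith)⟩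
  obtain ⟨A, a₀, ha₀, -, hφ, U, hUn, hU⟩ := hKL
  have hb := H.b_pos
  have ha := H.a_pos
  have hev : ∀ᶠ k in atTop, z k ∈ U ∧ ((r k - rs : ℝ) : EReal) < A ∧ r k - rs < 1 :=
    (hz.eventually hUn).and ((H.eventually_lt hφ).and
      ((by simpa using H.tendsto_value.sub_const rs :
        Tendsto (fun k => r k - rs) atTop (𝓝 0)).eventually (gt_mem_nhds one_pos)))
  obtain ⟨m, hm⟩ := eventually_atTop.1 hev
  -- The extra `1` appears because `norm_sub_lim_le` estimates `z (m + 1)` in terms of data at `m`.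
  suffices hs : ConvergesAtKLRate (fun k => z (k + (m + 1))) zs α from hs.of_tail (m + 1)
  have H' := H.shift m
  have hz' := (tendsto_add_atTop_iff_nat m).2 hz
  have hU' : ∀ k, z (k + m) ∈ U := fun k => (hm _ (by omega)).1
  have hA' : ∀ k, ((r (k + m) - rs : ℝ) : EReal) < A := fun k => (hm _ (by omega)).2.1
  set s : ℕ → ℝ := fun k => r (k + m) - rs with hsdef
  have hs0 : ∀ k, 0 ≤ s k := fun k => by simpa [s] using H'.lim_le k
  have hs1 : ∀ k, s k ≤ 1 := fun k => (hm _ (by omega)).2.2.le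
  have hanti : Antitone s := fun i j hij => by simpa [s] using H'.antitone hij
  set C₁ := a₀ * (1 - α) * b with hC₁
  have hC₁0 : 0 < C₁ := by have : 0 < 1 - α := by linarith
                           positivity
  -- The recursion skips one index because the subgradient bound involves both `d k` and `d (k +
  -- 1)`, so two decreases of the value are needed to control it.
  have hrec : ∀ k, s (k + 2) ^ (2 * α) ≤ (C₁ ^ 2 * (2 / a)) * (s k - s (k + 2)) := by
    intro k
    have hsub : s k - s (k + 2) = r (k + m) - r (k + 2 + m) := by simp [s]
    rcases (hs0 (k + 2)).eq_or_lt with h0 | h0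
    · rw [← h0, Real.zero_rpow (by positivity)]
      have := hs0 k
      rw [sub_zero]
      positivity
    · have h1 : 0 < s (k + 1) := h0.trans_le (hanti (by omega))
      have h2 : s (k + 1) ^ α ≤ C₁ * (d (k + m) + d (k + 1 + m)) :=
        H'.rpow_le_of_exponent hφ hU (k := k) (hU' (k + 1)) (by simpa [s] using h1)
          (hA' (k + 1))
      have h3 : (d (k + m) + d (k + 1 + m)) ^ 2 ≤ 2 / a * (s k - s (k + 2)) := by
        rw [hsub]; exact H'.step_sq_le k
      calc s (k + 2) ^ (2 * α) ≤ s (k + 1) ^ (2 * α) :=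
            Real.rpow_le_rpow h0.le (hanti (by omega)) (by positivity)
        _ = (s (k + 1) ^ α) ^ 2 := by
            rw [mul_comm, Real.rpow_mul h1.le, Real.rpow_two]
        _ ≤ (C₁ * (d (k + m) + d (k + 1 + m))) ^ 2 := by gcongr
        _ = C₁ ^ 2 * (d (k + m) + d (k + 1 + m)) ^ 2 := by ring
        _ ≤ C₁ ^ 2 * (2 / a * (s k - s (k + 2))) := by gcongr
        _ = _ := by ring
  have hbound : ∀ k, ‖z (k + (m + 1)) - zs‖ ≤ (1 / a) ^ (1 / 2 : ℝ) * s k ^ (1 / 2 : ℝ) +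
      4 * (b / a) * a₀ * s k ^ (1 - α) := by
    intro k
    have h1 := H'.norm_sub_lim_le hφ hU hz' hU' (m := k) (hA' (k + 1))
    have h2 := H'.d_le_rpow k
    have h3 : s (k + 1) ^ (1 - α) ≤ s k ^ (1 - α) :=
      Real.rpow_le_rpow (hs0 _) (hanti (by omega)) (by linarith)
    have h4 : 4 * (b / a) * (a₀ * s (k + 1) ^ (1 - α)) ≤ 4 * (b / a) * a₀ * s k ^ (1 - α) := by
      rw [← mul_assoc]; gcongr
    rw [show k + (m + 1) = k + 1 + m by ring]
    exact h1.trans (add_le_add h2 h4)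
  set C₂ := (1 / a) ^ (1 / 2 : ℝ) + 4 * (b / a) * a₀ with hC₂
  have hC₂0 : 0 < C₂ := by positivity
  -- As `s k ≤ 1`, the smaller exponent dominates: `e = 1 / 2` when `α ≤ 1 / 2`, and `e = 1 - α`
  -- when `α > 1 / 2`.
  have hbound' : ∀ e : ℝ, 0 ≤ e → e ≤ 1 / 2 → e ≤ 1 - α → ∀ k,
      ‖z (k + (m + 1)) - zs‖ ≤ C₂ * s k ^ e := by
    intro e he0 he1 he2 k
    refine (hbound k).trans ?_
    have hmono : ∀ e', e ≤ e' → s k ^ e' ≤ s k ^ e := by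
      intro e' hee
      exact Real.rpow_le_rpow_of_exponent_ge_of_imp (hs0 k) (hs1 k) hee
        (fun _ h => by linarith)
    rw [hC₂, add_mul]
    exact add_le_add (mul_le_mul_of_nonneg_left (hmono _ he1) (by positivity))
      (mul_le_mul_of_nonneg_left (hmono _ he2) (by positivity))
  refine ⟨fun h => absurd h hα0, fun _ hα => ?_, fun hα _ => ?_⟩
  · obtain ⟨c, q, hc, hq, hq1, hsq⟩ := exists_le_geometric_of_rpow_le hs0 hanti (hs1 0)
      (p := 2 * α) (by linarith) (by positivity) hrec
    refine ⟨C₂ * c ^ (1 / 2 : ℝ), q ^ (1 / 2 : ℝ), by positivity, by positivity,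
      Real.rpow_lt_one hq.le hq1 (by norm_num), fun k => ?_⟩
    refine (hbound' (1 / 2) (by norm_num) le_rfl (by linarith) k).trans ?_
    rw [mul_assoc]
    gcongr
    calc s k ^ (1 / 2 : ℝ) ≤ (c * q ^ k) ^ (1 / 2 : ℝ) :=
          Real.rpow_le_rpow (hs0 k) (hsq k) (by norm_num)
      _ = c ^ (1 / 2 : ℝ) * (q ^ (1 / 2 : ℝ)) ^ k := by
        rw [Real.mul_rpow hc.le (by positivity), ← Real.rpow_natCast, ← Real.rpow_natCast,
          ← Real.rpow_mul hq.le, ← Real.rpow_mul hq.le, mul_comm (k : ℝ)]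
  · obtain ⟨c, hc, hsc⟩ := exists_le_rpow_of_rpow_le hanti (q := 2 * α - 1) (by linarith)
      (C := C₁ ^ 2 * (2 / a)) (by positivity)
      (by simpa only [add_sub_cancel] using hrec)
    refine ⟨C₂ * c ^ (1 - α), by positivity, fun k hk => ?_⟩
    refine (hbound' (1 - α) (by linarith) (by linarith) le_rfl k).trans ?_
    rw [mul_assoc]
    have hk0 : (0 : ℝ) < k := by exact_mod_cast hk
    gcongr
    have he : 0 < 1 / (2 * α - 1) := by
      have : 0 < 2 * α - 1 := by linarith
      positivity
    calc s k ^ (1 - α) ≤ (c * ((k : ℝ) + 1) ^ (-(1 / (2 * α - 1)))) ^ (1 - α) :=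
          Real.rpow_le_rpow (hs0 k) (hsc k) (by linarith)
      _ ≤ (c * (k : ℝ) ^ (-(1 / (2 * α - 1)))) ^ (1 - α) := by
        refine Real.rpow_le_rpow (by positivity) ?_ (by linarith)
        gcongr c * ?_
        exact Real.rpow_le_rpow_of_nonpos hk0 (by linarith) (by linarith)
      _ = c ^ (1 - α) * (k : ℝ) ^ (-((1 - α) / (2 * α - 1))) := by
        rw [Real.mul_rpow hc.le (by positivity), ← Real.rpow_mul hk0.le]
        congr 2
        ring

end IsKLDescent

/-! ### Convex analysis -/

section ConvexAnalysis

variable {V : Type*} [NormedAddCommGroup V] [InnerProductSpace ℝ V]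

/-- Divide by `t` and let `t ↓ 0`. This takes the place of directional derivatives throughout:
nonsmooth terms are only ever bounded above by a linear term plus `C * t ^ 2`. -/
theorem nonneg_of_forall_small {B C t₀ : ℝ} (ht₀ : 0 < t₀)
    (h : ∀ t, 0 < t → t ≤ t₀ → 0 ≤ t * B + C * t ^ 2) : 0 ≤ B := by
  by_contra! hB
  have hC : 0 < |C| + 1 := by positivity
  set t := min t₀ (-B / (2 * (|C| + 1))) with ht
  have ht0 : 0 < t := lt_min ht₀ (div_pos (by linarith) (by positivity))
  have h1 := h t ht0 (min_le_left _ _)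
  have h2 : t * (2 * (|C| + 1)) ≤ -B := by
    rw [← le_div_iff₀ (by positivity)]; exact min_le_right _ _
  have h3 : 0 ≤ t * (B + C * t) := by linarith
  have h4 : 0 ≤ B + C * t := nonneg_of_mul_nonneg_right h3 ht0
  nlinarith [le_abs_self C, abs_nonneg C]

theorem convexOn_finset_sum {ι : Type*} (T : Finset ι) {S : Set V} (hS : Convex ℝ S)
    {g : ι → V → ℝ} (h : ∀ i ∈ T, ConvexOn ℝ S (g i)) : ConvexOn ℝ S fun x => ∑ i ∈ T, g i x := by
  refine ⟨hS, fun x hx y hy s t hs ht hst => ?_⟩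
  simp only [smul_eq_mul, Finset.mul_sum, ← Finset.sum_add_distrib]
  exact Finset.sum_le_sum fun i hi => (h i hi).2 hx hy hs ht hst

theorem mem_subdifferential_coe_iff {g : V → ℝ} {x ξ : V} :
    ξ ∈ subdifferential (fun v => ((g v : ℝ) : EReal)) x ↔
      ∀ y, g x + inner ℝ ξ (y - x) ≤ g y := by
  simp only [subdifferential, mem_ofPred_eq]
  exact forall_congr' fun y => by rw [← EReal.coe_add, EReal.coe_le_coe_iff]

theorem mem_subdifferential_add_indicatorTop {W : Type*} {g : V → ℝ} {π : V → W} {S : Set W}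
    {x ξ : V} (hx : π x ∈ S) (h : ∀ y, π y ∈ S → g x + inner ℝ ξ (y - x) ≤ g y) :
    ξ ∈ subdifferential (fun v => ((g v : ℝ) : EReal) + indicatorTop S (π v)) x := by
  intro y
  by_cases hy : π y ∈ S
  · simp only [indicatorTop, hx, hy, if_true, add_zero]
    rw [← EReal.coe_add, EReal.coe_le_coe_iff]
    exact h y hy
  · simp only [indicatorTop, hx, hy, if_true, if_false]
    rw [EReal.coe_add_top]
    exact le_top

/-- A finite convex function on a finite-dimensional space has a subgradient at every point. -/
theorem ConvexOn.exists_subgradient [FiniteDimensional ℝ V] {g : V → ℝ}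
    (hg : ConvexOn ℝ univ g) (x : V) :
    ∃ ξ : V, ∀ y, g x + inner ℝ ξ (y - x) ≤ g y := by
  have hcont : Continuous g := hg.locallyLipschitz.continuous
  have hconv : Convex ℝ {p : V × ℝ | g p.1 < p.2} := by
    have := hg.convex_strict_epigraph
    simpa using this
  have hopen : IsOpen {p : V × ℝ | g p.1 < p.2} :=
    isOpen_lt (hcont.comp continuous_fst) continuous_snd
  -- Separation of the open strict epigraph from the graph point `(x, g x)`. The vertical component
  -- `c` is negative, so dividing by `-c` turns the horizontal part into a subgradient.
  obtain ⟨φ, hφ⟩ := geometric_hahn_banach_open_point hconv hopen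
    (x := (x, g x)) (by simp)
  set c := φ (0, 1) with hc
  have hsplit : ∀ (v : V) (t : ℝ), φ (v, t) = φ (v, 0) + t * c := by
    intro v t
    rw [hc, ← smul_eq_mul, ← map_smul, ← map_add]
    simp
  have hc0 : c < 0 := by
    have h1 := hφ (x, g x + 1) (by simp)
    rw [hsplit x (g x + 1), hsplit x (g x)] at h1
    linarith
  have hle : ∀ y, φ (y, 0) + g y * c ≤ φ (x, 0) + g x * c := by
    intro y
    have h1 : ∀ ε : ℝ, 0 < ε → φ (y, 0) + g y * c ≤ φ (x, 0) + g x * c + ε := by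
      intro ε hε
      have h2 := hφ (y, g y + ε / (-c)) (by
        have : 0 < ε / (-c) := div_pos hε (by linarith)
        simpa using this)
      rw [hsplit y, hsplit x] at h2
      have h3 : (g y + ε / (-c)) * c = g y * c - ε := by
        rw [add_mul, div_neg, neg_mul, div_mul_cancel₀ _ hc0.ne, sub_eq_add_neg]
      linarith
    exact le_of_forall_pos_le_add h1
  let ψ : V →L[ℝ] ℝ := φ.comp (ContinuousLinearMap.inl ℝ V ℝ)
  have hψ : ∀ v, ψ v = φ (v, 0) := fun v => by simp [ψ]
  refine ⟨(-c)⁻¹ • (InnerProductSpace.toDual ℝ V).symm ψ, fun y => ?_⟩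
  rw [inner_smul_left, InnerProductSpace.toDual_symm_apply, map_sub, hψ, hψ]
  have h1 := hle y
  have h2 : (-c)⁻¹ * (φ (y, 0) - φ (x, 0)) ≤ g y - g x := by
    rw [inv_mul_le_iff₀ (by linarith)]
    linarith
  simp only [conj_trivial]
  linarith

theorem ConvexOn.add_inner_gradient_le [CompleteSpace V] {g : V → ℝ} (hg : ConvexOn ℝ univ g)
    (hd : Differentiable ℝ g) (x y : V) : g x + inner ℝ (gradient g x) (y - x) ≤ g y := by
  set l : ℝ → V := fun t => x + t • (y - x) with hl
  have hconv : ConvexOn ℝ univ (fun t => g (l t)) := by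
    refine ⟨convex_univ, fun a _ b _ p q hp hq hpq => ?_⟩
    have h1 := hg.2 (mem_univ (l a)) (mem_univ (l b)) hp hq hpq
    have h2 : l (p • a + q • b) = p • l a + q • l b := by
      have : x = p • x + q • x := by rw [← add_smul, hpq, one_smul]
      simp only [l, smul_eq_mul]
      nth_rw 1 [this]
      module
    simpa only [h2] using h1
  have hder : HasDerivAt (fun t => g (l t)) (inner ℝ (gradient g x) (y - x)) 0 := by
    have h1 : HasDerivAt l (y - x) 0 := by
      simpa [l] using ((hasDerivAt_id (0 : ℝ)).smul_const (y - x)).const_add x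
    have h2 : HasFDerivAt g (InnerProductSpace.toDual ℝ V (gradient g x)) (l 0) := by
      have := (hd x).hasGradientAt.hasFDerivAt
      simpa [l] using this
    exact (h2.comp_hasDerivAt 0 h1).congr_deriv (by simp)
  have h1 := hconv.le_slope_of_hasDerivAt (x := 0) (y := 1) (mem_univ _) (mem_univ _) one_pos hder
  rw [slope_def_field] at h1
  simp only [l, sub_zero, div_one, one_smul, zero_smul, add_zero, add_sub_cancel] at h1
  linarith

/-- The descent lemma. -/
theorem le_add_inner_gradient_add_sq [CompleteSpace V] {g : V → ℝ} {K : ℝ}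
    (hd : Differentiable ℝ g)
    (hK : ∀ x y, ‖gradient g x - gradient g y‖ ≤ K * ‖x - y‖) (x y : V) :
    g y ≤ g x + inner ℝ (gradient g x) (y - x) + K / 2 * ‖y - x‖ ^ 2 := by
  set v := y - x with hv
  have hder : ∀ t : ℝ, HasDerivAt (fun t : ℝ => g (x + t • v) - t * inner ℝ (gradient g x) v
      - K / 2 * ‖v‖ ^ 2 * t ^ 2)
      (inner ℝ (gradient g (x + t • v)) v - inner ℝ (gradient g x) v - K * ‖v‖ ^ 2 * t) t := by
    intro t
    have h1 : HasDerivAt (fun t : ℝ => x + t • v) v t := by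
      simpa using ((hasDerivAt_id t).smul_const v).const_add x
    have h2 : HasDerivAt (fun t : ℝ => g (x + t • v)) (inner ℝ (gradient g (x + t • v)) v) t := by
      exact ((hd (x + t • v)).hasGradientAt.hasFDerivAt.comp_hasDerivAt t h1).congr_deriv (by simp)
    have h3 := (hasDerivAt_id t).mul_const (inner ℝ (gradient g x) v)
    have h4 := ((hasDerivAt_id t).pow 2).const_mul (K / 2 * ‖v‖ ^ 2)
    refine ((h2.sub h3).sub h4).congr_deriv ?_
    simp
    ring
  -- The gap between `g` along the segment and its quadratic upper model has nonpositive derivative,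
  -- by Cauchy-Schwarz and the Lipschitz bound.
  have hanti : AntitoneOn (fun t : ℝ => g (x + t • v) - t * inner ℝ (gradient g x) v
      - K / 2 * ‖v‖ ^ 2 * t ^ 2) (Ici 0) := by
    refine antitoneOn_of_deriv_nonpos (convex_Ici 0)
      (fun t _ => (hder t).continuousAt.continuousWithinAt)
      (fun t _ => (hder t).differentiableAt.differentiableWithinAt) fun t ht => ?_
    rw [interior_Ici, mem_Ioi] at ht
    rw [(hder t).deriv, ← inner_sub_left]
    have h1 := real_inner_le_norm (gradient g (x + t • v) - gradient g x) v
    have h2 := hK (x + t • v) x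
    rw [add_sub_cancel_left, norm_smul, Real.norm_of_nonneg ht.le] at h2
    have h3 := mul_le_mul_of_nonneg_right h2 (norm_nonneg v)
    nlinarith
  have h := hanti (mem_Ici.2 le_rfl) (mem_Ici.2 zero_le_one) zero_le_one
  simp only [one_smul, zero_smul, add_zero, v, add_sub_cancel] at h
  simp only [v]
  linarith

/-- The optimality condition of a proximal subproblem. -/
theorem IsMinOn.prox_optimality {S : Set V} (hS : Convex ℝ S) {g : V → ℝ} (hg : ConvexOn ℝ S g)
    {α : ℝ} {y u v : V} (hu : u ∈ S) (hv : v ∈ S)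
    (hmin : IsMinOn (fun x => g x + α / 2 * ‖x - y‖ ^ 2) S u) :
    0 ≤ g v - g u + α * inner ℝ (u - y) (v - u) := by
  refine nonneg_of_forall_small (C := α / 2 * ‖v - u‖ ^ 2) one_pos fun t ht ht1 => ?_
  have hmem : u + t • (v - u) ∈ S := hS.add_smul_sub_mem hu hv ⟨ht.le, ht1⟩
  have h1 : g u + α / 2 * ‖u - y‖ ^ 2 ≤ g (u + t • (v - u)) + α / 2 * ‖u + t • (v - u) - y‖ ^ 2 :=
    hmin hmem
  have h2 : g (u + t • (v - u)) ≤ (1 - t) * g u + t * g v := by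
    have := hg.2 hu hv (by linarith : 0 ≤ 1 - t) ht.le (by ring)
    rw [show u + t • (v - u) = (1 - t) • u + t • v by module]
    simpa using this
  have h3 : ‖u + t • (v - u) - y‖ ^ 2 =
      ‖u - y‖ ^ 2 + 2 * t * inner ℝ (u - y) (v - u) + t ^ 2 * ‖v - u‖ ^ 2 := by
    rw [show u + t • (v - u) - y = (u - y) + t • (v - u) by abel, norm_add_sq_real,
      inner_smul_right, norm_smul, mul_pow, Real.norm_eq_abs, sq_abs]
    ring
  rw [h3] at h1
  linarith

/-- The minimal value of a proximal subproblem grows quadratically. -/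
theorem IsMinOn.prox_growth {S : Set V} (hS : Convex ℝ S) {g : V → ℝ} (hg : ConvexOn ℝ S g)
    {α : ℝ} {y u v : V} (hu : u ∈ S) (hv : v ∈ S)
    (hmin : IsMinOn (fun x => g x + α / 2 * ‖x - y‖ ^ 2) S u) :
    g u + α / 2 * ‖u - y‖ ^ 2 + α / 2 * ‖v - u‖ ^ 2 ≤ g v + α / 2 * ‖v - y‖ ^ 2 := by
  have h1 := hmin.prox_optimality hS hg hu hv
  have h2 : ‖v - y‖ ^ 2 = ‖u - y‖ ^ 2 + 2 * inner ℝ (u - y) (v - u) + ‖v - u‖ ^ 2 := by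
    rw [← norm_add_sq_real, sub_add_sub_cancel']
  rw [h2]
  linarith

end ConvexAnalysis

/-! ### Group norms -/

/-- The concave square root lies below its tangent at `A ^ 2`. -/
theorem sqrt_add_le_add_div {A E : ℝ} (hA : 0 < A) (hE : 0 ≤ A ^ 2 + E) :
    √(A ^ 2 + E) ≤ A + E / (2 * A) := by
  have h0 : A + E / (2 * A) = (A ^ 2 + (A ^ 2 + E)) / (2 * A) := by field_simp; ring
  refine Real.sqrt_le_iff.2 ⟨by rw [h0]; positivity, ?_⟩
  have h1 : (A + E / (2 * A)) ^ 2 = A ^ 2 + E + (E / (2 * A)) ^ 2 := by field_simp; ring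
  rw [h1]
  linarith [sq_nonneg (E / (2 * A))]

/-- The tangent bound for the square root of `(u + h) ^ 2 = u ^ 2 + (2 * u * h + h ^ 2)`. It needs
no smallness of `h` and survives a sign change of `u + h`. -/
theorem abs_add_le_add_sq {u h : ℝ} (hu : u ≠ 0) :
    |u + h| ≤ |u| + u / |u| * h + h ^ 2 / (2 * |u|) := by
  have hA : 0 < |u| := abs_pos.2 hu
  have h1 := sqrt_add_le_add_div (A := |u|) (E := 2 * u * h + h ^ 2) hA
    (by rw [sq_abs]; nlinarith [sq_nonneg (u + h)])
  rw [sq_abs, show u ^ 2 + (2 * u * h + h ^ 2) = (u + h) ^ 2 by ring, Real.sqrt_sq_eq_abs] at h1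
  refine h1.trans (le_of_eq ?_)
  field_simp
  ring

namespace SparseGroupProblem

variable {n L : ℕ} (P : SparseGroupProblem n L)

theorem groupNorm_of_one (hp : P.p = 1) (x : EuclideanSpace ℝ (Fin n)) (l : Fin L) :
    P.groupNorm x l = ∑ j ∈ P.G l, |x j| := by
  simp [groupNorm, hp]

theorem groupNorm_of_two (hp : P.p = 2) (x : EuclideanSpace ℝ (Fin n)) (l : Fin L) :
    P.groupNorm x l = √(∑ j ∈ P.G l, x j ^ 2) := by
  simp [groupNorm, hp, Real.sqrt_eq_rpow]

theorem groupNorm_nonneg (x : EuclideanSpace ℝ (Fin n)) (l : Fin L) : 0 ≤ P.groupNorm x l :=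
  Real.rpow_nonneg (Finset.sum_nonneg fun _ _ => by positivity) _

theorem groupNorm_sq_of_two (hp : P.p = 2) (x : EuclideanSpace ℝ (Fin n)) (l : Fin L) :
    P.groupNorm x l ^ 2 = ∑ j ∈ P.G l, x j ^ 2 := by
  rw [P.groupNorm_of_two hp, Real.sq_sqrt (Finset.sum_nonneg fun _ _ => sq_nonneg _)]

theorem groupNorm_mono (x y : EuclideanSpace ℝ (Fin n)) (l : Fin L)
    (h : ∀ j ∈ P.G l, |x j| ≤ |y j|) : P.groupNorm x l ≤ P.groupNorm y l := by
  unfold groupNorm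
  refine Real.rpow_le_rpow (Finset.sum_nonneg fun _ _ => by positivity) ?_ (by positivity)
  exact Finset.sum_le_sum fun j hj => pow_le_pow_left₀ (abs_nonneg _) (h j hj) _

theorem groupNorm_congr (x y : EuclideanSpace ℝ (Fin n)) (l : Fin L)
    (h : ∀ j ∈ P.G l, x j = y j) : P.groupNorm x l = P.groupNorm y l := by
  unfold groupNorm
  rw [Finset.sum_congr rfl fun j hj => by rw [h j hj]]

variable {P}

theorem abs_le_groupNorm (hp : P.p = 1 ∨ P.p = 2) (x : EuclideanSpace ℝ (Fin n)) {l : Fin L}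
    {j : Fin n} (hj : j ∈ P.G l) : |x j| ≤ P.groupNorm x l := by
  rcases hp with hp | hp
  · rw [P.groupNorm_of_one hp]
    exact Finset.single_le_sum (f := fun j => |x j|) (fun _ _ => abs_nonneg _) hj
  · refine abs_le_of_sq_le_sq ?_ (P.groupNorm_nonneg x l)
    rw [P.groupNorm_sq_of_two hp]
    exact Finset.single_le_sum (f := fun j => x j ^ 2) (fun _ _ => sq_nonneg _) hj

theorem groupNorm_eq_zero_iff (hp : P.p = 1 ∨ P.p = 2) (x : EuclideanSpace ℝ (Fin n)) (l : Fin L) :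
    P.groupNorm x l = 0 ↔ ∀ j ∈ P.G l, x j = 0 := by
  refine ⟨fun h j hj => ?_, fun h => ?_⟩
  · have := abs_le_groupNorm hp x hj
    rw [h] at this
    exact abs_eq_zero.1 (le_antisymm this (abs_nonneg _))
  · rcases hp with hp | hp
    · rw [P.groupNorm_of_one hp]
      exact Finset.sum_eq_zero fun j hj => by rw [h j hj, abs_zero]
    · rw [P.groupNorm_of_two hp, Finset.sum_eq_zero fun j hj => by rw [h j hj]; norm_num,
        Real.sqrt_zero]

theorem groupNorm_of_two_eq_norm (hp : P.p = 2) (x : EuclideanSpace ℝ (Fin n)) (l : Fin L) :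
    P.groupNorm x l = ‖(WithLp.toLp 2 fun j : P.G l => x j : EuclideanSpace ℝ (P.G l))‖ := by
  rw [P.groupNorm_of_two hp, EuclideanSpace.norm_eq]
  simp only [Real.norm_eq_abs, sq_abs]
  rw [Finset.sum_coe_sort (P.G l) fun j => x j ^ 2]

theorem groupNorm_add_le (hp : P.p = 1 ∨ P.p = 2) (x y : EuclideanSpace ℝ (Fin n)) (l : Fin L) :
    P.groupNorm (x + y) l ≤ P.groupNorm x l + P.groupNorm y l := by
  rcases hp with hp | hp
  · simp only [P.groupNorm_of_one hp, ← Finset.sum_add_distrib]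
    exact Finset.sum_le_sum fun j _ => abs_add_le _ _
  · simp only [groupNorm_of_two_eq_norm hp]
    exact norm_add_le (WithLp.toLp 2 fun j : P.G l => x j : EuclideanSpace ℝ (P.G l))
      (WithLp.toLp 2 fun j : P.G l => y j)

theorem groupNorm_smul (hp : P.p = 1 ∨ P.p = 2) (t : ℝ) (x : EuclideanSpace ℝ (Fin n))
    (l : Fin L) : P.groupNorm (t • x) l = |t| * P.groupNorm x l := by
  rcases hp with hp | hp
  · simp [P.groupNorm_of_one hp, abs_mul, Finset.mul_sum]
  · simp only [groupNorm_of_two_eq_norm hp]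
    exact norm_smul t (WithLp.toLp 2 fun j : P.G l => x j : EuclideanSpace ℝ (P.G l))

theorem convexOn_groupNorm (hp : P.p = 1 ∨ P.p = 2) (l : Fin L) :
    ConvexOn ℝ univ fun x => P.groupNorm x l := by
  refine ⟨convex_univ, fun x _ y _ s t hs ht _ => ?_⟩
  refine (groupNorm_add_le hp _ _ l).trans_eq ?_
  rw [groupNorm_smul hp, groupNorm_smul hp, abs_of_nonneg hs, abs_of_nonneg ht, smul_eq_mul,
    smul_eq_mul]

theorem abs_groupNorm_sub_le_of_two (hp : P.p = 2) (x y : EuclideanSpace ℝ (Fin n)) (l : Fin L) :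
    |P.groupNorm x l - P.groupNorm y l| ≤ ‖x - y‖ := by
  rw [groupNorm_of_two_eq_norm hp, groupNorm_of_two_eq_norm hp]
  refine (abs_norm_sub_norm_le _ _).trans ?_
  have h1 : (WithLp.toLp 2 fun j : P.G l => x j : EuclideanSpace ℝ (P.G l)) -
      (WithLp.toLp 2 fun j : P.G l => y j) = WithLp.toLp 2 fun j : P.G l => (x - y) j := rfl
  rw [h1, ← groupNorm_of_two_eq_norm hp, P.groupNorm_of_two hp, EuclideanSpace.norm_eq]
  refine Real.sqrt_le_sqrt ?_
  simp only [Real.norm_eq_abs, sq_abs]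
  exact Finset.sum_le_univ_sum_of_nonneg fun j => sq_nonneg _

variable (P) in
/-- The gradient of the group norm at points where it is differentiable. -/
noncomputable def normGrad (u : EuclideanSpace ℝ (Fin n)) (l : Fin L) (j : Fin n) : ℝ :=
  if j ∈ P.G l then u j / (if P.p = 1 then |u j| else P.groupNorm u l) else 0

/-- One-sided second-order expansion along `d`. The hypotheses keep `d` away from the kinks of the
norm: zero entries when `p = 1`, a vanishing group when `p = 2`. It holds for all real `t`, so it
can also be applied with `-t`. -/
theorem exists_groupNorm_add_le (hp : P.p = 1 ∨ P.p = 2) {u d : EuclideanSpace ℝ (Fin n)}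
    {l : Fin L} (h1 : P.p = 1 → ∀ j ∈ P.G l, u j = 0 → d j = 0)
    (h2 : P.groupNorm u l = 0 → ∀ j ∈ P.G l, d j = 0) :
    ∃ C, ∀ t : ℝ, P.groupNorm (u + t • d) l ≤
      P.groupNorm u l + t * ∑ j, P.normGrad u l j * d j + C * t ^ 2 := by
  have hsum : ∑ j, P.normGrad u l j * d j =
      ∑ j ∈ P.G l, u j / (if P.p = 1 then |u j| else P.groupNorm u l) * d j := by
    simp only [normGrad, ite_mul, zero_mul]
    rw [Finset.sum_ite_mem, Finset.univ_inter]
  rw [hsum]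
  rcases hp with hp | hp
  · refine ⟨∑ j ∈ P.G l, d j ^ 2 / (2 * |u j|), fun t => ?_⟩
    simp only [P.groupNorm_of_one hp, hp, if_true]
    rw [Finset.mul_sum, Finset.sum_mul, ← Finset.sum_add_distrib, ← Finset.sum_add_distrib]
    refine Finset.sum_le_sum fun j hj => ?_
    by_cases hu : u j = 0
    · simp [hu, h1 hp j hj hu]
    · refine (abs_add_le_add_sq (h := t * d j) hu).trans_eq ?_
      ring
  · by_cases hN : P.groupNorm u l = 0
    · refine ⟨0, fun t => ?_⟩
      rw [Finset.sum_eq_zero fun j hj => by rw [h2 hN j hj, mul_zero], hN]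
      simp only [mul_zero, add_zero, zero_mul]
      refine ((groupNorm_eq_zero_iff (Or.inr hp) _ l).2 fun j hj => ?_).le
      simp [h2 hN j hj, (groupNorm_eq_zero_iff (Or.inr hp) u l).1 hN j hj]
    · have hN0 : 0 < P.groupNorm u l := lt_of_le_of_ne (P.groupNorm_nonneg u l) (Ne.symm hN)
      refine ⟨(∑ j ∈ P.G l, d j ^ 2) / (2 * P.groupNorm u l), fun t => ?_⟩
      have h4 : ∑ j ∈ P.G l, (u + t • d) j ^ 2 = P.groupNorm u l ^ 2 +
          (2 * t * ∑ j ∈ P.G l, u j * d j + t ^ 2 * ∑ j ∈ P.G l, d j ^ 2) := by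
        rw [P.groupNorm_sq_of_two hp, Finset.mul_sum, Finset.mul_sum, ← Finset.sum_add_distrib,
          ← Finset.sum_add_distrib]
        refine Finset.sum_congr rfl fun j _ => ?_
        simp only [PiLp.add_apply, PiLp.smul_apply, smul_eq_mul]
        ring
      rw [P.groupNorm_of_two hp (u + t • d), h4]
      refine (sqrt_add_le_add_div hN0
        (h4 ▸ Finset.sum_nonneg fun _ _ => sq_nonneg _)).trans_eq ?_
      have h5 : ∑ j ∈ P.G l, u j / (if P.p = 1 then |u j| else P.groupNorm u l) * d j =
          (∑ j ∈ P.G l, u j * d j) / P.groupNorm u l := by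
        rw [Finset.sum_div]
        refine Finset.sum_congr rfl fun j _ => ?_
        rw [if_neg (by omega)]
        ring
      rw [h5]
      field_simp
      ring

/-- Normalization is Lipschitz away from the origin. The splitting divides only by the norm of `z`,
so a lower bound `ν` is needed for `z` alone, and `u` merely has to be nonzero on the group. -/
theorem abs_div_groupNorm_sub_le (hp : P.p = 2) {ν : ℝ} (hν : 0 < ν)
    {u z : EuclideanSpace ℝ (Fin n)} {l : Fin L} (hu : 0 < P.groupNorm u l)
    (hz : ν ≤ P.groupNorm z l) {j : Fin n} (hj : j ∈ P.G l) :
    |u j / P.groupNorm u l - z j / P.groupNorm z l| ≤ 2 / ν * ‖u - z‖ := by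
  set U := P.groupNorm u l
  set Z := P.groupNorm z l
  have hZ : 0 < Z := hν.trans_le hz
  have h1 : u j / U - z j / Z = (u j - z j) / Z + u j / U * ((Z - U) / Z) := by
    field_simp; ring
  have h2 : |u j - z j| ≤ ‖u - z‖ := PiLp.norm_apply_le (u - z) j
  have h3 : |u j / U| ≤ 1 := by
    rw [abs_div, abs_of_pos hu, div_le_one hu]
    exact abs_le_groupNorm (Or.inr hp) u hj
  have h4 : |Z - U| ≤ ‖u - z‖ := by
    rw [norm_sub_rev]; exact abs_groupNorm_sub_le_of_two hp z u l
  have h0 := norm_nonneg (u - z)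
  calc |u j / U - z j / Z| ≤ |(u j - z j) / Z| + |u j / U * ((Z - U) / Z)| := by
        rw [h1]; exact abs_add_le _ _
    _ ≤ ‖u - z‖ / ν + 1 * (‖u - z‖ / ν) := by
        rw [abs_mul, abs_div, abs_div (Z - U), abs_of_pos hZ]
        gcongr
    _ = 2 / ν * ‖u - z‖ := by ring

theorem abs_normGrad_sub_le (hp : P.p = 1 ∨ P.p = 2) {ν : ℝ} (hν : 0 < ν)
    {u z : EuclideanSpace ℝ (Fin n)} {l : Fin L} (hsign : ∀ j, u j / |u j| = z j / |z j|)
    (h : (P.groupNorm u l = 0 ∧ P.groupNorm z l = 0) ∨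
      (0 < P.groupNorm u l ∧ ν ≤ P.groupNorm z l)) (j : Fin n) :
    |P.normGrad u l j - P.normGrad z l j| ≤ 2 / ν * ‖u - z‖ := by
  have h0 : 0 ≤ 2 / ν * ‖u - z‖ := by positivity
  unfold normGrad
  by_cases hj : j ∈ P.G l
  · rcases hp with hp | hp
    -- For `p = 1` the gradient is the sign vector, so equal signs give exact cancellation.
    · simp [hj, hp, hsign, h0]
    · simp only [hj, hp, if_true, OfNat.ofNat_ne_one, if_false]
      rcases h with ⟨h1, h2⟩ | ⟨h1, h2⟩
      · simp [h1, h2, h0]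
      · exact abs_div_groupNorm_sub_le hp hν h1 h2 hj
  · simp [hj, h0]

/-- Moving the `j`-th entry of `u` towards zero decreases the group norm at about the same rate at
which moving the `j`-th entry of `z` in the opposite direction increases it. -/
theorem exists_groupNorm_add_single_le (hp : P.p = 1 ∨ P.p = 2) {ν : ℝ} (hν : 0 < ν)
    {u z : EuclideanSpace ℝ (Fin n)} {l : Fin L} (hz : ν ≤ P.groupNorm z l) {j : Fin n}
    (hu : u j ≠ 0) :
    ∃ C, ∀ t : ℝ, 0 ≤ t → P.groupNorm (z + t • EuclideanSpace.single j (u j / |u j|)) l -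
        P.groupNorm z l + (P.groupNorm (u - t • EuclideanSpace.single j (u j / |u j|)) l -
        P.groupNorm u l) ≤ t * (2 / ν * ‖u - z‖) + C * t ^ 2 := by
  have habs : 0 < |u j| := abs_pos.2 hu
  have hσ : abs (u j / |u j|) = 1 := by rw [abs_div, abs_abs, div_self habs.ne']
  have hσ2 : u j / |u j| * (u j / |u j|) = 1 := by
    rw [← abs_mul_abs_self, hσ, one_mul]
  set σ := u j / |u j| with hσdef
  set e : EuclideanSpace ℝ (Fin n) := EuclideanSpace.single j σ with he
  have hej : e j = σ := by simp [e]
  have hei : ∀ i, i ≠ j → e i = 0 := fun i hi => by simp [e, hi]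
  have h0 : 0 ≤ 2 / ν * ‖u - z‖ := by positivity
  by_cases hj : j ∈ P.G l
  swap
  · refine ⟨0, fun t ht => ?_⟩
    have hne : ∀ i ∈ P.G l, i ≠ j := fun i hi h => hj (h ▸ hi)
    rw [P.groupNorm_congr (z + t • e) z l fun i hi => by simp [hei i (hne i hi)],
      P.groupNorm_congr (u - t • e) u l fun i hi => by simp [hei i (hne i hi)]]
    have := mul_nonneg ht h0
    linarith
  have hUpos : 0 < P.groupNorm u l := habs.trans_le (abs_le_groupNorm hp u hj)
  obtain ⟨C₁, hC₁⟩ := exists_groupNorm_add_le hp (u := u) (d := -e) (l := l)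
    (fun _ i _ hi => by
      have : i ≠ j := fun h => hu (h ▸ hi)
      simp [hei i this]) (fun h => absurd h hUpos.ne')
  have hsum1 : ∑ i, P.normGrad u l i * (-e) i = -(P.normGrad u l j * σ) := by
    rw [Finset.sum_eq_single j (fun i _ hi => by simp [hei i hi]) (by simp)]
    simp [hej]
  rcases hp with hp | hp
  -- For `p = 1` nothing is known about the sign of `z j`; the triangle inequality bounds the
  -- increase at `z` by `t`, which the decrease at `u` compensates.
  · refine ⟨C₁, fun t ht => ?_⟩
    have h1 := hC₁ t
    rw [hsum1, smul_neg, ← sub_eq_add_neg] at h1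
    have h2 : P.normGrad u l j = σ := by simp [normGrad, hj, hp, hσdef]
    rw [h2, hσ2] at h1
    have h3 := groupNorm_add_le (Or.inl hp) z (t • e) l
    have h4 : P.groupNorm (t • e) l = t := by
      rw [groupNorm_smul (Or.inl hp), abs_of_nonneg ht, P.groupNorm_of_one hp,
        Finset.sum_eq_single j (fun i _ hi => by simp [hei i hi]) (fun h => absurd hj h), hej, hσ,
        mul_one]
    have := mul_nonneg ht h0
    linarith
  · obtain ⟨C₂, hC₂⟩ := exists_groupNorm_add_le (Or.inr hp) (u := z) (d := e) (l := l)
      (fun h => by omega) (fun h => by linarith)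
    refine ⟨C₁ + C₂, fun t ht => ?_⟩
    have h1 := hC₁ t
    have h2 := hC₂ t
    rw [hsum1, smul_neg, ← sub_eq_add_neg] at h1
    have hsum2 : ∑ i, P.normGrad z l i * e i = P.normGrad z l j * σ := by
      rw [Finset.sum_eq_single j (fun i _ hi => by simp [hei i hi]) (by simp), hej]
    rw [hsum2] at h2
    have h3 := abs_div_groupNorm_sub_le hp hν hUpos hz hj
    have h4 : P.normGrad u l j = u j / P.groupNorm u l := by simp [normGrad, hj, hp]
    have h5 : P.normGrad z l j = z j / P.groupNorm z l := by simp [normGrad, hj, hp]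
    rw [← h4, ← h5] at h3
    have h6 : (P.normGrad z l j - P.normGrad u l j) * σ ≤ 2 / ν * ‖u - z‖ := by
      refine (le_abs_self _).trans ?_
      rw [abs_mul, hσ, mul_one, abs_sub_comm]
      exact h3
    have h7 := mul_le_mul_of_nonneg_left h6 ht
    linarith

end SparseGroupProblem

/-! ### The relaxed objective and the subproblems -/

@[simp] theorem theta_zero (t μ : ℝ) : theta 0 t μ = 0 := rfl

@[simp] theorem theta_one (t μ : ℝ) : theta 1 t μ = t / μ - 1 := rfl

@[simp] theorem theta_two (t μ : ℝ) : theta 2 t μ = -t / μ - 1 := rfl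

open Classical in
theorem le_maxArgmax_apply {m : ℕ} [NeZero m] (g : Fin m → ℝ) (i : Fin m) :
    g i ≤ g (maxArgmax g) := by
  have h : maxArgmax g ∈ Finset.univ.filter fun i => ∀ i', g i' ≤ g i := Finset.max'_mem _ _
  exact (Finset.mem_filter.1 h).2 i

theorem le_maxArgmax {m : ℕ} [NeZero m] (g : Fin m → ℝ) {i : Fin m} (hi : ∀ i', g i' ≤ g i) :
    i ≤ maxArgmax g :=
  Finset.le_max' _ _ (Finset.mem_filter.2 ⟨Finset.mem_univ _, hi⟩)

theorem sup'_eq_maxArgmax {m : ℕ} [NeZero m] (g : Fin m → ℝ) :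
    Finset.univ.sup' Finset.univ_nonempty g = g (maxArgmax g) :=
  le_antisymm (Finset.sup'_le _ _ fun i _ => le_maxArgmax_apply g i)
    (Finset.le_sup' g (Finset.mem_univ _))

namespace SparseGroupProblem

variable {n L : ℕ} {P : SparseGroupProblem n L}

theorem activeI_eq_zero {x : EuclideanSpace ℝ (Fin n)} {ν : ℝ} (hν : 0 < ν) {j : Fin n}
    (h : |x j| < ν) : activeI x ν j = 0 := by
  have h0 := le_maxArgmax_apply (fun i : Fin 3 => theta i (x j) ν) 0
  change theta 0 (x j) ν ≤ theta (activeI x ν j) (x j) ν at h0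
  obtain ⟨h1, h2⟩ := abs_lt.1 h
  generalize activeI x ν j = i at h0
  have h3 : x j / ν < 1 := by rwa [div_lt_one hν]
  have h4 : -x j / ν < 1 := by rw [div_lt_one hν]; linarith
  fin_cases i
  · rfl
  · simp at h0; linarith
  · simp at h0; linarith

/-- At `x j = ν` the first two pieces tie, and the largest-index rule decides for the sloped one.
This makes the threshold `ν ≤ |x j|` inclusive, as the identification argument needs. -/
theorem activeI_eq_one {x : EuclideanSpace ℝ (Fin n)} {ν : ℝ} (hν : 0 < ν) {j : Fin n}
    (h : ν ≤ x j) : activeI x ν j = 1 := by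
  have h3 : 1 ≤ x j / ν := by rwa [one_le_div hν]
  have hle : (1 : Fin 3) ≤ activeI x ν j := by
    refine le_maxArgmax _ fun i => ?_
    fin_cases i <;> simp [neg_div] <;> linarith
  have h0 := le_maxArgmax_apply (fun i : Fin 3 => theta i (x j) ν) 0
  change theta 0 (x j) ν ≤ theta (activeI x ν j) (x j) ν at h0
  generalize activeI x ν j = i at h0 hle
  fin_cases i
  · simp at hle
  · rfl
  · simp [neg_div] at h0; linarith

theorem activeI_eq_two {x : EuclideanSpace ℝ (Fin n)} {ν : ℝ} (hν : 0 < ν) {j : Fin n}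
    (h : x j ≤ -ν) : activeI x ν j = 2 := by
  have h3 : 1 ≤ -x j / ν := by rw [one_le_div hν]; linarith
  have hle : (2 : Fin 3) ≤ activeI x ν j := by
    refine le_maxArgmax _ fun i => ?_
    rw [neg_div] at h3
    fin_cases i <;> simp [neg_div] <;> linarith
  exact le_antisymm (Fin.le_last _) hle

theorem activeJ_eq_zero {x : EuclideanSpace ℝ (Fin n)} {ν : ℝ} (hν : 0 < ν) {l : Fin L}
    (h : P.groupNorm x l < ν) : P.activeJ x ν l = 0 := by
  have h0 := le_maxArgmax_apply (fun i : Fin 2 => theta i.castSucc (P.groupNorm x l) ν) 0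
  change theta 0 (P.groupNorm x l) ν ≤ theta (P.activeJ x ν l).castSucc (P.groupNorm x l) ν at h0
  generalize P.activeJ x ν l = i at h0
  have h3 : P.groupNorm x l / ν < 1 := by rwa [div_lt_one hν]
  fin_cases i
  · rfl
  · simp at h0; linarith

theorem activeJ_eq_one {x : EuclideanSpace ℝ (Fin n)} {ν : ℝ} (hν : 0 < ν) {l : Fin L}
    (h : ν ≤ P.groupNorm x l) : P.activeJ x ν l = 1 := by
  have h3 : 1 ≤ P.groupNorm x l / ν := by rwa [one_le_div hν]
  have hle : (1 : Fin 2) ≤ P.activeJ x ν l := by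
    refine le_maxArgmax _ fun i => ?_
    fin_cases i <;> simp <;> linarith
  exact le_antisymm (Fin.le_last _) hle

theorem F_le (hlam1 : 0 ≤ P.lam1) (hlam2 : 0 ≤ P.lam2) (hw : ∀ l, 0 ≤ P.w l)
    (I : Fin n → Fin 3) (J : Fin L → Fin 2) (x : EuclideanSpace ℝ (Fin n)) (μ : ℝ) :
    P.F x μ ≤ P.f x + P.convexPenalty x μ - P.Theta I J x μ := by
  have h1 : P.lam1 * ∑ j, theta (I j) (x j) μ ≤ P.lam1 * ∑ j, Finset.univ.sup'
      Finset.univ_nonempty (fun i : Fin 3 => theta i (x j) μ) :=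
    mul_le_mul_of_nonneg_left (Finset.sum_le_sum fun j _ =>
      Finset.le_sup' (fun i : Fin 3 => theta i (x j) μ) (Finset.mem_univ _)) hlam1
  have h2 : P.lam2 * ∑ l, P.w l * theta (J l).castSucc (P.groupNorm x l) μ ≤
      P.lam2 * ∑ l, P.w l * Finset.univ.sup' Finset.univ_nonempty
        (fun i : Fin 2 => theta i.castSucc (P.groupNorm x l) μ) :=
    mul_le_mul_of_nonneg_left (Finset.sum_le_sum fun l _ => mul_le_mul_of_nonneg_left
      (Finset.le_sup' (fun i : Fin 2 => theta i.castSucc (P.groupNorm x l) μ)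
        (Finset.mem_univ _)) (hw l)) hlam2
  unfold F Theta
  linarith

theorem F_eq (x : EuclideanSpace ℝ (Fin n)) (μ : ℝ) :
    P.F x μ = P.f x + P.convexPenalty x μ - P.Theta (activeI x μ) (P.activeJ x μ) x μ := by
  unfold F Theta activeI activeJ
  simp only [sup'_eq_maxArgmax]
  ring

/-- Every piece `theta i t μ` is at most `|t| / μ`, so the relaxed penalty is nonnegative. Bounds on
`F` thereby transfer to `f`, whose level sets are bounded on the box. -/
theorem f_le_F (hlam1 : 0 ≤ P.lam1) (hlam2 : 0 ≤ P.lam2) (hw : ∀ l, 0 ≤ P.w l) {μ : ℝ}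
    (hμ : 0 < μ) (x : EuclideanSpace ℝ (Fin n)) : P.f x ≤ P.F x μ := by
  have h1 : P.lam1 * ∑ j, theta (activeI x μ j) (x j) μ ≤ P.lam1 * ∑ j, |x j| / μ := by
    refine mul_le_mul_of_nonneg_left (Finset.sum_le_sum fun j _ => ?_) hlam1
    generalize activeI x μ j = i
    have h0 : 0 ≤ |x j| / μ := by positivity
    have h1 : x j / μ ≤ |x j| / μ := by gcongr; exact le_abs_self _
    have h2 : -x j / μ ≤ |x j| / μ := by gcongr; exact neg_le_abs _
    fin_cases i <;> simp <;> linarith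
  have h2 : P.lam2 * ∑ l, P.w l * theta (P.activeJ x μ l).castSucc (P.groupNorm x l) μ ≤
      P.lam2 * ∑ l, P.w l * (P.groupNorm x l / μ) := by
    refine mul_le_mul_of_nonneg_left (Finset.sum_le_sum fun l _ =>
      mul_le_mul_of_nonneg_left ?_ (hw l)) hlam2
    generalize P.activeJ x μ l = i
    have h0 : 0 ≤ P.groupNorm x l / μ := div_nonneg (P.groupNorm_nonneg x l) hμ.le
    fin_cases i <;> simp <;> linarith
  rw [F_eq]
  unfold convexPenalty Theta
  simp only [← mul_div_assoc, ← Finset.sum_div] at h1 h2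
  simp only [div_mul_eq_mul_div]
  linarith

/-- At points whose nonzero entries are at least `ν` in absolute value, the relaxation is exact. -/
theorem F_eq_F0 (hp : P.p = 1 ∨ P.p = 2) {ν : ℝ} (hν : 0 < ν) {x : EuclideanSpace ℝ (Fin n)}
    (hx : ∀ j, x j ≠ 0 → ν ≤ |x j|) : P.F x ν = P.F0 x := by
  classical
  have h1 : ∀ j, theta (activeI x ν j) (x j) ν = |x j| / ν - if x j ≠ 0 then (1 : ℝ) else 0 := by
    intro j
    by_cases h : x j = 0
    · rw [activeI_eq_zero hν (by simpa [h] using hν)]; simp [h]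
    · rcases le_abs.1 (hx j h) with h' | h'
      · rw [activeI_eq_one hν h', abs_of_nonneg (hν.le.trans h')]; simp [h]
      · rw [activeI_eq_two hν (by linarith), abs_of_nonpos (by linarith)]; simp [h]
  have h2 : ∀ l, theta (P.activeJ x ν l).castSucc (P.groupNorm x l) ν =
      P.groupNorm x l / ν - if P.groupNorm x l ≠ 0 then (1 : ℝ) else 0 := by
    intro l
    by_cases h : P.groupNorm x l = 0
    · rw [activeJ_eq_zero hν (by simpa [h] using hν)]; simp [h]
    · have h' : ∃ j ∈ P.G l, x j ≠ 0 := by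
        rw [groupNorm_eq_zero_iff hp] at h; push Not at h; exact h
      obtain ⟨j, hj, hxj⟩ := h'
      rw [activeJ_eq_one hν ((hx j hxj).trans (abs_le_groupNorm hp x hj))]; simp [h]
  rw [F_eq]
  unfold Theta F0 convexPenalty
  simp only [h1, h2, mul_sub, Finset.sum_sub_distrib, ← mul_div_assoc, ← Finset.sum_div]
  simp only [div_mul_eq_mul_div]
  ring_nf

theorem F0_eq_add (hp : P.p = 1 ∨ P.p = 2) {x y : EuclideanSpace ℝ (Fin n)}
    (h : ∀ j, x j = 0 ↔ y j = 0) : P.F0 x = P.F0 y - P.f y + P.f x := by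
  classical
  have h1 : ∀ l, P.groupNorm x l = 0 ↔ P.groupNorm y l = 0 := fun l => by
    simp only [groupNorm_eq_zero_iff hp, h]
  unfold F0
  simp only [ne_eq, h, h1]
  ring


end SparseGroupProblem

/-! ### The box, and the descent and optimality inequalities of a single subproblem -/

namespace SparseGroupProblem

variable {n L : ℕ} {P : SparseGroupProblem n L} {Lf Ls : ℝ}

theorem mem_Omega_of_shrink (hlo : ∀ j, P.lo j ≤ 0) (hhi : ∀ j, 0 ≤ P.hi j)
    {u v : EuclideanSpace ℝ (Fin n)} (hu : u ∈ P.Omega)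
    (h : ∀ j, (0 ≤ v j ∧ v j ≤ u j) ∨ (u j ≤ v j ∧ v j ≤ 0)) : v ∈ P.Omega := by
  intro j
  obtain ⟨h1, h2⟩ := hu j
  rcases h j with ⟨h3, h4⟩ | ⟨h3, h4⟩
  · exact ⟨(hlo j).trans (by exact_mod_cast h3), le_trans (by exact_mod_cast h4) h2⟩
  · exact ⟨h1.trans (by exact_mod_cast h3), le_trans (by exact_mod_cast h4) (hhi j)⟩

theorem isClosed_Omega : IsClosed P.Omega := by
  have : P.Omega = ⋂ j, {x : EuclideanSpace ℝ (Fin n) |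
      P.lo j ≤ ((x j : ℝ) : EReal) ∧ ((x j : ℝ) : EReal) ≤ P.hi j} := by
    ext x; simp [Omega]
  rw [this]
  refine isClosed_iInter fun j => ?_
  have hc : Continuous fun x : EuclideanSpace ℝ (Fin n) => ((x j : ℝ) : EReal) :=
    continuous_coe_real_ereal.comp (by fun_prop)
  exact (isClosed_le continuous_const hc).inter (isClosed_le hc continuous_const)

theorem convex_Omega : Convex ℝ P.Omega := by
  have : P.Omega = ⋂ j, (fun x : EuclideanSpace ℝ (Fin n) => x j) ⁻¹'
      {t : ℝ | P.lo j ≤ (t : EReal) ∧ (t : EReal) ≤ P.hi j} := by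
    ext x; simp [Omega]
  rw [this]
  refine convex_iInter fun j => ?_
  have hord : OrdConnected {t : ℝ | P.lo j ≤ (t : EReal) ∧ (t : EReal) ≤ P.hi j} :=
    ⟨fun a ha b hb c hc => ⟨ha.1.trans (EReal.coe_le_coe_iff.2 hc.1),
      (EReal.coe_le_coe_iff.2 hc.2).trans hb.2⟩⟩
  exact hord.convex.is_linear_preimage
    ⟨fun _ _ => rfl, fun _ _ => rfl⟩

namespace StandingAssumptions

theorem f_convex (hP : P.StandingAssumptions Lf Ls) : ConvexOn ℝ univ P.f :=
  hP.fn_convex.add hP.fs_convex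

theorem f_continuous (hP : P.StandingAssumptions Lf Ls) : Continuous P.f :=
  hP.f_convex.locallyLipschitz.continuous

theorem convexOn_model (hP : P.StandingAssumptions Lf Ls) (I : Fin n → Fin 3) (J : Fin L → Fin 2)
    (ξ : EuclideanSpace ℝ (Fin n)) {μ : ℝ} (hμ : 0 < μ) (y z : EuclideanSpace ℝ (Fin n)) :
    ConvexOn ℝ P.Omega (P.model I J ξ μ y z) := by
  have h1 : ConvexOn ℝ univ fun x : EuclideanSpace ℝ (Fin n) => ∑ j, |x j| := by
    refine convexOn_finset_sum _ convex_univ fun j _ => ?_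
    refine ⟨convex_univ, fun x _ y _ s t hs ht _ => ?_⟩
    refine (abs_add_le _ _).trans_eq ?_
    simp [abs_mul, abs_of_nonneg hs, abs_of_nonneg ht]
  have h2 : ConvexOn ℝ univ fun x : EuclideanSpace ℝ (Fin n) =>
      ∑ l, P.w l * P.groupNorm x l :=
    convexOn_finset_sum _ convex_univ fun l _ => (convexOn_groupNorm hP.p_eq l).smul (hP.w_nonneg l)
  have h3 : ConvexOn ℝ univ fun x : EuclideanSpace ℝ (Fin n) => P.convexPenalty x μ :=
    (h1.smul (div_nonneg hP.lam1_pos.le hμ.le)).add (h2.smul (div_nonneg hP.lam2_nonneg hμ.le))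
  have h4 : ∀ a b : EuclideanSpace ℝ (Fin n), ConvexOn ℝ univ
      fun x : EuclideanSpace ℝ (Fin n) => inner ℝ a (x - b) := by
    intro a b
    refine ⟨convex_univ, fun x _ y _ s t _ _ hst => le_of_eq ?_⟩
    have : s • x + t • y - b = s • (x - b) + t • (y - b) := by
      have hb : b = s • b + t • b := by rw [← add_smul, hst, one_smul]
      nth_rw 1 [hb]; module
    beta_reduce
    rw [this, inner_add_right, inner_smul_right, inner_smul_right, smul_eq_mul, smul_eq_mul]
  have h5 := ((hP.fn_convex.add h3).add (h4 (gradient P.fs y) y)).add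
    ((h4 (-ξ) z).add (convexOn_const (P.fs y - P.Theta I J z μ) convex_univ))
  refine (h5.subset (subset_univ _) convex_Omega).congr fun x _ => ?_
  simp only [Pi.add_apply, model, inner_neg_left]
  ring

/-- Three majorizations add up: a single piece replaces each maximum, `ξ` linearizes `Θ` from below
at `z`, and the descent lemma linearizes `fs` from above at `y`. -/
theorem F_le_model (hP : P.StandingAssumptions Lf Ls) {I : Fin n → Fin 3} {J : Fin L → Fin 2}
    {ξ z : EuclideanSpace ℝ (Fin n)} {μ : ℝ}
    (hξ : ξ ∈ subdifferential (fun v => ((P.Theta I J v μ : ℝ) : EReal)) z)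
    (y v : EuclideanSpace ℝ (Fin n)) :
    P.F v μ ≤ P.model I J ξ μ y z v + Ls / 2 * ‖v - y‖ ^ 2 := by
  have h1 := F_le hP.lam1_pos.le hP.lam2_nonneg hP.w_nonneg I J v μ
  have h2 := mem_subdifferential_coe_iff.1 hξ v
  have h3 := le_add_inner_gradient_add_sq hP.fs_differentiable hP.fs_gradient_lipschitz y v
  unfold f at h1
  unfold model
  linarith

theorem model_le_F (hP : P.StandingAssumptions Lf Ls) (ξ y z : EuclideanSpace ℝ (Fin n)) (μ : ℝ) :
    P.model (activeI z μ) (P.activeJ z μ) ξ μ y z z ≤ P.F z μ := by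
  have h1 := hP.fs_convex.add_inner_gradient_le hP.fs_differentiable y z
  rw [F_eq]
  unfold f model
  rw [sub_self, inner_zero_right]
  linarith

/-- The basic descent inequality of the subproblems. -/
theorem descent (hP : P.StandingAssumptions Lf Ls) {μ α : ℝ} (hμ : 0 < μ)
    {y z ξ u : EuclideanSpace ℝ (Fin n)} (hz : z ∈ P.Omega)
    (h : P.SolvesSubproblem μ μ α y z ξ u) :
    P.F u μ + α / 2 * ‖u - y‖ ^ 2 + α / 2 * ‖u - z‖ ^ 2 ≤
      P.F z μ + α / 2 * ‖z - y‖ ^ 2 + Ls / 2 * ‖u - y‖ ^ 2 := by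
  obtain ⟨hξ, hu, hmin⟩ := h
  have h1 := hmin.prox_growth convex_Omega (hP.convexOn_model _ _ ξ hμ y z) hu hz
  have h2 := hP.F_le_model hξ y u
  have h3 := hP.model_le_F ξ y z μ
  rw [norm_sub_rev z u] at h1
  linarith

/-- The optimality condition of a subproblem, with the linearization at `z` bounded by means of
the point `z - d`. -/
theorem optimality (hP : P.StandingAssumptions Lf Ls) {μ τ α : ℝ} (hμ : 0 < μ)
    {y z ξ u d : EuclideanSpace ℝ (Fin n)} (h : P.SolvesSubproblem μ τ α y z ξ u)
    (hd : u + d ∈ P.Omega) :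
    0 ≤ P.fn (u + d) - P.fn u
      + P.lam1 / μ * ∑ j, (|u j + d j| - |u j| + μ * (theta (activeI z τ j) (z j - d j) μ
          - theta (activeI z τ j) (z j) μ))
      + P.lam2 / μ * ∑ l, P.w l * (P.groupNorm (u + d) l - P.groupNorm u l
          + μ * (theta (P.activeJ z τ l).castSucc (P.groupNorm (z - d) l) μ
            - theta (P.activeJ z τ l).castSucc (P.groupNorm z l) μ))
      + inner ℝ (gradient P.fs y) d + α * inner ℝ (u - y) d := by
  obtain ⟨hξ, hu, hmin⟩ := h
  have h1 := hmin.prox_optimality convex_Omega (hP.convexOn_model _ _ ξ hμ y z) hu hd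
  -- Testing `ξ` at the reflected point `z - d` replaces `-⟨ξ, d⟩` by a difference of values of `Θ`,
  -- so the subdifferential of `Θ` never has to be computed.
  have h2 := mem_subdifferential_coe_iff.1 hξ (z - d)
  rw [add_sub_cancel_left] at h1
  rw [show z - d - z = -d by abel, inner_neg_right] at h2
  have h3 : inner ℝ (gradient P.fs y) (u + d - y) - inner ℝ (gradient P.fs y) (u - y) =
      inner ℝ (gradient P.fs y) d := by rw [← inner_sub_right]; congr 1; abel
  have h4 : inner ℝ ξ (u + d - z) - inner ℝ ξ (u - z) = inner ℝ ξ d := by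
    rw [← inner_sub_right]; congr 1; abel
  have e1 : P.lam1 / μ * ∑ j, (|u j + d j| - |u j| + μ * (theta (activeI z τ j) (z j - d j) μ
          - theta (activeI z τ j) (z j) μ)) =
      P.lam1 / μ * ∑ j, |(u + d) j| - P.lam1 / μ * ∑ j, |u j|
        + (P.lam1 * ∑ j, theta (activeI z τ j) ((z - d) j) μ
          - P.lam1 * ∑ j, theta (activeI z τ j) (z j) μ) := by
    rw [Finset.sum_add_distrib, Finset.sum_sub_distrib, ← Finset.mul_sum, Finset.sum_sub_distrib]
    simp only [PiLp.add_apply, PiLp.sub_apply]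
    field_simp
  have e2 : P.lam2 / μ * ∑ l, P.w l * (P.groupNorm (u + d) l - P.groupNorm u l
          + μ * (theta (P.activeJ z τ l).castSucc (P.groupNorm (z - d) l) μ
            - theta (P.activeJ z τ l).castSucc (P.groupNorm z l) μ)) =
      P.lam2 / μ * ∑ l, P.w l * P.groupNorm (u + d) l - P.lam2 / μ * ∑ l, P.w l * P.groupNorm u l
        + (P.lam2 * ∑ l, P.w l * theta (P.activeJ z τ l).castSucc (P.groupNorm (z - d) l) μ
          - P.lam2 * ∑ l, P.w l * theta (P.activeJ z τ l).castSucc (P.groupNorm z l) μ) := by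
    have : ∀ l, P.w l * (P.groupNorm (u + d) l - P.groupNorm u l
          + μ * (theta (P.activeJ z τ l).castSucc (P.groupNorm (z - d) l) μ
            - theta (P.activeJ z τ l).castSucc (P.groupNorm z l) μ)) =
        P.w l * P.groupNorm (u + d) l - P.w l * P.groupNorm u l +
        μ * (P.w l * theta (P.activeJ z τ l).castSucc (P.groupNorm (z - d) l) μ
          - P.w l * theta (P.activeJ z τ l).castSucc (P.groupNorm z l) μ) := fun l => by ring
    simp only [this]
    rw [Finset.sum_add_distrib, Finset.sum_sub_distrib, ← Finset.mul_sum, Finset.sum_sub_distrib]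
    field_simp
  rw [e1, e2]
  unfold model convexPenalty at h1
  unfold Theta at h2
  linarith

/-- If `|z j| < ν` and the next iterate has a nonzero `j`-th entry, then the step is not small. -/
theorem identification (hP : P.StandingAssumptions Lf Ls) {α : ℝ} (hα : 0 ≤ α)
    {y z ξ u : EuclideanSpace ℝ (Fin n)} (h : P.SolvesSubproblem P.ν P.ν α y z ξ u) {j : Fin n}
    (hz : |z j| < P.ν) (hu : u j ≠ 0) :
    P.lam1 / P.ν - Lf ≤ (Ls + α) * ‖u - y‖ +
      P.lam2 / P.ν * ∑ l, P.w l * (2 / P.ν * ‖u - z‖) := by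
  have hν := hP.nu_pos
  have habs : 0 < |u j| := abs_pos.2 hu
  have hσ : abs (u j / |u j|) = 1 := by rw [abs_div, abs_abs, div_self habs.ne']
  -- The test direction pulls `u j` towards zero. On an inactive group the subtracted piece is
  -- constant and the norm at `u` does not grow; on an active one the two changes nearly cancel.
  have hl : ∀ l, ∃ C, ∀ t : ℝ, 0 ≤ t → t ≤ |u j| →
      P.groupNorm (u + -(t • EuclideanSpace.single j (u j / |u j|))) l - P.groupNorm u l
        + P.ν * (theta (P.activeJ z P.ν l).castSucc
            (P.groupNorm (z - -(t • EuclideanSpace.single j (u j / |u j|))) l) P.ν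
          - theta (P.activeJ z P.ν l).castSucc (P.groupNorm z l) P.ν) ≤
      t * (2 / P.ν * ‖u - z‖) + C * t ^ 2 := by
    intro l
    rcases lt_or_ge (P.groupNorm z l) P.ν with hlt | hge
    · refine ⟨0, fun t ht htu => ?_⟩
      rw [activeJ_eq_zero hν hlt]
      have h1 := P.groupNorm_mono (u + -(t • EuclideanSpace.single j (u j / |u j|))) u l
        fun i _ => by
          by_cases hi : i = j
          · subst hi
            have : (u + -(t • EuclideanSpace.single i (u i / |u i|))) i =
                u i / |u i| * (|u i| - t) := by
              simp; field_simp; ring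
            rw [this, abs_mul, hσ, one_mul, abs_of_nonneg (by linarith)]
            linarith
          · simp [hi]
      have h2 : 0 ≤ t * (2 / P.ν * ‖u - z‖) := by positivity
      simp only [Fin.castSucc_zero, theta_zero]
      linarith
    · obtain ⟨C, hC⟩ := exists_groupNorm_add_single_le hP.p_eq hν hge hu
      refine ⟨C, fun t ht _ => ?_⟩
      rw [activeJ_eq_one hν hge]
      have h1 := hC t ht
      have h2 : ∀ a b : ℝ, P.ν * (theta (Fin.castSucc 1) a P.ν - theta (Fin.castSucc 1) b P.ν)
          = a - b := fun a b => by
        rw [show (Fin.castSucc 1 : Fin 3) = 1 from rfl, theta_one, theta_one]; field_simp; ring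
      rw [h2, sub_neg_eq_add, ← sub_eq_add_neg]
      linarith
  choose C hC using hl
  set e : EuclideanSpace ℝ (Fin n) := EuclideanSpace.single j (u j / |u j|) with he
  have hen : ‖e‖ = 1 := by rw [he, PiLp.norm_single, Real.norm_eq_abs, hσ]
  have key : 0 ≤ Lf + (Ls + α) * ‖u - y‖ - P.lam1 / P.ν +
      P.lam2 / P.ν * ∑ l, P.w l * (2 / P.ν * ‖u - z‖) := by
    refine nonneg_of_forall_small (C := P.lam2 / P.ν * ∑ l, P.w l * C l) habs fun t ht htu => ?_
    have hmem : u + -(t • e) ∈ P.Omega := by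
      refine mem_Omega_of_shrink hP.lo_nonpos hP.hi_nonneg h.2.1 fun i => ?_
      by_cases hi : i = j
      · subst hi
        have : (u + -(t • e)) i = u i - t * (u i / |u i|) := by simp [e, sub_eq_add_neg]
        rw [this]
        rcases lt_or_gt_of_ne hu with h' | h'
        · right
          rw [abs_of_neg h'] at htu ⊢
          rw [div_neg, div_self hu]
          constructor <;> linarith
        · left
          rw [abs_of_pos h'] at htu ⊢
          rw [div_self hu]
          constructor <;> linarith
      · have : (u + -(t • e)) i = u i := by simp [e, hi]
        rw [this]
        rcases le_total 0 (u i) with h' | h'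
        · exact Or.inl ⟨h', le_rfl⟩
        · exact Or.inr ⟨le_rfl, h'⟩
    have h1 := hP.optimality hν h hmem
    have h2 : ∑ i, (|u i + (-(t • e)) i| - |u i| + P.ν * (theta (activeI z P.ν i)
        (z i - (-(t • e)) i) P.ν - theta (activeI z P.ν i) (z i) P.ν)) = -t := by
      -- Since `|z j| < ν` the active piece of coordinate `j` is constant, so the decrease `-t` of
      -- `|u j|` is not compensated.
      rw [Finset.sum_eq_single j (fun i _ hi => by simp [e, hi]) (by simp),
        activeI_eq_zero hν hz]
      have : u j + (-(t • e)) j = u j / |u j| * (|u j| - t) := by simp [e]; field_simp; ring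
      rw [this, abs_mul, hσ, one_mul, abs_of_nonneg (by linarith)]
      simp
    have h3 : P.lam2 / P.ν * ∑ l, P.w l * (P.groupNorm (u + -(t • e)) l - P.groupNorm u l
          + P.ν * (theta (P.activeJ z P.ν l).castSucc (P.groupNorm (z - -(t • e)) l) P.ν
            - theta (P.activeJ z P.ν l).castSucc (P.groupNorm z l) P.ν)) ≤
        P.lam2 / P.ν * ∑ l, P.w l * (t * (2 / P.ν * ‖u - z‖) + C l * t ^ 2) := by
      refine mul_le_mul_of_nonneg_left (Finset.sum_le_sum fun l _ => ?_)
        (div_nonneg hP.lam2_nonneg hν.le)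
      exact mul_le_mul_of_nonneg_left (hC l t ht.le htu) (hP.w_nonneg l)
    have h4 : P.lam2 / P.ν * ∑ l, P.w l * (t * (2 / P.ν * ‖u - z‖) + C l * t ^ 2) =
        t * (P.lam2 / P.ν * ∑ l, P.w l * (2 / P.ν * ‖u - z‖)) +
          (P.lam2 / P.ν * ∑ l, P.w l * C l) * t ^ 2 := by
      simp only [mul_add, Finset.sum_add_distrib, Finset.mul_sum, Finset.sum_mul]
      congr 1 <;> exact Finset.sum_congr rfl fun l _ => by ring
    -- The subgradient is taken at the moved point, which lies in the box: this is the side on which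
    -- convexity bounds the increase of `f` from above by `t * Lf`.
    obtain ⟨ζ, hζ⟩ := hP.f_convex.exists_subgradient (u + -(t • e))
    have h5 : P.f (u + -(t • e)) - P.f u ≤ t * Lf := by
      have h6 := hζ u
      rw [show u - (u + -(t • e)) = t • e by abel, inner_smul_right, he,
        EuclideanSpace.inner_single_right, conj_trivial] at h6
      have h7 : |ζ j| ≤ Lf :=
        hP.Lf_bound _ hmem ζ (mem_subdifferential_coe_iff.2 hζ) j
      have h8 : -(u j / |u j| * ζ j) ≤ Lf := by
        refine (neg_le_abs _).trans ?_
        rw [abs_mul, hσ, one_mul]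
        exact h7
      have h9 := mul_le_mul_of_nonneg_left h8 ht.le
      rw [← he] at h6
      linarith
    -- This converts the bound for `f` into one for `fn`, with `∇fs u` replacing `fs`; the mismatch
    -- with `∇fs y` costs `Ls * ‖u - y‖`.
    have h6 := hP.fs_convex.add_inner_gradient_le hP.fs_differentiable u (u + -(t • e))
    rw [add_sub_cancel_left, inner_neg_right, inner_smul_right] at h6
    rw [inner_neg_right, inner_smul_right, inner_neg_right, inner_smul_right, h2] at h1
    have h7 : inner ℝ (gradient P.fs u) e - inner ℝ (gradient P.fs y) e ≤ Ls * ‖u - y‖ := by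
      rw [← inner_sub_left]
      refine (real_inner_le_norm _ _).trans ?_
      rw [hen, mul_one]
      exact hP.fs_gradient_lipschitz u y
    have h8 : -inner ℝ (u - y) e ≤ ‖u - y‖ := by
      refine (neg_le_abs _).trans ((abs_real_inner_le_norm _ _).trans ?_)
      rw [hen, mul_one]
    have h9 := mul_le_mul_of_nonneg_left h7 ht.le
    have h10 := mul_le_mul_of_nonneg_left (mul_le_mul_of_nonneg_left h8 hα) ht.le
    rw [h4] at h3
    unfold f at h5
    linarith
  linarith

end StandingAssumptions
end SparseGroupProblem

/-! ### Fixed sign patterns: local minimality and small subgradients -/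

theorem EuclideanSpace.norm_le_sum_abs {ι : Type*} [Fintype ι] (g : EuclideanSpace ℝ ι) :
    ‖g‖ ≤ ∑ j, |g j| := by
  rw [EuclideanSpace.norm_eq]
  refine Real.sqrt_le_iff.2 ⟨Finset.sum_nonneg fun _ _ => abs_nonneg _, ?_⟩
  simp only [Real.norm_eq_abs]
  exact Finset.sum_sq_le_sq_sum_of_nonneg fun _ _ => abs_nonneg _

namespace SparseGroupProblem

variable {n L : ℕ} {P : SparseGroupProblem n L} {Lf Ls : ℝ}

/-- `u` and `z` have the same zero entries, and their other entries have the same signs and are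
at least `ν` in absolute value. -/
def SamePattern (ν : ℝ) (u z : EuclideanSpace ℝ (Fin n)) : Prop :=
  ∀ j, (u j = 0 ∧ z j = 0) ∨ (ν ≤ |u j| ∧ ν ≤ |z j| ∧ u j / |u j| = z j / |z j|)

/-- Near `xs` the support cannot shrink. If it is unchanged, the penalties agree and minimality on
the face decides. If it grows, the `‖·‖₀` term costs at least `λ₁`, while by continuity `f` drops by
less than `λ₁` and the group terms do not decrease. -/
theorem isStrongLocalMinimizer_of_face (hP : P.StandingAssumptions Lf Ls)
    {xs : EuclideanSpace ℝ (Fin n)} (hxs : xs ∈ P.Omega) (hν : ∀ j, xs j ≠ 0 → P.ν ≤ |xs j|)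
    (hmin : ∀ v ∈ P.face xs, P.f xs ≤ P.f v) : P.IsStrongLocalMinimizer xs := by
  classical
  refine ⟨hxs, ?_, hν⟩
  have h1 : ∀ᶠ v in 𝓝 xs, ∀ j, xs j ≠ 0 → v j ≠ 0 := by
    refine eventually_all.2 fun j => ?_
    by_cases hj : xs j = 0
    · simp [hj]
    · have hc : Continuous fun v : EuclideanSpace ℝ (Fin n) => v j := by fun_prop
      filter_upwards [hc.continuousAt.eventually_ne hj] with v hv _ using hv
  have h2 : ∀ᶠ v in 𝓝 xs, P.f xs - P.lam1 < P.f v :=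
    hP.f_continuous.continuousAt.eventually (lt_mem_nhds (by linarith [hP.lam1_pos]))
  refine eventually_inf_principal.2 ?_
  filter_upwards [h1, h2] with v hv1 hv2 hvΩ
  by_cases hface : ∀ j, xs j = 0 → v j = 0
  · have h3 := F0_eq_add hP.p_eq (x := v) (y := xs)
      fun j => ⟨fun h => by_contra fun h' => hv1 j h' h, hface j⟩
    have h4 := hmin v ⟨hvΩ, hface⟩
    linarith
  · push Not at hface
    obtain ⟨i, hi, hvi⟩ := hface
    have h3 : ∑ j, (if xs j ≠ 0 then (1 : ℝ) else 0) + 1 ≤ ∑ j, if v j ≠ 0 then (1 : ℝ) else 0 := by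
      rw [← Finset.add_sum_erase _ _ (Finset.mem_univ i),
        ← Finset.add_sum_erase _ (fun j => if v j ≠ 0 then (1 : ℝ) else 0) (Finset.mem_univ i)]
      have : ∑ j ∈ Finset.univ.erase i, (if xs j ≠ 0 then (1 : ℝ) else 0) ≤
          ∑ j ∈ Finset.univ.erase i, if v j ≠ 0 then (1 : ℝ) else 0 := by
        refine Finset.sum_le_sum fun j _ => ?_
        by_cases hj : xs j = 0
        · simp only [hj, ne_eq, not_true_eq_false, if_false]
          split_ifs <;> norm_num
        · simp [hj, hv1 j hj]
      simp only [hi, hvi, ne_eq, not_true_eq_false, not_false_eq_true, if_true, if_false]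
      linarith
    have h4 : ∑ l, P.w l * (if P.groupNorm xs l ≠ 0 then (1 : ℝ) else 0) ≤
        ∑ l, P.w l * if P.groupNorm v l ≠ 0 then (1 : ℝ) else 0 := by
      refine Finset.sum_le_sum fun l _ => mul_le_mul_of_nonneg_left ?_ (hP.w_nonneg l)
      by_cases hl : P.groupNorm xs l = 0
      · simp only [hl, ne_eq, not_true_eq_false, if_false]
        split_ifs <;> norm_num
      · have hl' : P.groupNorm v l ≠ 0 := by
          rw [groupNorm_eq_zero_iff hP.p_eq] at hl
          rw [ne_eq, groupNorm_eq_zero_iff hP.p_eq]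
          push Not at hl ⊢
          obtain ⟨j, hj, hxj⟩ := hl
          exact ⟨j, hj, hv1 j hxj⟩
        simp [hl, hl']
    have h5 := mul_le_mul_of_nonneg_left h3 hP.lam1_pos.le
    have h6 := mul_le_mul_of_nonneg_left h4 hP.lam2_nonneg
    unfold F0
    linarith

namespace StandingAssumptions

/-- At a solution `u` of a subproblem at `z` with the same pattern, `f` plus the indicator of the
face of `u` has a small subgradient. -/
theorem exists_small_subgradient (hP : P.StandingAssumptions Lf Ls) {α : ℝ} (hα : 0 ≤ α)
    {y z ξ u : EuclideanSpace ℝ (Fin n)} (h : P.SolvesSubproblem P.ν P.ν α y z ξ u)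
    (hpat : SamePattern P.ν u z) :
    ∃ ζ : EuclideanSpace ℝ (Fin n), ‖ζ‖ ≤ (Ls + α) * ‖u - y‖ +
        P.lam2 / P.ν * (n * ∑ l, P.w l * (2 / P.ν * ‖u - z‖)) ∧
      ∀ v ∈ P.Omega, (∀ j, u j = 0 → v j = 0) → P.f u + inner ℝ ζ (v - u) ≤ P.f v := by
  have hν := hP.nu_pos
  have hsign : ∀ j, u j / |u j| = z j / |z j| := fun j => by
    rcases hpat j with ⟨h1, h2⟩ | ⟨-, -, h3⟩
    · rw [h1, h2]
    · exact h3
  have hgroup : ∀ l, (P.groupNorm u l = 0 ∧ P.groupNorm z l = 0) ∨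
      (0 < P.groupNorm u l ∧ P.ν ≤ P.groupNorm z l) := by
    intro l
    by_cases hl : ∀ j ∈ P.G l, u j = 0
    · refine Or.inl ⟨(groupNorm_eq_zero_iff hP.p_eq u l).2 hl,
        (groupNorm_eq_zero_iff hP.p_eq z l).2 fun j hj => ?_⟩
      rcases hpat j with ⟨-, h2⟩ | ⟨h1, -, -⟩
      · exact h2
      · rw [hl j hj, abs_zero] at h1; linarith
    · push Not at hl
      obtain ⟨j, hj, huj⟩ := hl
      rcases hpat j with ⟨h1, -⟩ | ⟨h1, h2, -⟩
      · exact absurd h1 huj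
      · exact Or.inr ⟨hν.trans_le (h1.trans (abs_le_groupNorm hP.p_eq u hj)),
          h2.trans (abs_le_groupNorm hP.p_eq z hj)⟩
  set g : EuclideanSpace ℝ (Fin n) :=
    WithLp.toLp 2 fun j => ∑ l, P.w l * (P.normGrad u l j - P.normGrad z l j) with hg
  have hgn : ‖g‖ ≤ n * ∑ l, P.w l * (2 / P.ν * ‖u - z‖) := by
    refine (EuclideanSpace.norm_le_sum_abs g).trans ?_
    have : ∀ j ∈ Finset.univ, |g j| ≤ ∑ l, P.w l * (2 / P.ν * ‖u - z‖) := fun j _ => by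
      have h1 : |∑ l, P.w l * (P.normGrad u l j - P.normGrad z l j)| ≤
          ∑ l, P.w l * (2 / P.ν * ‖u - z‖) := by
        refine (Finset.abs_sum_le_sum_abs _ _).trans (Finset.sum_le_sum fun l _ => ?_)
        rw [abs_mul, abs_of_nonneg (hP.w_nonneg l)]
        exact mul_le_mul_of_nonneg_left (abs_normGrad_sub_le hP.p_eq hν hsign (hgroup l) j)
          (hP.w_nonneg l)
      exact h1
    refine (Finset.sum_le_card_nsmul _ _ _ this).trans_eq ?_
    simp
  -- What is left after moving the first-order terms of the subproblem to one side: the mismatch of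
  -- the `fs` gradients, the proximal term, and the mismatch `g` of the group-norm gradients.
  refine ⟨gradient P.fs u - gradient P.fs y - α • (u - y) - (P.lam2 / P.ν) • g, ?_, ?_⟩
  · refine (norm_sub_le _ _).trans (add_le_add ((norm_sub_le _ _).trans ?_) ?_)
    · rw [norm_smul, Real.norm_of_nonneg hα, add_mul]
      exact add_le_add (hP.fs_gradient_lipschitz u y) le_rfl
    · have h0 : 0 ≤ P.lam2 / P.ν := div_nonneg hP.lam2_nonneg hν.le
      rw [norm_smul, Real.norm_of_nonneg h0]
      exact mul_le_mul_of_nonneg_left hgn h0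
  intro v hv hvu
  set d := v - u with hd
  have hdu : ∀ j, u j = 0 → d j = 0 := fun j hj => by simp [d, hj, hvu j hj]
  -- The slopes of `|u j|` and of the active piece at `z j` are the same sign, so only a
  -- second-order term remains; zero entries do not move, as `d` is tangent to the face.
  have hcoord : ∀ j, ∃ C, ∀ t : ℝ, |u j + (t • d) j| - |u j| + P.ν *
      (theta (activeI z P.ν j) (z j - (t • d) j) P.ν - theta (activeI z P.ν j) (z j) P.ν) ≤
      C * t ^ 2 := by
    intro j
    rcases hpat j with ⟨h1, h2⟩ | ⟨h1, h2, h3⟩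
    · refine ⟨0, fun t => ?_⟩
      simp [hdu j h1]
    · have huj : u j ≠ 0 := fun h => by rw [h, abs_zero] at h1; linarith
      refine ⟨d j ^ 2 / (2 * |u j|), fun t => ?_⟩
      have h4 := abs_add_le_add_sq (h := (t • d) j) huj
      have h5 : P.ν * (theta (activeI z P.ν j) (z j - (t • d) j) P.ν -
          theta (activeI z P.ν j) (z j) P.ν) = -(z j / |z j| * (t • d) j) := by
        rcases le_abs.1 h2 with h' | h'
        · rw [activeI_eq_one hν h', abs_of_pos (hν.trans_le h'),
            div_self (hν.trans_le h').ne', theta_one, theta_one]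
          field_simp; ring
        · have hz0 : z j < 0 := by linarith
          rw [activeI_eq_two hν (by linarith), abs_of_neg hz0, div_neg, div_self hz0.ne,
            theta_two, theta_two]
          field_simp; ring
      rw [h5, ← h3]
      have h6 : (t • d) j ^ 2 / (2 * |u j|) = d j ^ 2 / (2 * |u j|) * t ^ 2 := by
        simp; ring
      linarith
  have hl : ∀ l, ∃ C, ∀ t : ℝ, P.groupNorm (u + t • d) l - P.groupNorm u l
      + P.ν * (theta (P.activeJ z P.ν l).castSucc (P.groupNorm (z - t • d) l) P.ν
        - theta (P.activeJ z P.ν l).castSucc (P.groupNorm z l) P.ν) ≤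
      t * ∑ j, (P.normGrad u l j - P.normGrad z l j) * d j + C * t ^ 2 := by
    intro l
    obtain ⟨C₁, hC₁⟩ := exists_groupNorm_add_le hP.p_eq (u := u) (d := d) (l := l)
      (fun _ j _ => hdu j)
      (fun h j hj => hdu j ((groupNorm_eq_zero_iff hP.p_eq u l).1 h j hj))
    rcases hgroup l with ⟨-, h2⟩ | ⟨-, h2⟩
    · refine ⟨C₁, fun t => ?_⟩
      have h3 : ∀ j, P.normGrad z l j = 0 := fun j => by
        unfold normGrad
        split_ifs with hj
        · rw [(groupNorm_eq_zero_iff hP.p_eq z l).1 h2 j hj, zero_div]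
        · rw [(groupNorm_eq_zero_iff hP.p_eq z l).1 h2 j hj, zero_div]
        · rfl
      rw [activeJ_eq_zero hν (by rw [h2]; exact hν)]
      simp only [h3, sub_zero, Fin.castSucc_zero, theta_zero]
      linarith [hC₁ t]
    · obtain ⟨C₂, hC₂⟩ := exists_groupNorm_add_le hP.p_eq (u := z) (d := d) (l := l)
        (fun _ j _ hj => by
          rcases hpat j with ⟨h1, -⟩ | ⟨-, h1, -⟩
          · exact hdu j h1
          · rw [hj, abs_zero] at h1; linarith) (fun h => by linarith)
      refine ⟨C₁ + C₂, fun t => ?_⟩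
      have h3 := hC₁ t
      have h4 := hC₂ (-t)
      rw [neg_smul, ← sub_eq_add_neg] at h4
      rw [activeJ_eq_one hν h2]
      have h5 : ∀ a b : ℝ, P.ν * (theta (Fin.castSucc 1) a P.ν - theta (Fin.castSucc 1) b P.ν)
          = a - b := fun a b => by
        rw [show (Fin.castSucc 1 : Fin 3) = 1 from rfl, theta_one, theta_one]; field_simp; ring
      rw [h5]
      simp only [sub_mul, Finset.sum_sub_distrib, mul_sub]
      linarith
  choose C₁ hC₁ using hcoord
  choose C₂ hC₂ using hl
  have key : 0 ≤ P.fn v - P.fn u + P.lam2 / P.ν * inner ℝ g d + inner ℝ (gradient P.fs y) d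
      + α * inner ℝ (u - y) d := by
    -- The points `u + t • (v - u)` stay in the box. Convexity bounds the change of `fn` by `t`
    -- times its full difference, which yields a global inequality at `v` from a first-order
    -- argument.
    refine nonneg_of_forall_small
      (C := P.lam1 / P.ν * ∑ j, C₁ j + P.lam2 / P.ν * ∑ l, P.w l * C₂ l) one_pos
      fun t ht ht1 => ?_
    have hmem : u + t • d ∈ P.Omega := convex_Omega.add_smul_sub_mem h.2.1 hv ⟨ht.le, ht1⟩
    have h1 := hP.optimality hν h hmem
    have h2 : P.fn (u + t • d) ≤ (1 - t) * P.fn u + t * P.fn v := by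
      have := hP.fn_convex.2 (mem_univ u) (mem_univ v) (by linarith : 0 ≤ 1 - t) ht.le (by ring)
      rw [show u + t • d = (1 - t) • u + t • v by rw [hd]; module]
      simpa using this
    have h3 := mul_le_mul_of_nonneg_left (Finset.sum_le_sum fun j (_ : j ∈ Finset.univ) => hC₁ j t)
      (div_nonneg hP.lam1_pos.le hν.le)
    have h4 := mul_le_mul_of_nonneg_left (Finset.sum_le_sum fun l (_ : l ∈ Finset.univ) =>
      mul_le_mul_of_nonneg_left (hC₂ l t) (hP.w_nonneg l)) (div_nonneg hP.lam2_nonneg hν.le)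
    have h5 : ∑ l, P.w l * (t * ∑ j, (P.normGrad u l j - P.normGrad z l j) * d j + C₂ l * t ^ 2)
        = t * inner ℝ g d + (∑ l, P.w l * C₂ l) * t ^ 2 := by
      have h6 : inner ℝ g d = ∑ l, P.w l * ∑ j, (P.normGrad u l j - P.normGrad z l j) * d j := by
        rw [PiLp.inner_apply]
        simp only [hg, RCLike.inner_apply, conj_trivial, Finset.mul_sum]
        rw [Finset.sum_comm]
        exact Finset.sum_congr rfl fun l _ => Finset.sum_congr rfl fun j _ => by ring
      rw [h6, Finset.mul_sum, Finset.sum_mul, ← Finset.sum_add_distrib]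
      exact Finset.sum_congr rfl fun l _ => by ring
    rw [h5] at h4
    rw [← Finset.sum_mul] at h3
    rw [inner_smul_right, inner_smul_right] at h1
    linarith
  have h1 := hP.fs_convex.add_inner_gradient_le hP.fs_differentiable u v
  rw [inner_sub_left, inner_sub_left, inner_sub_left, inner_smul_left, inner_smul_left]
  simp only [conj_trivial]
  unfold f
  linarith

end StandingAssumptions
end SparseGroupProblem

/-! ### Cluster points and finite identification of the pattern -/

theorem MapClusterPt.comp_add_nat {X : Type*} [TopologicalSpace X] {x : ℕ → X} {xs : X}
    (h : MapClusterPt xs atTop x) (m : ℕ) : MapClusterPt xs atTop fun k => x (k + m) := by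
  rw [mapClusterPt_def] at h ⊢
  rwa [← map_add_atTop_eq_nat m, Filter.map_map] at h

theorem MapClusterPt.mem_of_eventually {X ι : Type*} [TopologicalSpace X] {F : Filter ι}
    {x : ι → X} {xs : X} (h : MapClusterPt xs F x) {S : Set X} (hS : IsClosed S)
    (hx : ∀ᶠ k in F, x k ∈ S) : xs ∈ S := by
  by_contra hxs
  obtain ⟨k, hk1, hk2⟩ := ((h.frequently (hS.isOpen_compl.mem_nhds hxs)).and_eventually hx).exists
  exact hk1 hk2

theorem Antitone.tendsto_of_mapClusterPt {r : ℕ → ℝ} (hr : Antitone r) {c : ℝ}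
    (h : MapClusterPt c atTop r) : Tendsto r atTop (𝓝 c) := by
  have hle : ∀ k, c ≤ r k := fun k =>
    h.mem_of_eventually isClosed_Iic (eventually_atTop.2 ⟨k, fun m hm => hr hm⟩)
  refine tendsto_order.2 ⟨fun a ha => Eventually.of_forall fun k => ha.trans_le (hle k),
    fun a ha => ?_⟩
  obtain ⟨m, hm⟩ := (h.frequently (gt_mem_nhds ha)).exists
  exact eventually_atTop.2 ⟨m, fun k hk => (hr hk).trans_lt hm⟩

namespace SparseGroupProblem

variable {n L : ℕ} {P : SparseGroupProblem n L} {Lf Ls : ℝ}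

/-- `x` is generated by solving subproblems at level `ν` with bounded proximal parameters `α` and
proximal centres `y`, and its steps tend to zero. -/
structure IsProxRun (P : SparseGroupProblem n L) (x y ξ : ℕ → EuclideanSpace ℝ (Fin n))
    (α : ℕ → ℝ) (A : ℝ) : Prop where
  alpha_nonneg : ∀ k, 0 ≤ α k
  alpha_le : ∀ k, α k ≤ A
  solves : ∀ k, P.SolvesSubproblem P.ν P.ν (α k) (y k) (x k) (ξ k) (x (k + 1))
  tendsto_step : Tendsto (fun k => ‖x (k + 1) - x k‖) atTop (𝓝 0)
  tendsto_center : Tendsto (fun k => ‖x (k + 1) - y k‖) atTop (𝓝 0)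

namespace IsProxRun

variable {x y ξ : ℕ → EuclideanSpace ℝ (Fin n)} {α : ℕ → ℝ} {A : ℝ}
  {xs : EuclideanSpace ℝ (Fin n)}

/-- By `identification`, a violation forces a combination of step lengths to be at least the gap `λ₁
/ ν - Lf`, which is positive by the choice of `ν`, whereas the steps tend to zero. -/
theorem eventually_next_eq_zero (hP : P.StandingAssumptions Lf Ls) (H : P.IsProxRun x y ξ α A) :
    ∀ᶠ k in atTop, ∀ j, |x k j| < P.ν → x (k + 1) j = 0 := by
  have hν := hP.nu_pos
  have hgap : 0 < P.lam1 / P.ν - Lf := by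
    rw [sub_pos, lt_div_iff₀ hν, mul_comm]; exact hP.nu_mul_Lf_lt
  have h1 : Tendsto (fun k => (Ls + A) * ‖x (k + 1) - y k‖ +
      P.lam2 / P.ν * ∑ l, P.w l * (2 / P.ν * ‖x (k + 1) - x k‖)) atTop (𝓝 0) := by
    have h2 := H.tendsto_center.const_mul (Ls + A)
    have h3 := (tendsto_finsetSum Finset.univ fun l _ =>
      (H.tendsto_step.const_mul (2 / P.ν)).const_mul (P.w l)).const_mul (P.lam2 / P.ν)
    simpa using h2.add h3
  filter_upwards [h1.eventually (gt_mem_nhds hgap)] with k hk j hj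
  by_contra hne
  have h2 := hP.identification (H.alpha_nonneg k) (H.solves k) hj hne
  have h3 : (Ls + α k) * ‖x (k + 1) - y k‖ ≤ (Ls + A) * ‖x (k + 1) - y k‖ := by
    gcongr
    exact H.alpha_le k
  linarith

/-- One late visit below `ν` sends the entry to zero, and zero is itself below `ν`, so it stays
there. -/
theorem eventually_zero_or_le (hP : P.StandingAssumptions Lf Ls) (H : P.IsProxRun x y ξ α A)
    (j : Fin n) : (∀ᶠ k in atTop, x k j = 0) ∨ ∀ᶠ k in atTop, P.ν ≤ |x k j| := by
  obtain ⟨k₀, hk₀⟩ := eventually_atTop.1 (H.eventually_next_eq_zero hP)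
  by_cases h : ∀ k, k₀ ≤ k → P.ν ≤ |x k j|
  · exact Or.inr (eventually_atTop.2 ⟨k₀, h⟩)
  · push Not at h
    obtain ⟨m, hm, hxm⟩ := h
    refine Or.inl (eventually_atTop.2 ⟨m + 1, fun k hk => ?_⟩)
    induction k, hk using Nat.le_induction with
    | base => exact hk₀ m hm j hxm
    | succ k hk ih => exact hk₀ k (by omega) j (by rw [ih, abs_zero]; exact hP.nu_pos)

/-- Both alternatives of `eventually_zero_or_le` are closed conditions and pass to the cluster
point. A sign change between entries of size at least `ν` would need a step of length at least `ν`.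
-/
theorem pattern_limit (hP : P.StandingAssumptions Lf Ls) (H : P.IsProxRun x y ξ α A)
    (hc : MapClusterPt xs atTop x) : (∀ j, xs j ≠ 0 → P.ν ≤ |xs j|) ∧
      ∀ᶠ k in atTop, SamePattern P.ν (x (k + 1)) (x k) ∧ ∀ j, xs j = 0 ↔ x k j = 0 := by
  have hν := hP.nu_pos
  have hz : ∀ j, (∀ᶠ k in atTop, x k j = 0) → xs j = 0 := fun j hj =>
    hc.mem_of_eventually (S := {v : EuclideanSpace ℝ (Fin n) | v j = 0})
      (isClosed_eq (by fun_prop) continuous_const) hj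
  have hnz : ∀ j, (∀ᶠ k in atTop, P.ν ≤ |x k j|) → P.ν ≤ |xs j| := fun j hj =>
    hc.mem_of_eventually (S := {v : EuclideanSpace ℝ (Fin n) | P.ν ≤ |v j|})
      (isClosed_le continuous_const (by fun_prop)) hj
  refine ⟨fun j hj => ?_, ?_⟩
  · rcases H.eventually_zero_or_le hP j with h | h
    · exact absurd (hz j h) hj
    · exact hnz j h
  · have h1 : ∀ᶠ k in atTop, ∀ j, ((x k j = 0 ∧ xs j = 0) ∨ (P.ν ≤ |x k j| ∧ P.ν ≤ |xs j|)) := by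
      refine eventually_all.2 fun j => ?_
      rcases H.eventually_zero_or_le hP j with h | h
      · filter_upwards [h] with k hk using Or.inl ⟨hk, hz j h⟩
      · filter_upwards [h] with k hk using Or.inr ⟨hk, hnz j h⟩
    filter_upwards [h1, (tendsto_add_atTop_nat 1).eventually h1,
      H.tendsto_step.eventually (gt_mem_nhds hν)] with k hk hk1 hstep
    refine ⟨fun j => ?_, fun j => ?_⟩
    · rcases hk j with ⟨h2, h3⟩ | ⟨h2, h3⟩
      · rcases hk1 j with ⟨h4, -⟩ | ⟨-, h5⟩
        · exact Or.inl ⟨h4, h2⟩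
        · rw [h3, abs_zero] at h5; linarith
      · rcases hk1 j with ⟨-, h5⟩ | ⟨h4, -⟩
        · rw [h5, abs_zero] at h3; linarith
        · refine Or.inr ⟨h4, h2, ?_⟩
          have h6 : |x (k + 1) j - x k j| < P.ν :=
            (PiLp.norm_apply_le (x (k + 1) - x k) j).trans_lt hstep
          obtain ⟨h7, h8⟩ := abs_lt.1 h6
          rcases le_abs.1 h2 with h9 | h9
          · have h10 : 0 < x (k + 1) j := by linarith
            rw [abs_of_pos h10, abs_of_pos (hν.trans_le h9), div_self h10.ne',
              div_self (hν.trans_le h9).ne']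
          · have h10 : x (k + 1) j < 0 := by linarith
            have h11 : x k j < 0 := by linarith
            rw [abs_of_neg h10, abs_of_neg h11, div_neg, div_neg, div_self h10.ne,
              div_self h11.ne]
    · rcases hk j with ⟨h2, h3⟩ | ⟨h2, h3⟩
      · simp [h2, h3]
      · constructor <;> intro h4
        · rw [h4, abs_zero] at h3; linarith
        · rw [h4, abs_zero] at h2; linarith

/-- Along a run, the values of `F` and `f` eventually differ by a constant, and `f` plus the
indicator of the face of a cluster point has small subgradients. -/
theorem eventually_regular (hP : P.StandingAssumptions Lf Ls) (H : P.IsProxRun x y ξ α A)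
    (hc : MapClusterPt xs atTop x) : ∃ C c : ℝ, 0 < C ∧ ∃ m, ∀ k, m ≤ k →
      x k ∈ P.face xs ∧ P.F (x k) P.ν = P.f (x k) + c ∧
      ∃ ζ : EuclideanSpace ℝ (Fin n), ‖ζ‖ ≤ C * (‖x (k + 1) - y k‖ + ‖x (k + 1) - x k‖) ∧
        ∀ v ∈ P.face xs, P.f (x (k + 1)) + inner ℝ ζ (v - x (k + 1)) ≤ P.f v := by
  have hν := hP.nu_pos
  obtain ⟨-, hev⟩ := H.pattern_limit hP hc
  obtain ⟨m, hm⟩ := eventually_atTop.1 hev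
  have hA : 0 ≤ A := (H.alpha_nonneg 0).trans (H.alpha_le 0)
  set D := P.lam2 / P.ν * (n * ∑ l, P.w l * (2 / P.ν)) with hD
  have hD0 : 0 ≤ D := mul_nonneg (div_nonneg hP.lam2_nonneg hν.le) (mul_nonneg (Nat.cast_nonneg _)
    (Finset.sum_nonneg fun l _ => mul_nonneg (hP.w_nonneg l) (by positivity)))
  have hLs := hP.Ls_pos
  -- The additive constant is the penalty of `xs`, shared by all points with its support. Starting
  -- at `m + 1` makes `x k` the output of a subproblem, hence a point of the box.
  refine ⟨Ls + A + D, P.F0 xs - P.f xs, by positivity, m + 1, fun k hk => ?_⟩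
  obtain ⟨hpat, hzero⟩ := hm k (by omega)
  have hmem : x k ∈ P.Omega := by
    have := (H.solves (k - 1)).2.1
    rwa [show k - 1 + 1 = k by omega] at this
  refine ⟨⟨hmem, fun j => (hzero j).1⟩, ?_, ?_⟩
  · rw [F_eq_F0 hP.p_eq hν fun j hj => ?_, F0_eq_add hP.p_eq fun j => (hzero j).symm]
    · ring
    · rcases hpat j with ⟨-, h⟩ | ⟨-, h, -⟩
      · exact absurd h hj
      · exact h
  · obtain ⟨ζ, hζ1, hζ2⟩ := hP.exists_small_subgradient (H.alpha_nonneg k) (H.solves k) hpat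
    refine ⟨ζ, hζ1.trans ?_, fun v hv => hζ2 v hv.1 fun j hj =>
      hv.2 j (((hm (k + 1) (by omega)).2 j).2 hj)⟩
    · have h1 : P.lam2 / P.ν * (n * ∑ l, P.w l * (2 / P.ν * ‖x (k + 1) - x k‖)) =
          D * ‖x (k + 1) - x k‖ := by
        simp only [hD, ← mul_assoc, ← Finset.sum_mul]
      rw [h1]
      have h2 := norm_nonneg (x (k + 1) - x k)
      have h3 := norm_nonneg (x (k + 1) - y k)
      have h4 := H.alpha_le k
      have h5 := mul_le_mul_of_nonneg_right h4 h3
      have h6 := mul_nonneg hD0 h3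
      have h7 := mul_nonneg (add_nonneg hLs.le hA) h2
      linarith

end IsProxRun
end SparseGroupProblem

/-! ### Compactness, stationarity of limits, and subgradients of the KL functions -/

theorem tendsto_sub_succ_of_antitone {E : ℕ → ℝ} (hE : Antitone E) {M : ℝ} (hM : ∀ k, M ≤ E k) :
    Tendsto (fun k => E k - E (k + 1)) atTop (𝓝 0) := by
  have h1 := tendsto_atTop_ciInf hE ⟨M, by rintro _ ⟨k, rfl⟩; exact hM k⟩
  simpa using h1.sub ((tendsto_add_atTop_iff_nat 1).2 h1)

theorem tendsto_zero_of_descent {E e : ℕ → ℝ} {a M : ℝ} (ha : 0 < a) (he : ∀ k, 0 ≤ e k)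
    (h : ∀ k, E (k + 1) + a * e k ^ 2 ≤ E k) (hM : ∀ k, M ≤ E k) : Tendsto e atTop (𝓝 0) := by
  have hE : Antitone E := antitone_nat_of_succ_le fun k => by
    have := mul_nonneg ha.le (sq_nonneg (e k))
    linarith [h k]
  have h1 := (tendsto_sub_succ_of_antitone hE hM).div_const a
  rw [zero_div] at h1
  have h2 : Tendsto (fun k => e k ^ 2) atTop (𝓝 0) := by
    refine squeeze_zero (fun k => sq_nonneg _) (fun k => ?_) h1
    rw [le_div_iff₀ ha]
    linarith [h k]
  simpa [Real.sqrt_sq (he _)] using h2.sqrt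

theorem WithLp.norm_toLp_prod_le {V W : Type*} [NormedAddCommGroup V] [NormedAddCommGroup W]
    (a : V) (b : W) : ‖(WithLp.toLp 2 (a, b) : WithLp 2 (V × W))‖ ≤ ‖a‖ + ‖b‖ := by
  rw [WithLp.prod_norm_eq_of_L2]
  refine Real.sqrt_le_iff.2 ⟨by positivity, ?_⟩
  have := mul_nonneg (norm_nonneg a) (norm_nonneg b)
  change ‖a‖ ^ 2 + ‖b‖ ^ 2 ≤ _
  nlinarith

namespace SparseGroupProblem

variable {n L : ℕ} {P : SparseGroupProblem n L} {Lf Ls : ℝ}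

theorem exists_cluster_of_F_le (hP : P.StandingAssumptions Lf Ls)
    {x : ℕ → EuclideanSpace ℝ (Fin n)} (hx : ∀ k, x k ∈ P.Omega) {M : ℝ}
    (hM : ∀ k, P.F (x k) P.ν ≤ M) :
    (∃ xs, MapClusterPt xs atTop x) ∧ ∃ M', ∀ k, M' ≤ P.F (x k) P.ν := by
  have hfF : ∀ k, P.f (x k) ≤ P.F (x k) P.ν := fun k =>
    f_le_F hP.lam1_pos.le hP.lam2_nonneg hP.w_nonneg hP.nu_pos (x k)
  have hcomp : IsCompact {v ∈ P.Omega | P.f v ≤ M} :=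
    Metric.isCompact_of_isClosed_isBounded
      (isClosed_Omega.inter (isClosed_le hP.f_continuous continuous_const)) (hP.f_levelBounded M)
  have hmem : ∀ k, x k ∈ {v ∈ P.Omega | P.f v ≤ M} := fun k => ⟨hx k, (hfF k).trans (hM k)⟩
  constructor
  · obtain ⟨xs, -, ψ, hψ, hlim⟩ := hcomp.tendsto_subseq hmem
    exact ⟨xs, MapClusterPt.of_comp hψ.tendsto_atTop hlim.mapClusterPt⟩
  · obtain ⟨v, -, hv⟩ := hcomp.exists_isMinOn ⟨x 0, hmem 0⟩ hP.f_continuous.continuousOn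
    exact ⟨P.f v, fun k => (hv (hmem k)).trans (hfF k)⟩

/-- In the subgradient inequalities of `eventually_regular` the subgradients tend to zero, so the
limit minimizes `f` over its own face. -/
theorem IsProxRun.isStrongLocalMinimizer (hP : P.StandingAssumptions Lf Ls)
    {x y ξ : ℕ → EuclideanSpace ℝ (Fin n)} {α : ℕ → ℝ} {A : ℝ} {xs : EuclideanSpace ℝ (Fin n)}
    (H : P.IsProxRun x y ξ α A) (hx : Tendsto x atTop (𝓝 xs)) : P.IsStrongLocalMinimizer xs := by
  have hc : MapClusterPt xs atTop x := hx.mapClusterPt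
  obtain ⟨C, c, hC, m, hm⟩ := H.eventually_regular hP hc
  have hmem : xs ∈ P.Omega := isClosed_Omega.mem_of_tendsto hx
    (eventually_atTop.2 ⟨m, fun k hk => (hm k hk).1.1⟩)
  refine isStrongLocalMinimizer_of_face hP hmem (H.pattern_limit hP hc).1 fun v hv => ?_
  have hx1 := (tendsto_add_atTop_iff_nat 1).2 hx
  have h1 : Tendsto (fun k => P.f (x (k + 1)) -
      C * (‖x (k + 1) - y k‖ + ‖x (k + 1) - x k‖) * ‖v - x (k + 1)‖) atTop (𝓝 (P.f xs)) := by
    have h2 := (hP.f_continuous.tendsto xs).comp hx1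
    have h3 := ((H.tendsto_center.add H.tendsto_step).const_mul C).mul (hx1.const_sub v).norm
    simpa using h2.sub h3
  refine le_of_tendsto h1 (eventually_atTop.2 ⟨m, fun k hk => ?_⟩)
  obtain ⟨-, -, ζ, hζ1, hζ2⟩ := hm k hk
  have h4 := hζ2 v hv
  have h5 := neg_le_of_abs_le (abs_real_inner_le_norm ζ (v - x (k + 1)))
  have h6 := mul_le_mul_of_nonneg_right hζ1 (norm_nonneg (v - x (k + 1)))
  linarith

theorem IsSchedule.exists_eq {μ : ℕ → ℝ} (hμ : P.IsSchedule μ) : ∃ K, ∀ k, K ≤ k → μ k = P.ν := by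
  obtain ⟨K, -, -, -, -, -, h⟩ := hμ
  exact ⟨K, h⟩

theorem fFace_of_mem {xs v : EuclideanSpace ℝ (Fin n)} (hv : v ∈ P.face xs) :
    P.fFace xs v = (P.f v : EReal) := by
  simp [fFace, indicatorTop, hv]

theorem mem_subdifferential_fFace {xs v ζ : EuclideanSpace ℝ (Fin n)} (hv : v ∈ P.face xs)
    (h : ∀ w ∈ P.face xs, P.f v + inner ℝ ζ (w - v) ≤ P.f w) :
    ζ ∈ subdifferential (P.fFace xs) v :=
  mem_subdifferential_add_indicatorTop (π := id) hv h

theorem HFace_of_mem {xs v w : EuclideanSpace ℝ (Fin n)} (hv : v ∈ P.face xs) :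
    P.HFace Ls xs (WithLp.toLp 2 (v, w)) = ((P.f v + Ls / 2 * ‖v - w‖ ^ 2 : ℝ) : EReal) := by
  simp [HFace, indicatorTop, hv]

/-- The coupling term contributes its gradient, `Ls • (v - w)` in the first and its negative in the
second component; expanding the square leaves a nonnegative remainder. -/
theorem mem_subdifferential_HFace (hLs : 0 ≤ Ls) {xs v w ζ : EuclideanSpace ℝ (Fin n)}
    (hv : v ∈ P.face xs) (h : ∀ v' ∈ P.face xs, P.f v + inner ℝ ζ (v' - v) ≤ P.f v') :
    WithLp.toLp 2 (ζ + Ls • (v - w), -(Ls • (v - w))) ∈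
      subdifferential (P.HFace Ls xs) (WithLp.toLp 2 (v, w)) := by
  refine mem_subdifferential_add_indicatorTop
    (g := fun z : WithLp 2 (EuclideanSpace ℝ (Fin n) × EuclideanSpace ℝ (Fin n)) =>
      P.f z.fst + Ls / 2 * ‖z.fst - z.snd‖ ^ 2) (π := fun z => z.fst) hv fun z hz => ?_
  have h1 := h z.fst hz
  have h2 : inner ℝ (WithLp.toLp 2 (ζ + Ls • (v - w), -(Ls • (v - w))))
      (z - WithLp.toLp 2 (v, w)) =
      inner ℝ ζ (z.fst - v) + Ls * inner ℝ (v - w) ((z.fst - z.snd) - (v - w)) := by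
    rw [WithLp.prod_inner_apply]
    change inner ℝ (ζ + Ls • (v - w)) (z.fst - v) + inner ℝ (-(Ls • (v - w))) (z.snd - w) = _
    rw [inner_add_left, inner_neg_left, inner_smul_left, inner_smul_left,
      show z.fst - z.snd - (v - w) = (z.fst - v) - (z.snd - w) by abel, inner_sub_right _ (z.fst - v)]
    simp only [conj_trivial]
    ring
  have h3 : ‖z.fst - z.snd‖ ^ 2 = ‖v - w‖ ^ 2 + 2 * inner ℝ (v - w) ((z.fst - z.snd) - (v - w)) +
      ‖(z.fst - z.snd) - (v - w)‖ ^ 2 := by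
    rw [← norm_add_sq_real, add_sub_cancel]
  rw [h2]
  change P.f v + Ls / 2 * ‖v - w‖ ^ 2 + _ ≤ P.f z.fst + Ls / 2 * ‖z.fst - z.snd‖ ^ 2
  rw [h3]
  have h4 : 0 ≤ Ls / 2 * ‖(z.fst - z.snd) - (v - w)‖ ^ 2 := by positivity
  linarith

/-! ### The line search algorithm -/

theorem lineSearchTest_zero_iff {c : ℝ} {μ : ℕ → ℝ} {x : ℕ → EuclideanSpace ℝ (Fin n)} {k : ℕ}
    {v : EuclideanSpace ℝ (Fin n)} : P.LineSearchTest c 0 μ x k v ↔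
    P.F v (μ k) ≤ P.F (x k) (μ k) - c / 2 * ‖v - x k‖ ^ 2 := by
  simp [LineSearchTest]

/-- The tail of a line search run on which the smoothing parameter is `ν`. -/
theorem IsLineSearchRun.exists_proxRun (hP : P.StandingAssumptions Lf Ls) {μ : ℕ → ℝ}
    (hμ : P.IsSchedule μ) {x : ℕ → EuclideanSpace ℝ (Fin n)} (h : P.IsLineSearchRun Ls 0 μ x) :
    ∃ (K : ℕ) (c : ℝ) (ξ : ℕ → EuclideanSpace ℝ (Fin n)) (α : ℕ → ℝ) (A : ℝ), 0 < c ∧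
      (∀ k, P.F (x (k + K + 1)) P.ν + c * ‖x (k + K + 1) - x (k + K)‖ ^ 2 ≤
        P.F (x (k + K)) P.ν) ∧
      (∃ xs, MapClusterPt xs atTop fun k => x (k + K)) ∧
      P.IsProxRun (fun k => x (k + K)) (fun k => x (k + K)) ξ α A := by
  obtain ⟨K, hK⟩ := hμ.exists_eq
  obtain ⟨hx0, ρ, c, αlo, αhi, hρ, hc, hcLs, hαlo, hαhi, τ, αB, m, ξ, v, hrun⟩ := h
  have hmem : ∀ k, x k ∈ P.Omega := by
    rintro (_ | k)
    · exact hx0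
    · obtain ⟨-, -, -, h1, -, -, h2⟩ := hrun k
      rw [h2]
      exact (h1 (m k) le_rfl).2.1
  have hτ : ∀ k, K ≤ k → τ k = P.ν := fun k hk => by
    rcases (hrun k).1 with h | h
    · exact h
    · rw [h, hK k hk]
  have hdesc : ∀ k, P.F (x (k + K + 1)) P.ν + c / 2 * ‖x (k + K + 1) - x (k + K)‖ ^ 2 ≤
      P.F (x (k + K)) P.ν := by
    intro k
    obtain ⟨-, -, -, -, -, h1, h2⟩ := hrun (k + K)
    rw [lineSearchTest_zero_iff, hK _ (by omega), ← h2] at h1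
    linarith
  have hα0 : ∀ k i, 0 < αB k * ρ ^ i := fun k i => by
    have := hαlo.trans_le (hrun k).2.1
    positivity
  -- A proximal parameter above `Ls ≥ c` always passes the test by `descent`. Hence the last
  -- rejected one is at most `Ls`, and the accepted one exceeds it by the factor `ρ`.
  have hαA : ∀ k, αB (k + K) * ρ ^ m (k + K) ≤ max αhi (ρ * Ls) := by
    intro k
    obtain ⟨-, h1, h2, h3, h4, -, -⟩ := hrun (k + K)
    rcases Nat.eq_zero_or_pos (m (k + K)) with h0 | h0
    · rw [h0, pow_zero, mul_one]
      exact h2.trans (le_max_left _ _)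
    · obtain ⟨i, hi⟩ : ∃ i, m (k + K) = i + 1 := ⟨m (k + K) - 1, by omega⟩
      have h5 := h3 i (by omega)
      have h6 := h4 i (by omega)
      rw [hK _ (by omega), hτ _ (by omega)] at h5
      rw [lineSearchTest_zero_iff, hK _ (by omega)] at h6
      have h7 := hP.descent hP.nu_pos (hmem (k + K)) h5
      rw [sub_self, norm_zero] at h7
      have h8 : αB (k + K) * ρ ^ i ≤ Ls := by
        by_contra! hcon
        have h9 := sq_nonneg ‖v (k + K) i - x (k + K)‖
        have h10 := mul_nonneg (sub_nonneg.2 hcon.le) h9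
        have h11 := mul_nonneg (sub_nonneg.2 (hcLs.trans hcon.le)) h9
        apply h6
        linarith
      refine le_trans ?_ (le_max_right _ _)
      rw [hi, pow_succ]
      calc αB (k + K) * (ρ ^ i * ρ) = ρ * (αB (k + K) * ρ ^ i) := by ring
        _ ≤ ρ * Ls := by gcongr
  have hanti : Antitone fun k => P.F (x (k + K)) P.ν := antitone_nat_of_succ_le fun k => by
    have := hdesc k
    rw [show k + 1 + K = k + K + 1 by ring]
    have : 0 ≤ c / 2 * ‖x (k + K + 1) - x (k + K)‖ ^ 2 := by positivity
    linarith
  obtain ⟨hcl, M, hM⟩ := exists_cluster_of_F_le hP (x := fun k => x (k + K))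
    (fun k => hmem _) (fun k => hanti (Nat.zero_le k))
  have hstep : Tendsto (fun k => ‖x (k + 1 + K) - x (k + K)‖) atTop (𝓝 0) := by
    refine tendsto_zero_of_descent (E := fun k => P.F (x (k + K)) P.ν) (half_pos hc)
      (fun _ => norm_nonneg _) (fun k => ?_) hM
    have := hdesc k
    rwa [show k + K + 1 = k + 1 + K by ring] at this
  refine ⟨K, c / 2, fun k => ξ (k + K) (m (k + K)), fun k => αB (k + K) * ρ ^ m (k + K), _,
    half_pos hc, hdesc, hcl, fun k => (hα0 _ _).le, hαA, fun k => ?_, hstep, hstep⟩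
  obtain ⟨-, -, -, h1, -, -, h2⟩ := hrun (k + K)
  have h3 := h1 (m (k + K)) le_rfl
  rw [← h2, hK _ (by omega), hτ _ (by omega)] at h3
  rwa [show k + 1 + K = k + K + 1 by ring]

theorem IsLineSearchRun.exists_mapClusterPt (hP : P.StandingAssumptions Lf Ls) {μ : ℕ → ℝ}
    (hμ : P.IsSchedule μ) {x : ℕ → EuclideanSpace ℝ (Fin n)} (h : P.IsLineSearchRun Ls 0 μ x) :
    ∃ xs, MapClusterPt xs atTop x := by
  obtain ⟨K, -, -, -, -, -, -, ⟨xs, hxs⟩, -⟩ := h.exists_proxRun hP hμ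
  exact ⟨xs, MapClusterPt.of_comp (tendsto_add_atTop_nat K) hxs⟩

theorem IsLineSearchRun.convergence (hP : P.StandingAssumptions Lf Ls) {μ : ℕ → ℝ}
    (hμ : P.IsSchedule μ) {x : ℕ → EuclideanSpace ℝ (Fin n)} (h : P.IsLineSearchRun Ls 0 μ x)
    {xs : EuclideanSpace ℝ (Fin n)} (hxs : MapClusterPt xs atTop x)
    (hKL : IsKLFunction (P.fFace xs)) :
    Tendsto x atTop (𝓝 xs) ∧ P.IsStrongLocalMinimizer xs ∧
      Summable (fun k => ‖x (k + 1) - x k‖) ∧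
      ∀ α : ℝ, α < 1 → HasKLExponentAt (P.fFace xs) xs α → ConvergesAtKLRate x xs α := by
  obtain ⟨K, a, ξ, α, A, ha, hdesc, -, hrun⟩ := h.exists_proxRun hP hμ
  obtain ⟨C, c, hC, m, hm⟩ := hrun.eventually_regular hP (hxs.comp_add_nat K)
  have hxsmem : xs ∈ P.Omega := (hxs.comp_add_nat K).mem_of_eventually isClosed_Omega
    (eventually_atTop.2 ⟨m, fun k hk => (hm k hk).1.1⟩)
  have hxsface : xs ∈ P.face xs := ⟨hxsmem, fun _ h => h⟩
  have hdesc' : ∀ k, P.f (x (k + 1 + (m + K))) +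
      a * ‖x (k + 1 + (m + K)) - x (k + (m + K))‖ ^ 2 ≤ P.f (x (k + (m + K))) := by
    intro k
    have h1 := hdesc (k + m)
    have h2 := (hm (k + m) (by omega)).2.1
    have h3 := (hm (k + m + 1) (by omega)).2.1
    simp only [show k + m + 1 + K = k + 1 + (m + K) by ring,
      show k + m + K = k + (m + K) by ring, show k + (m + K) + 1 = k + 1 + (m + K) by ring]
      at h1 h2 h3
    linarith
  have hanti : Antitone fun k => P.f (x (k + (m + K))) := antitone_nat_of_succ_le fun k => by
    have := hdesc' k
    have : 0 ≤ a * ‖x (k + 1 + (m + K)) - x (k + (m + K))‖ ^ 2 := by positivity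
    linarith
  have hKLD : IsKLDescent (P.fFace xs) (fun k => x (k + (m + K))) xs
      (fun k => P.f (x (k + (m + K)))) (fun k => ‖x (k + 1 + (m + K)) - x (k + (m + K))‖)
      (P.f xs) a (2 * C) := by
    -- The proximal centre is `x k` itself, so both terms in the subgradient bound equal the step `d
    -- k`; this is the source of the constant `2 * C`.
    refine ⟨ha, by positivity, fun k => norm_nonneg _, fun k => ?_, fFace_of_mem hxsface, hdesc',
      fun k => ?_, fun k => ?_, hanti.tendsto_of_mapClusterPt
        ((hxs.comp_add_nat (m + K)).continuousAt_comp hP.f_continuous.continuousAt)⟩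
    · have h1 := (hm (k + m) (by omega)).1
      rw [show k + m + K = k + (m + K) by ring] at h1
      exact fFace_of_mem h1
    · obtain ⟨-, -, ζ, hζ1, hζ2⟩ := hm (k + m) (by omega)
      have h1 := (hm (k + m + 1) (by omega)).1
      simp only [show k + m + 1 + K = k + 1 + (m + K) by ring,
        show k + m + K = k + (m + K) by ring] at h1 hζ1 hζ2
      refine ⟨ζ, mem_subdifferential_fFace h1 hζ2, hζ1.trans ?_⟩
      have := mul_nonneg hC.le (norm_nonneg (x (k + 1 + 1 + (m + K)) - x (k + 1 + (m + K))))
      linarith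
    · exact le_add_of_nonneg_right (norm_nonneg _)
  have hnonempty : (subdifferential (P.fFace xs) xs).Nonempty := by
    obtain ⟨ζ, hζ⟩ := hP.f_convex.exists_subgradient xs
    exact ⟨ζ, mem_subdifferential_fFace hxsface fun v _ => hζ v⟩
  obtain ⟨hsum, hlim⟩ := hKLD.summable_and_tendsto (hxs.comp_add_nat _) (hKL xs hnonempty)
  have hlim' : Tendsto x atTop (𝓝 xs) := (tendsto_add_atTop_iff_nat (m + K)).1 hlim
  refine ⟨hlim', hrun.isStrongLocalMinimizer hP ((tendsto_add_atTop_iff_nat K).2 hlim'), ?_,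
    fun α hα hexp => (hKLD.convergesAtKLRate hlim hα hexp).of_tail (m + K)⟩
  refine (summable_nat_add_iff (m + K)).1 (hsum.congr fun k => ?_)
  rw [show k + 1 + (m + K) = k + (m + K) + 1 by ring]

end SparseGroupProblem

/-! ### The extrapolation algorithm -/

namespace SparseGroupProblem

variable {n L : ℕ} {P : SparseGroupProblem n L} {Lf Ls : ℝ}

/-- The tail `X` of an extrapolation run on which the smoothing parameter is `ν`. -/
theorem IsExtrapolationRun.exists_proxRun (hP : P.StandingAssumptions Lf Ls) {μ : ℕ → ℝ}
    (hμ : P.IsSchedule μ) {x : ℕ → EuclideanSpace ℝ (Fin n)} (h : P.IsExtrapolationRun Ls μ x) :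
    ∃ (K : ℕ) (X y ξ : ℕ → EuclideanSpace ℝ (Fin n)) (β : ℝ), (∀ k, X k = x (k + K)) ∧
      0 ≤ β ∧ β < 1 ∧
      (∀ k, P.F (X (k + 2)) P.ν + Ls / 2 * ‖X (k + 2) - X (k + 1)‖ ^ 2 ≤
        P.F (X (k + 1)) P.ν + Ls / 2 * (β * ‖X (k + 1) - X k‖) ^ 2) ∧
      (∀ k, ‖X (k + 2) - y k‖ ≤ ‖X (k + 2) - X (k + 1)‖ + ‖X (k + 1) - X k‖) ∧
      (∃ xs, MapClusterPt xs atTop fun k => X (k + 1)) ∧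
      P.IsProxRun (fun k => X (k + 1)) y ξ (fun _ => Ls) Ls := by
  obtain ⟨K, hK⟩ := hμ.exists_eq
  obtain ⟨hx0, β, hβ0, hβ1, xm1, τ, b, y, ξ, -, hy, hrun⟩ := h
  have hLs := hP.Ls_pos
  set X : ℕ → EuclideanSpace ℝ (Fin n) := fun k => x (k + K) with hX
  -- The run starts at `X 1`, so that its extrapolated point always uses the genuine previous
  -- iterate `X k`, never the arbitrary `x^{-1}`.
  have hsolves : ∀ k, P.SolvesSubproblem P.ν P.ν Ls (y (k + 1 + K)) (X (k + 1)) (ξ (k + 1 + K))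
      (X (k + 2)) := by
    intro k
    obtain ⟨hτ, -, -, h⟩ := hrun (k + 1 + K)
    have hτ' : τ (k + 1 + K) = P.ν := by
      rcases hτ with h | h
      · exact h
      · rw [h, hK _ (by omega)]
    rw [hK _ (by omega), hτ', show k + 1 + K + 1 = k + 2 + K by ring] at h
    exact h
  have hXmem : ∀ k, X (k + 1) ∈ P.Omega := by
    intro k
    obtain ⟨-, -, -, h⟩ := hrun (k + K)
    have := h.2.1
    rwa [show k + K + 1 = k + 1 + K by ring] at this
  have hcenter : ∀ k, ‖X (k + 1) - y (k + 1 + K)‖ ≤ β * ‖X (k + 1) - X k‖ := by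
    intro k
    obtain ⟨-, hb0, hb, -⟩ := hrun (k + 1 + K)
    have h1 := hy (k + K)
    rw [show k + K + 1 = k + 1 + K by ring] at h1
    rw [h1, sub_add_cancel_left, norm_neg, norm_smul, Real.norm_of_nonneg hb0]
    exact mul_le_mul_of_nonneg_right hb (norm_nonneg _)
  have hcenter' : ∀ k, ‖X (k + 2) - y (k + 1 + K)‖ ≤
      ‖X (k + 2) - X (k + 1)‖ + ‖X (k + 1) - X k‖ := by
    intro k
    rw [← sub_add_sub_cancel (X (k + 2)) (X (k + 1)) (y (k + 1 + K))]
    refine (norm_add_le _ _).trans (add_le_add le_rfl ((hcenter k).trans ?_))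
    exact mul_le_of_le_one_left (norm_nonneg _) hβ1.le
  have hdesc : ∀ k, P.F (X (k + 2)) P.ν + Ls / 2 * ‖X (k + 2) - X (k + 1)‖ ^ 2 ≤
        P.F (X (k + 1)) P.ν + Ls / 2 * (β * ‖X (k + 1) - X k‖) ^ 2 := by
    intro k
    have h1 := hP.descent hP.nu_pos (hXmem k) (hsolves k)
    have h2 : Ls / 2 * ‖X (k + 1) - y (k + 1 + K)‖ ^ 2 ≤
        Ls / 2 * (β * ‖X (k + 1) - X k‖) ^ 2 := by
      gcongr
      exact hcenter k
    linarith
  have hgap : 0 < Ls / 2 * (1 - β ^ 2) := by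
    have : 0 < 1 - β ^ 2 := by nlinarith
    positivity
  -- `F` alone need not decrease. Adding `Ls / 2` times the squared last step gives a Lyapunov
  -- function, with strict decrease because `β < 1`.
  have hE : ∀ k, P.F (X (k + 2)) P.ν + Ls / 2 * ‖X (k + 2) - X (k + 1)‖ ^ 2 +
      Ls / 2 * (1 - β ^ 2) * ‖X (k + 1) - X k‖ ^ 2 ≤
      P.F (X (k + 1)) P.ν + Ls / 2 * ‖X (k + 1) - X k‖ ^ 2 := by
    intro k
    have := hdesc k
    rw [mul_pow] at this
    linarith
  have hanti : Antitone fun k => P.F (X (k + 1)) P.ν + Ls / 2 * ‖X (k + 1) - X k‖ ^ 2 :=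
    antitone_nat_of_succ_le fun k => by
      have := hE k
      have : 0 ≤ Ls / 2 * (1 - β ^ 2) * ‖X (k + 1) - X k‖ ^ 2 := by positivity
      simp only [show k + 1 + 1 = k + 2 from rfl]
      linarith
  obtain ⟨hcl, M, hM⟩ := exists_cluster_of_F_le hP (x := fun k => X (k + 1)) hXmem (fun k =>
    le_trans (le_add_of_nonneg_right (by positivity)) (hanti (Nat.zero_le k)))
  have hstep : Tendsto (fun k => ‖X (k + 1) - X k‖) atTop (𝓝 0) := by
    refine tendsto_zero_of_descent
      (E := fun k => P.F (X (k + 1)) P.ν + Ls / 2 * ‖X (k + 1) - X k‖ ^ 2) (M := M) hgap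
      (fun _ => norm_nonneg _) hE fun k => ?_
    exact (hM k).trans (le_add_of_nonneg_right (by positivity))
  have hstep' := (tendsto_add_atTop_iff_nat 1).2 hstep
  refine ⟨K, X, fun k => y (k + 1 + K), fun k => ξ (k + 1 + K), β, fun k => rfl, hβ0, hβ1, hdesc,
    hcenter', hcl, fun k => hLs.le, fun k => le_rfl, hsolves, hstep', ?_⟩
  refine squeeze_zero (fun k => norm_nonneg _) hcenter' ?_
  simpa using hstep'.add hstep

theorem IsExtrapolationRun.exists_mapClusterPt (hP : P.StandingAssumptions Lf Ls) {μ : ℕ → ℝ}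
    (hμ : P.IsSchedule μ) {x : ℕ → EuclideanSpace ℝ (Fin n)} (h : P.IsExtrapolationRun Ls μ x) :
    ∃ xs, MapClusterPt xs atTop x := by
  obtain ⟨K, X, -, -, -, hX, -, -, -, -, ⟨xs, hxs⟩, -⟩ := h.exists_proxRun hP hμ
  simp only [hX] at hxs
  exact ⟨xs, MapClusterPt.of_comp ((tendsto_add_atTop_nat K).comp (tendsto_add_atTop_nat 1)) hxs⟩

theorem IsExtrapolationRun.convergence (hP : P.StandingAssumptions Lf Ls) {μ : ℕ → ℝ}
    (hμ : P.IsSchedule μ) {x : ℕ → EuclideanSpace ℝ (Fin n)} (h : P.IsExtrapolationRun Ls μ x)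
    {xs : EuclideanSpace ℝ (Fin n)} (hxs : MapClusterPt xs atTop x)
    (hKL : IsKLFunction (P.HFace Ls xs)) :
    Tendsto x atTop (𝓝 xs) ∧ P.IsStrongLocalMinimizer xs ∧
      Summable (fun k => ‖x (k + 1) - x k‖) ∧
      ∀ α : ℝ, α < 1 → HasKLExponentAt (P.HFace Ls xs) (WithLp.toLp 2 (xs, xs)) α →
        ConvergesAtKLRate x xs α := by
  obtain ⟨K, X, y, ξ, β, hX, hβ0, hβ1, hdesc, hcenter, -, hrun⟩ := h.exists_proxRun hP hμ
  have hLs := hP.Ls_pos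
  have hXc : MapClusterPt xs atTop X := by
    have := hxs.comp_add_nat K
    rwa [← funext hX] at this
  obtain ⟨C, c, hC, m, hm⟩ := hrun.eventually_regular hP (hXc.comp_add_nat 1)
  have hxsmem : xs ∈ P.Omega := (hXc.comp_add_nat 1).mem_of_eventually isClosed_Omega
    (eventually_atTop.2 ⟨m, fun k hk => (hm k hk).1.1⟩)
  have hxsface : xs ∈ P.face xs := ⟨hxsmem, fun _ h => h⟩
  set Y : ℕ → EuclideanSpace ℝ (Fin n) := fun k => X (k + (m + 1)) with hY
  have hYc : MapClusterPt xs atTop Y := hXc.comp_add_nat _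
  have hYface : ∀ k, Y k ∈ P.face xs := fun k => (hm (k + m) (by omega)).1
  have hYF : ∀ k, P.F (Y k) P.ν = P.f (Y k) + c := fun k => (hm (k + m) (by omega)).2.1
  have hYdesc : ∀ k, P.f (Y (k + 2)) + Ls / 2 * ‖Y (k + 2) - Y (k + 1)‖ ^ 2 ≤
      P.f (Y (k + 1)) + Ls / 2 * (β * ‖Y (k + 1) - Y k‖) ^ 2 := by
    intro k
    have h1 := hdesc (k + m + 1)
    have h2 := hYF (k + 2)
    have h3 := hYF (k + 1)
    simp only [hY] at h2 h3 ⊢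
    rw [show k + m + 1 + 2 = k + 2 + (m + 1) by ring,
      show k + m + 1 + 1 = k + 1 + (m + 1) by ring, show k + m + 1 = k + (m + 1) by ring] at h1
    linarith
  have hYsub : ∀ k, ∃ ζ : EuclideanSpace ℝ (Fin n),
      ‖ζ‖ ≤ C * (2 * ‖Y (k + 2) - Y (k + 1)‖ + ‖Y (k + 1) - Y k‖) ∧
      ∀ v ∈ P.face xs, P.f (Y (k + 2)) + inner ℝ ζ (v - Y (k + 2)) ≤ P.f v := by
    intro k
    obtain ⟨-, -, ζ, hζ1, hζ2⟩ := hm (k + m + 1) (by omega)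
    have h1 := hcenter (k + m + 1)
    have e0 : X (k + m + 1) = Y k := rfl
    have e1 : X (k + m + 1 + 1) = Y (k + 1) := congrArg X (by ring)
    have e2 : X (k + m + 1 + 2) = Y (k + 2) := congrArg X (by ring)
    simp only [show k + m + 1 + 1 + 1 = k + m + 1 + 2 from rfl, e1, e2] at hζ1 hζ2
    rw [e0, e1, e2] at h1
    refine ⟨ζ, hζ1.trans (mul_le_mul_of_nonneg_left ?_ hC.le), hζ2⟩
    linarith
  have hgap : 0 < Ls / 2 * (1 - β ^ 2) := by
    have : 0 < 1 - β ^ 2 := by nlinarith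
    positivity
  have hrdesc : ∀ k, P.f (Y (k + 2)) + Ls / 2 * ‖Y (k + 2) - Y (k + 1)‖ ^ 2 +
      Ls / 2 * (1 - β ^ 2) * ‖Y (k + 1) - Y k‖ ^ 2 ≤
      P.f (Y (k + 1)) + Ls / 2 * ‖Y (k + 1) - Y k‖ ^ 2 := by
    intro k
    have := hYdesc k
    rw [mul_pow] at this
    linarith
  have hanti : Antitone fun k => P.f (Y (k + 1)) + Ls / 2 * ‖Y (k + 1) - Y k‖ ^ 2 :=
    antitone_nat_of_succ_le fun k => by
      have := hrdesc k
      have : 0 ≤ Ls / 2 * (1 - β ^ 2) * ‖Y (k + 1) - Y k‖ ^ 2 := by positivity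
      simp only [show k + 1 + 1 = k + 2 from rfl]
      linarith
  have hstep : Tendsto (fun k => ‖Y (k + 1) - Y k‖) atTop (𝓝 0) := by
    have := (tendsto_add_atTop_iff_nat m).2 hrun.tendsto_step
    refine this.congr fun k => ?_
    simp only [hY]
    rw [show k + m + 1 + 1 = k + 1 + (m + 1) by ring, show k + m + 1 = k + (m + 1) by ring]
  -- Along a subsequence converging to `xs` the next iterate has the same limit, since the steps
  -- vanish.
  have hzc : MapClusterPt (WithLp.toLp 2 (xs, xs)) atTop
      fun k => (WithLp.toLp 2 (Y (k + 1), Y k) :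
        WithLp 2 (EuclideanSpace ℝ (Fin n) × EuclideanSpace ℝ (Fin n))) := by
    obtain ⟨ψ, hψ, hlim⟩ := hYc.tendsto_subseq
    have h1 : Tendsto (fun k => Y (ψ k + 1)) atTop (𝓝 xs) := by
      have h2 : Tendsto (fun k => Y (ψ k + 1) - Y (ψ k)) atTop (𝓝 0) :=
        tendsto_zero_iff_norm_tendsto_zero.2 (hstep.comp hψ.tendsto_atTop)
      simpa using h2.add hlim
    have h3 := ((WithLp.prod_continuous_toLp 2 _ _).tendsto (xs, xs)).comp (h1.prodMk_nhds hlim)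
    exact MapClusterPt.of_comp hψ.tendsto_atTop h3.mapClusterPt
  have hval : Tendsto (fun k => P.f (Y (k + 1)) + Ls / 2 * ‖Y (k + 1) - Y k‖ ^ 2) atTop
      (𝓝 (P.f xs)) := by
    refine hanti.tendsto_of_mapClusterPt ?_
    have hcont : Continuous fun z : WithLp 2 (EuclideanSpace ℝ (Fin n) × EuclideanSpace ℝ (Fin n)) =>
        P.f z.fst + Ls / 2 * ‖z.fst - z.snd‖ ^ 2 := by
      have h1 := WithLp.prod_continuous_ofLp 2 (EuclideanSpace ℝ (Fin n)) (EuclideanSpace ℝ (Fin n))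
      exact (hP.f_continuous.comp h1.fst).add
        (continuous_const.mul ((h1.fst.sub h1.snd).norm.pow 2))
    simpa [Function.comp_def] using hzc.continuousAt_comp hcont.continuousAt
  -- On pairs of consecutive iterates `H` is the Lyapunov function up to a constant. The constant `2
  -- * C + 2 * Ls` adds the bound `C * (2 * d (k + 1) + d k)` for `ζ` to the two components `± Ls •
  -- (Y (k + 2) - Y (k + 1))` of the coupling gradient.
  have hKLD : IsKLDescent (P.HFace Ls xs) (fun k => WithLp.toLp 2 (Y (k + 1), Y k))
      (WithLp.toLp 2 (xs, xs)) (fun k => P.f (Y (k + 1)) + Ls / 2 * ‖Y (k + 1) - Y k‖ ^ 2)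
      (fun k => ‖Y (k + 1) - Y k‖) (P.f xs) (Ls / 2 * (1 - β ^ 2)) (2 * C + 2 * Ls) := by
    refine ⟨hgap, by positivity, fun k => norm_nonneg _, fun k => HFace_of_mem (hYface _), ?_,
      hrdesc, fun k => ?_, fun k => ?_, hval⟩
    · rw [HFace_of_mem hxsface]; simp
    · obtain ⟨ζ, hζ1, hζ2⟩ := hYsub k
      refine ⟨_, mem_subdifferential_HFace hLs.le (hYface (k + 2)) hζ2, ?_⟩
      refine (WithLp.norm_toLp_prod_le _ _).trans ?_
      have h1 := norm_add_le ζ (Ls • (Y (k + 2) - Y (k + 1)))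
      rw [norm_smul, Real.norm_of_nonneg hLs.le] at h1
      rw [norm_neg, norm_smul, Real.norm_of_nonneg hLs.le]
      have h2 := mul_nonneg hC.le (norm_nonneg (Y (k + 1) - Y k))
      have h3 := mul_nonneg hLs.le (norm_nonneg (Y (k + 1) - Y k))
      rw [show k + 1 + 1 = k + 2 from rfl]
      linarith
    · exact (WithLp.norm_toLp_prod_le (Y (k + 2) - Y (k + 1)) (Y (k + 1) - Y k)).trans_eq
        (add_comm _ _)
  have hnonempty : (subdifferential (P.HFace Ls xs) (WithLp.toLp 2 (xs, xs))).Nonempty := by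
    obtain ⟨ζ, hζ⟩ := hP.f_convex.exists_subgradient xs
    exact ⟨_, mem_subdifferential_HFace hLs.le hxsface fun v _ => hζ v⟩
  obtain ⟨hsum, hlim⟩ := hKLD.summable_and_tendsto hzc (hKL _ hnonempty)
  have hYlim : Tendsto Y atTop (𝓝 xs) :=
    ((WithLp.prod_continuous_ofLp 2 _ _).snd.tendsto _).comp hlim
  have hYx : ∀ k, Y k = x (k + (m + 1 + K)) := fun k => by
    simp only [hY, hX]; congr 1; ring
  have hlim' : Tendsto x atTop (𝓝 xs) :=
    (tendsto_add_atTop_iff_nat (m + 1 + K)).1 (hYlim.congr hYx)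
  have hXlim : Tendsto X atTop (𝓝 xs) :=
    ((tendsto_add_atTop_iff_nat K).2 hlim').congr fun k => (hX k).symm
  refine ⟨hlim', hrun.isStrongLocalMinimizer hP ((tendsto_add_atTop_iff_nat 1).2 hXlim), ?_,
    fun α hα hexp => ?_⟩
  · refine (summable_nat_add_iff (m + 1 + K)).1 (hsum.congr fun k => ?_)
    rw [hYx, hYx, show k + 1 + (m + 1 + K) = k + (m + 1 + K) + 1 by ring]
  · have h1 : ConvergesAtKLRate Y xs α := by
      refine (hKLD.convergesAtKLRate hlim hα hexp).of_norm_le fun k => ?_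
      exact WithLp.norm_snd_le _ (WithLp.toLp 2 (Y (k + 1), Y k) - WithLp.toLp 2 (xs, xs))
    rw [funext hYx] at h1
    exact h1.of_tail (m + 1 + K)

end SparseGroupProblem

theorem theorem4p1 {n L : ℕ} (P : SparseGroupProblem n L) (Lf Ls : ℝ)
    (hP : P.StandingAssumptions Lf Ls) (μ : ℕ → ℝ) (hμ : P.IsSchedule μ)
    (x : ℕ → EuclideanSpace ℝ (Fin n)) :
    (P.IsLineSearchRun Ls 0 μ x →
      (∃ xs, MapClusterPt xs atTop x) ∧
      ∀ xs, MapClusterPt xs atTop x → IsKLFunction (P.fFace xs) →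
        Tendsto x atTop (𝓝 xs) ∧ P.IsStrongLocalMinimizer xs ∧
        Summable (fun k => ‖x (k + 1) - x k‖) ∧
        ∀ α : ℝ, 0 ≤ α → α < 1 → HasKLExponentAt (P.fFace xs) xs α →
          ConvergesAtKLRate x xs α) ∧
    (P.IsExtrapolationRun Ls μ x →
      (∃ xs, MapClusterPt xs atTop x) ∧
      ∀ xs, MapClusterPt xs atTop x → IsKLFunction (P.HFace Ls xs) →
        Tendsto x atTop (𝓝 xs) ∧ P.IsStrongLocalMinimizer xs ∧
        Summable (fun k => ‖x (k + 1) - x k‖) ∧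
        ∀ α : ℝ, 0 ≤ α → α < 1 → HasKLExponentAt (P.HFace Ls xs) (WithLp.toLp 2 (xs, xs)) α →
          ConvergesAtKLRate x xs α) := by
  refine ⟨fun h => ⟨h.exists_mapClusterPt hP hμ, fun xs hxs hKL => ?_⟩,
    fun h => ⟨h.exists_mapClusterPt hP hμ, fun xs hxs hKL => ?_⟩⟩
  · obtain ⟨h1, h2, h3, h4⟩ := h.convergence hP hμ hxs hKL
    exact ⟨h1, h2, h3, fun α _ hα => h4 α hα⟩
  · obtain ⟨h1, h2, h3, h4⟩ := h.convergence hP hμ hxs hKL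
    exact ⟨h1, h2, h3, fun α _ hα => h4 α hα⟩
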